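/- Let $k$ be an algebraically closed field of characteristic different from $2$ and $3$. Let $P=k[x_1,\dots,x_n]$, $S=k[[\alpha_1,\dots,\alpha_n]]$, and let $S$ act on $P$ by contraction: $\alpha^{b}\lrcorner x^{a}=x^{a-b}$ if $a\ge b$ componentwise, and $0$ otherwise. For $f\in P$ put $\operatorname{Ann}_S(f)=\{s\in S: s\lrcorner f=0\}$ and $\operatorname{Apolar}(f)=S/\operatorname{Ann}_S(f)$. A finite $k$-algebra $A$ is *smoothable* if it is isomorphic to the fibre over a $k$-point of a finite flat family over an irreducible base of finite type over $k$ whose general fibre is smooth. A smoothable algebra $A$ with a closed embedding $\operatorname{Spec}A\subseteq\mathbb A^n\subseteq\mathbb P^n$, $A=k[\alpha_1,\dots,\alpha_n]/\mathfrak a$, is *unobstructed* if the tangent space $\operatorname{Hom}(\mathfrak a,A)$ to the Hilbert scheme of points at $[\operatorname{Spec}A]$ has dimension $n\dim_kA$. Apolar algebras are embedded through the given variables. For $0\ne f\in P$, a power series $\partial\in S$ in the maximal ideal of $S$ and $d\ge2$, the *$d$-th ray sum* of $f$ with respect to $\partial$ is $g=\sum_{i\ge0}x^{di}\,(\partial^i\lrcorner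 f)\in P[x]$; it is called unobstructed if $\operatorname{Apolar}(g)$ is. Let $\alpha$ be dual to $x$, $T=S[[\alpha]]$, $T_{poly}=k[\alpha_1,\dots,\alpha_n,\alpha]$, and let $\mathcal J=\operatorname{Ann}_S(f)\,T+\alpha\operatorname{Ann}_S(\partial\lrcorner f)\,T$. The ideal defining the *lower ray family* of the $d$-th ray sum is $$\mathfrak I_d=(\mathcal J\cap T_{poly})[t]+(\alpha^d-t\alpha-\partial)\,T_{poly}[t]\subseteq T_{poly}[t],$$ where, if $\partial$ is not a polynomial, it is replaced by any polynomial congruent to it modulo $\mathcal J$ (the ideal does not depend on the choice). Call $d$ *admissible* if $2\le d\le\operatorname{char}k$, or if $2\le d$ and $\operatorname{char}k=0$. **Theorem.** Let $0\ne f\in P$ and $\partial\in S$ be such that $\partial^2\lrcorner f=0$ (so that $\partial$ lies in the maximal ideal of $S$), and suppose that $\operatorname{Apolar}(f)$ and $\operatorname{Apolar}(\partial\lrcorner f)$ are smoothable and unobstructed. Then the following are equivalent: 1. the $d$-th ray sum of $f$ with respect to $\partial$ is unobstructed for some admissible $d$; 1a. the $d$-th ray sum of $f$ with respect to $\partial$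 is unobstructed for every admissible $d$; 2. the $k[t]$-module $\mathfrak I_d/\mathfrak I_d^2$ is flat for some admissible $d$; 2a. the $k[t]$-module $\mathfrak I_d/\mathfrak I_d^2$ is flat for every admissible $d$; 3. the family $k[t]\to T_{poly}[t]/\mathfrak I_d^2$ is flat for some admissible $d$; 3a. the family $k[t]\to T_{poly}[t]/\mathfrak I_d^2$ is flat for every admissible $d$; 4. $I\cap J^2\cap(I^2:\partial)\subseteq IJ$, where $I=\operatorname{Ann}_S(f)$ and $J=\operatorname{Ann}_S(\partial\lrcorner f)$; 4a. $I\cap J^2\cap(I^2:\partial)=IJ$, with the same $I$ and $J$. -/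

import Mathlib

universe u

noncomputable section

namespace RayFamily

open Finset

/-! ### Contraction and apolar algebras -/

section Apolar

variable {k : Type u} [Field k] {σ : Type} [DecidableEq σ]

/-- The contraction action `s ⌟ f` of power series on polynomials, as a `k`-linear map in `f`:
on monomials it is `x ^ a ↦ ∑_{b + c = a} s_b x ^ c`, that is, `α ^ b` sends `x ^ a` to
`x ^ (a - b)` if `b ≤ a` and to `0` otherwise. -/
def contract (s : MvPowerSeries σ k) : MvPolynomial σ k →ₗ[k] MvPolynomial σ k :=
  (MvPolynomial.basisMonomials σ k).constr k fun a =>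
    ∑ p ∈ antidiagonal a, MvPolynomial.monomial p.2 (MvPowerSeries.coeff p.1 s)

theorem contract_monomial (s : MvPowerSeries σ k) (a : σ →₀ ℕ) :
    contract s (MvPolynomial.monomial a 1) =
      ∑ p ∈ antidiagonal a, MvPolynomial.monomial p.2 (MvPowerSeries.coeff p.1 s) := by
  have h := (MvPolynomial.basisMonomials σ k).constr_basis k (fun a =>
    ∑ p ∈ antidiagonal a, MvPolynomial.monomial p.2 (MvPowerSeries.coeff p.1 s)) a
  rwa [MvPolynomial.coe_basisMonomials] at h

theorem contract_add (s u : MvPowerSeries σ k) : contract (s + u) = contract s + contract u := by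
  refine (MvPolynomial.basisMonomials σ k).ext fun a => ?_
  simp [contract_monomial, Finset.sum_add_distrib]

theorem contract_mul (s u : MvPowerSeries σ k) :
    contract (s * u) = contract s ∘ₗ contract u := by
  refine (MvPolynomial.basisMonomials σ k).ext fun a => ?_
  have hm : ∀ (b : σ →₀ ℕ) (r : k), MvPolynomial.monomial b r =
      r • (MvPolynomial.monomial b 1 : MvPolynomial σ k) := fun b r => by
    rw [MvPolynomial.smul_monomial, smul_eq_mul, mul_one]
  have hc : ∀ (b : σ →₀ ℕ) (r : k), contract s (MvPolynomial.monomial b r) =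
      ∑ p ∈ antidiagonal b, MvPolynomial.monomial p.2 (r * MvPowerSeries.coeff p.1 s) :=
    fun b r => by
      rw [hm, map_smul, contract_monomial, Finset.smul_sum]
      simp [MvPolynomial.smul_monomial]
  simp only [MvPolynomial.coe_basisMonomials, LinearMap.comp_apply, contract_monomial, map_sum,
    hc, MvPowerSeries.coeff_mul]
  rw [Finset.sum_sigma', Finset.sum_sigma']
  refine Finset.sum_nbij' (fun x => ⟨(x.2.2, x.2.1 + x.1.2), (x.2.1, x.1.2)⟩)
    (fun x => ⟨(x.2.1 + x.1.1, x.2.2), (x.2.1, x.1.1)⟩) ?_ ?_ ?_ ?_ ?_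
  all_goals
    rintro ⟨⟨a, b⟩, c, d⟩ h
    simp only [mem_sigma, HasAntidiagonal.mem_antidiagonal] at h ⊢
    obtain ⟨rfl, rfl⟩ := h
  · exact ⟨by abel, trivial⟩
  · exact ⟨by abel, trivial⟩
  · rfl
  · rfl
  · rw [mul_comm]

/-- The annihilator `Ann(f) = {s : s ⌟ f = 0}`, an ideal of the power series ring. -/
def ann (f : MvPolynomial σ k) : Ideal (MvPowerSeries σ k) where
  carrier := {s | contract s f = 0}
  add_mem' := by
    intro s u hs hu
    change contract s f = 0 at hs
    change contract u f = 0 at hu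
    change contract (s + u) f = 0
    rw [contract_add, LinearMap.add_apply, hs, hu, add_zero]
  zero_mem' := by
    have h := contract_add (0 : MvPowerSeries σ k) 0
    rw [add_zero, left_eq_add] at h
    simp [h]
  smul_mem' := by
    intro c s hs
    change contract s f = 0 at hs
    change contract (c * s) f = 0
    rw [contract_mul, LinearMap.comp_apply, hs, map_zero]

/-- The apolar algebra of `f`. -/
abbrev Apolar (f : MvPolynomial σ k) : Type u := MvPowerSeries σ k ⧸ ann f

/-- The presentation of the apolar algebra of `f` as a quotient of the polynomial ring, i.e. the
closed embedding of its spectrum into the affine space with coordinates indexed by `σ`. -/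
def apolarPresentation (f : MvPolynomial σ k) : MvPolynomial σ k →ₐ[k] Apolar f :=
  (Ideal.Quotient.mkₐ k (ann f)).comp (MvPolynomial.coeToMvPowerSeries.algHom k)

end Apolar

/-! ### Smoothable and unobstructed algebras -/

section Smoothable

/-- A finite `k`-algebra `A` (with `k` algebraically closed) is smoothable if there is a finite
flat family `B → C` over an irreducible affine base `Spec B` of finite type over `k` whose fibre
over some `k`-point is isomorphic to `A` and whose fibre over a general `k`-point, i.e. over every
`k`-point of some nonempty open subset `{r ≠ 0}` of the base, is smooth. -/
def IsSmoothable (k : Type u) [Field k] (A : Type u) [CommRing A] [Algebra k A] : Prop :=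
  ∃ (B C : Type u) (_ : CommRing B) (_ : CommRing C) (_ : Algebra k B) (_ : Algebra B C)
    (_ : Algebra k C) (_ : IsScalarTower k B C),
    Algebra.FiniteType k B ∧ IrreducibleSpace (PrimeSpectrum B) ∧
    Module.Finite B C ∧ Module.Flat B C ∧
    (∃ φ : B →ₐ[k] k, Nonempty (A ≃ₐ[k] (C ⧸ (RingHom.ker φ).map (algebraMap B C)))) ∧
    ∃ r : B, ¬ IsNilpotent r ∧ ∀ φ : B →ₐ[k] k, φ r ≠ 0 →
      Algebra.Smooth k (C ⧸ (RingHom.ker φ).map (algebraMap B C))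

variable {k : Type u} [Field k] {σ : Type} [Fintype σ]

/-- The tangent space `Hom_R(I, R/I)` to the Hilbert scheme of points at the `k`-point given by
the closed subscheme `Spec R/I` of affine space, `R = k[α_i : i ∈ σ]`, i.e. the space of global
sections of the normal sheaf of this subscheme. -/
abbrev HilbTangentSpace (I : Ideal (MvPolynomial σ k)) : Type u :=
  I →ₗ[MvPolynomial σ k] (MvPolynomial σ k ⧸ I)

/-- Let `π` be a surjection onto a finite `k`-algebra `A` from the polynomial ring in `n = |σ|`
variables, so that `Spec A` is a closed subscheme of the affine `n`-space, hence of the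
projective `n`-space. Then `A` is (smoothable and) unobstructed if it is smoothable and the
tangent space to the Hilbert scheme at `[Spec A]` has dimension `n * dim_k A`. -/
def IsUnobstructed {A : Type u} [CommRing A] [Algebra k A] (π : MvPolynomial σ k →ₐ[k] A) :
    Prop :=
  IsSmoothable k A ∧
    Module.finrank k (HilbTangentSpace (RingHom.ker π)) = Fintype.card σ * Module.finrank k A

end Smoothable

/-! ### Ray families

The base ring `k[t]` is `Polynomial k`, and the polynomial ring over `k[t]` in the variables
indexed by `σ` is `MvPolynomial σ (Polynomial k)`. -/

section LowerRay

variable {k : Type u} [Field k] {σ : Type}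

/-- The ideal `J_poly[t] + (α_i ^ ν - t α_i - q)` defining the lower ray family attached to the
ray decomposition `J + (α_i ^ ν - q)`, where `J_poly` is the set of polynomials in `J`. Since this
ideal depends only on `q` modulo `J`, the power series `q` is replaced by the polynomials that
are congruent to it modulo `J` (one of them is `q` itself if `q` is a polynomial). -/
def lowerRayIdeal (i : σ) (J : Ideal (MvPowerSeries σ k)) (ν : ℕ) (q : MvPowerSeries σ k) :
    Ideal (MvPolynomial σ (Polynomial k)) :=
  (J.comap MvPolynomial.coeToMvPowerSeries.ringHom).map (MvPolynomial.map Polynomial.C) ⊔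
    Ideal.span {w | ∃ p : MvPolynomial σ k, (p : MvPowerSeries σ k) - q ∈ J ∧
      w = MvPolynomial.X i ^ ν - MvPolynomial.C Polynomial.X * MvPolynomial.X i
        - MvPolynomial.map Polynomial.C p}

end LowerRay

/-! ### Ray sums

The variables of `P` and `S` are indexed by `Fin n`; those of `P[x]` and of the dual ring
`T = S[[α]]` by `Option (Fin n)`, where `none` stands for the new variable `x`, respectively
`α`. -/

section RaySum

variable {k : Type u} [Field k] {n : ℕ}

/-- The `d`-th ray sum `f + x ^ d (∂ ⌟ f) + x ^ (2 d) (∂ ^ 2 ⌟ f) + ⋯`. For `∂` in the maximal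
ideal the terms with exponent of `∂` greater than `deg f` vanish. -/
def raySum (d : ℕ) (f : MvPolynomial (Fin n) k) (D : MvPowerSeries (Fin n) k) :
    MvPolynomial (Option (Fin n)) k :=
  ∑ i ∈ range (f.totalDegree + 1),
    MvPolynomial.X none ^ (d * i) * MvPolynomial.rename some (contract (D ^ i) f)

/-- The inclusion of `S` into `T = S[[α]]`. -/
def inclT : MvPowerSeries (Fin n) k →ₐ[k] MvPowerSeries (Option (Fin n)) k :=
  MvPowerSeries.rename some

/-- The ideal `Ann(f) T + α Ann(∂ ⌟ f) T` of the ray decomposition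
`Ann(g) = Ann(f) T + α Ann(∂ ⌟ f) T + (α ^ d - ∂) T` of the annihilator of a ray sum `g`. -/
def raySumJ (f : MvPolynomial (Fin n) k) (D : MvPowerSeries (Fin n) k) :
    Ideal (MvPowerSeries (Option (Fin n)) k) :=
  (ann f).map inclT ⊔
    Ideal.span {MvPowerSeries.X none} * (ann (contract D f)).map inclT

/-- The ideal of `T_poly[t]` that defines the lower ray family of the `d`-th ray sum of `f` with
respect to `∂`. -/
def raySumLowerIdeal (d : ℕ) (f : MvPolynomial (Fin n) k) (D : MvPowerSeries (Fin n) k) :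
    Ideal (MvPolynomial (Option (Fin n)) (Polynomial k)) :=
  lowerRayIdeal none (raySumJ f D) d (inclT D)

end RaySum

/-- The exponents `2 ≤ d ≤ char k` (all `d ≥ 2` if `char k = 0`). -/
def Admissible (k : Type u) [Field k] (d : ℕ) : Prop :=
  2 ≤ d ∧ (ringChar k = 0 ∨ d ≤ ringChar k)

end RayFamily

end

/-!
Write `R = k[α₁, …, αₙ]`, `I` and `J` for the ideals of polynomials that annihilate `f` and
`∂ ⌟ f`, and `p` for a polynomial congruent to `∂` modulo `Ann(f) ^ 2`. Then `I ⊆ J` and `p J ⊆ I`,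
and `p ∈ J` because `∂ ^ 2 ⌟ f = 0`. Ideals of power series that contain a power of the maximal
ideal correspond to ideals of `R`, compatibly with products (`comap_mul_toSeries`), so that
the condition `I ⊓ J ^ 2 ⊓ (I ^ 2 : ∂) = I J` may be tested in `R` (`ann_inf_eq_iff`). The exponent
`d` does not occur in it. Hence it suffices to show, for each single admissible `d`, that
unobstructedness of the ray sum and flatness of either module are equivalent to this condition
(`tfae_of_admissible`). All three turn out to be statements about one number, the colength of the
square of the ideal of the special fibre of the lower ray family.

*Unobstructedness is a colength.* An apolar algebra `A = R ⧸ 𝔞` is Gorenstein: the constant term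
of `s ⌟ f` is a nondegenerate functional on it. Therefore `Hom(𝔞, A)` is dual to `𝔞 ⧸ 𝔞 ^ 2`
(`finrank_hom_add_finrank_quotient`), and a smoothable `A` is unobstructed if and only if the
colength of `𝔞 ^ 2` is `n + 1` times that of `𝔞` (`isUnobstructed_apolar_iff`).

*The fibres.* The fibre of the lower ray family at `t = a` has the ideal
`𝔞_a = I + X J + (X ^ d - a X - p)` in `R[X]` (`map_fibreMap_raySumLowerIdeal`), and that at `t = 0`
is the spectrum of the apolar algebra of the ray sum (`comap_annPoly_raySum`). Division by the monic
polynomial `X ^ d - a X - p` shows that the colength of `𝔞_a` is that of `I` plus `d - 1` times that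
of `J`, for every `a` (`finrank_quotient_rayIdeal`).

*The general fibres.* For `a ≠ 0` one has `𝔞_a = (I, X + p / a) (J, X ^ (d - 1) - a)` with coprime
factors (`rayIdeal_eq_mul`). Since the algebras of `I` and `J` are unobstructed, the colength of
`𝔞_a ^ 2` is the expected one, `n + 2` times that of `𝔞_a` (`finrank_quotient_rayIdeal_sq_general`).

*The special fibre.* Put `δ = X ^ d - p`. The ideals `𝔞_0 ^ 2 + (δ)` and `(𝔞_0 ^ 2 : δ)` consist of
the polynomials whose remainder modulo `δ` has its coefficients in certain ideals of `R`
(`rayIdeal_sq_sup`, `rayPoly_mul_mem_iff`). Adding up colengths, that of `𝔞_0 ^ 2` exceeds the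
expected one by `dim (I ⊓ J ^ 2 ⊓ (I ^ 2 : p)) ⧸ I J`. So it is the expected one if and only if the
condition on the ideals holds (`finrank_quotient_rayIdeal_sq_iff`).

*Flatness.* A finite module over the affine line whose fibres at `a ≠ 0` have constant dimension is
flat if and only if the fibre at `0` has this dimension (`flat_iff_finrank_fibre`). This shows that
the family itself is flat and that flatness of the quotient by the square of its ideal is the
condition on the ideals. As the family is flat, the conormal module is flat together with this
quotient (`flat_cotangent_iff`).

*Smoothability of the ray sum.* It remains to see that the apolar algebra of the ray sum is
smoothable. The general fibres are disjoint unions of one copy of the scheme of `I` and `d - 1`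
copies of the scheme of `J`, because `X ^ (d - 1) - a` has distinct roots for an admissible `d`;
this is the only use of admissibility. That finite products and limits of smoothable algebras are
smoothable (`IsSmoothable.prod`, `IsSmoothable.of_family`) follows from a description by structure
constants: an algebra is smoothable if and only if its structure constants lie in the Zariski
closure of those of the split algebra `k ^ r` (`IsSmoothable.isLimitOfSplit`,
`IsLimitOfSplit.isSmoothable`).
-/

noncomputable section

namespace RayFamily

open Module

section

/-! ### Finite smooth algebras -/

theorem isAdicComplete_sq {R : Type*} [CommRing R] (I : Ideal R) [IsAdicComplete I R] :
    IsAdicComplete (I ^ 2) R where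
  haus' := fun x hx => by
    refine IsHausdorff.haus (I := I) inferInstance x fun n => ?_
    refine (hx n).mono ?_
    rw [← pow_mul]
    exact Submodule.smul_mono_left (Ideal.pow_le_pow_right (by omega))
  prec' := fun f hf => by
    obtain ⟨L, hL⟩ := IsPrecomplete.prec (I := I) inferInstance (f := f) fun {m n} hmn => by
      refine (hf hmn).mono ?_
      rw [← pow_mul]
      exact Submodule.smul_mono_left (Ideal.pow_le_pow_right (by omega))
    refine ⟨L, fun n => (hf (show n ≤ 2 * n by omega)).trans ?_⟩
    rw [← pow_mul]
    exact hL (2 * n)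

/-- A finite smooth algebra over an algebraically closed field is unramified: a nonzero
derivation with values in `k` would lift to a nonconstant curve `Spec k⟦X⟧ → Spec A`. -/
theorem formallyUnramified_of_formallySmooth (k : Type u) [Field k] [IsAlgClosed k] (A : Type u)
    [CommRing A] [Algebra k A] [Module.Finite k A] [Algebra.FormallySmooth k A] :
    Algebra.FormallyUnramified k A := by
  by_contra hun
  rw [Algebra.formallyUnramified_iff, not_subsingleton_iff_nontrivial] at hun
  have : Module.Finite A (Ω[A⁄k]) := inferInstance
  obtain ⟨N, hN⟩ := IsCoatomic.exists_coatom (Submodule A (Ω[A⁄k]))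
  have hs : IsSimpleModule A (Ω[A⁄k] ⧸ N) := by
    rwa [isSimpleModule_iff_isCoatom]
  obtain ⟨m, hm, ⟨e⟩⟩ := isSimpleModule_iff_quot_maximal.mp hs
  let _ := Ideal.Quotient.field m
  have hbij : Function.Bijective (algebraMap k (A ⧸ m)) :=
    IsAlgClosed.algebraMap_bijective_of_isIntegral
  let ψ : (A ⧸ m) ≃ₐ[k] k := (AlgEquiv.ofBijective (Algebra.ofId k (A ⧸ m)) hbij).symm
  let χ : A →ₐ[k] k := (ψ : (A ⧸ m) →ₐ[k] k).comp (Ideal.Quotient.mkₐ k m)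
  let d : A → k := fun a => ψ (e (N.mkQ (KaehlerDifferential.D k A a)))
  have hdadd : ∀ a b, d (a + b) = d a + d b := fun a b => by simp [d]
  have hdmul : ∀ a b, d (a * b) = χ a * d b + χ b * d a := fun a b => by
    simp only [d, χ, Derivation.leibniz, map_add, map_smul]
    simp [Algebra.smul_def]
  have hdalg : ∀ c, d (algebraMap k A c) = 0 := fun c => by simp [d]
  obtain ⟨a, ha⟩ : ∃ a, d a ≠ 0 := by
    by_contra! h
    refine hN.1 (eq_top_iff.mpr ?_)
    rw [← KaehlerDifferential.span_range_derivation k A, Submodule.span_le]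
    rintro _ ⟨a, rfl⟩
    have := h a
    simpa [d] using this
  let I : Ideal (PowerSeries k) := Ideal.span {PowerSeries.X}
  have := isAdicComplete_sq I
  have hmem : ∀ s : PowerSeries k, s ∈ I ^ 2 ↔ PowerSeries.X ^ 2 ∣ s := fun s => by
    rw [Ideal.span_singleton_pow, Ideal.mem_span_singleton]
  have hX2 : (Ideal.Quotient.mk (I ^ 2) PowerSeries.X) ^ 2 = 0 := by
    rw [← map_pow, Ideal.Quotient.eq_zero_iff_mem, hmem]
  -- the tangent vector `d` at the point `χ`, as a homomorphism to the dual numbers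
  let F : A →ₐ[k] PowerSeries k ⧸ I ^ 2 := AlgHom.ofLinearMap
    { toFun := fun a =>
        algebraMap k _ (χ a) + algebraMap k _ (d a) * Ideal.Quotient.mk _ PowerSeries.X
      map_add' := fun a b => by simp only [map_add, hdadd]; ring
      map_smul' := fun c a => by
        simp only [Algebra.smul_def, map_mul, hdmul, hdalg, AlgHom.commutes, RingHom.id_apply,
          Algebra.algebraMap_self_apply, mul_zero, add_zero]
        ring }
    (by
      have : d 1 = 0 := by simpa using hdalg 1
      simp [this])
    (fun a b => by
      simp only [LinearMap.coe_mk, AddHom.coe_mk, map_mul, hdmul, map_add]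
      linear_combination (- (algebraMap k _ (d a)) * (algebraMap k _ (d b))) * hX2)
  obtain ⟨g, hg⟩ := Algebra.FormallySmooth.exists_mkₐ_comp_eq_of_isAdicComplete F
  -- the image of `A` in `k⟦X⟧` is a finite domain over `k`, so that the curve is constant
  obtain ⟨c, hc⟩ : ∃ c : k, algebraMap k (PowerSeries k) c = g a := by
    have : Algebra.IsIntegral k g.range :=
      Algebra.IsIntegral.of_surjective g.rangeRestrict g.rangeRestrict_surjective
    obtain ⟨c, hc⟩ := (IsAlgClosed.algebraMap_bijective_of_isIntegral (k := k) (K := g.range)).2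
      ⟨g a, ⟨a, rfl⟩⟩
    exact ⟨c, congr_arg Subtype.val hc⟩
  have h1 := congr($hg a)
  rw [AlgHom.comp_apply, ← hc] at h1
  have h2 : (PowerSeries.C c - PowerSeries.C (χ a) - PowerSeries.C (d a) * PowerSeries.X :
      PowerSeries k) ∈ I ^ 2 := by
    rw [← Ideal.Quotient.eq_zero_iff_mem]
    simp only [map_sub, sub_eq_zero, sub_sub]
    exact h1
  rw [hmem] at h2
  have := PowerSeries.X_pow_dvd_iff.mp h2 1 (by norm_num)
  simp at this
  exact ha this

/-- A finite smooth algebra over an algebraically closed field is split. -/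
theorem exists_algEquiv_pi_of_smooth (k : Type u) [Field k] [IsAlgClosed k] (A : Type u)
    [CommRing A] [Algebra k A] [Module.Finite k A] [Algebra.Smooth k A] :
    ∃ ι : Type u, ∃ _ : Fintype ι, Nonempty (A ≃ₐ[k] (ι → k)) := by
  have := formallyUnramified_of_formallySmooth k A
  have : Algebra.FormallyEtale k A := Algebra.FormallyEtale.of_formallyUnramified_of_field k A
  have := IsArtinianRing.of_finite k A
  have : Fintype (PrimeSpectrum A) := Fintype.ofFinite _
  exact ⟨_, this, ⟨Algebra.FormallyEtale.equivPiOfIsSepClosed k A⟩⟩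

end

section

/-! ### Structure constants -/

section StructureConstants

variable {R R' A A' : Type*} [CommRing R] [CommRing R'] [CommRing A] [CommRing A'] [Algebra R A]
  [Algebra R' A'] {ι κ : Type}

/-- The index set of the coordinates of an algebra with a basis indexed by `ι`: the structure
constants of the multiplication and the coordinates of the unit element. -/
abbrev StructIndex (ι : Type) : Type := (ι × ι × ι) ⊕ ι

/-- The structure constants of an algebra with respect to a basis, together with the coordinates
of its unit element. -/
def structConst (b : Basis ι R A) : StructIndex ι → R :=
  Sum.elim (fun s => b.repr (b s.1 * b s.2.1) s.2.2) (fun i => b.repr 1 i)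

theorem repr_of_semilinear [Fintype ι] (χ : R →+* R') (Φ : A →+* A')
    (hΦ : ∀ r, Φ (algebraMap R A r) = algebraMap R' A' (χ r)) (b : Basis ι R A)
    (b' : Basis ι R' A') (hb : ∀ i, b' i = Φ (b i)) (a : A) (i : ι) :
    b'.repr (Φ a) i = χ (b.repr a i) := by
  classical
  have h : Φ a = ∑ j, χ (b.repr a j) • b' j := by
    conv_lhs => rw [← b.sum_repr a]
    simp [Algebra.smul_def, hΦ, hb]
  rw [h, Basis.repr_sum_self]

theorem structConst_of_semilinear [Fintype ι] (χ : R →+* R') (Φ : A →+* A')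
    (hΦ : ∀ r, Φ (algebraMap R A r) = algebraMap R' A' (χ r)) (b : Basis ι R A)
    (b' : Basis ι R' A') (hb : ∀ i, b' i = Φ (b i)) :
    structConst b' = χ ∘ structConst b := by
  funext s
  rcases s with ⟨i, j, l⟩ | i
  · simp only [structConst, Sum.elim_inl, Function.comp_apply]
    rw [hb, hb, ← map_mul]
    exact repr_of_semilinear χ Φ hΦ b b' hb _ _
  · simp only [structConst, Sum.elim_inr, Function.comp_apply]
    rw [← map_one Φ]
    exact repr_of_semilinear χ Φ hΦ b b' hb _ _

theorem structConst_map {A₂ : Type*} [CommRing A₂] [Algebra R A₂] (b : Basis ι R A)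
    (e : A ≃ₐ[R] A₂) : structConst (b.map e.toLinearEquiv) = structConst b := by
  funext s
  rcases s with ⟨i, j, l⟩ | i <;> simp [structConst]

/-- Algebras with the same structure constants are isomorphic. -/
theorem nonempty_algEquiv_of_structConst_eq {A₂ : Type*} [CommRing A₂] [Algebra R A₂]
    (b : Basis ι R A) (b₂ : Basis ι R A₂) (h : structConst b = structConst b₂) :
    Nonempty (A ≃ₐ[R] A₂) := by
  let e : A ≃ₗ[R] A₂ := b.equiv b₂ (Equiv.refl ι)
  have he : ∀ a, b₂.repr (e a) = b.repr a := fun a => by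
    simp [e, Basis.equiv]
  have hbe : ∀ i, e (b i) = b₂ i := fun i => by simp [e]
  have h1 : e 1 = 1 := by
    apply b₂.repr.injective
    rw [he]
    ext i
    exact congr_fun h (Sum.inr i)
  have hm : ∀ i j, e (b i * b j) = e (b i) * e (b j) := fun i j => by
    apply b₂.repr.injective
    rw [he, hbe, hbe]
    ext l
    exact congr_fun h (Sum.inl (i, j, l))
  have hlin : (LinearMap.mul R A).compr₂ e.toLinearMap =
      (LinearMap.mul R A₂).compl₁₂ e.toLinearMap e.toLinearMap :=
    b.ext fun i => b.ext fun j => by simpa using hm i j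
  refine ⟨AlgEquiv.ofLinearEquiv e h1 fun x y => ?_⟩
  simpa using congr($hlin x y)

/-- A basis of an algebra over `R` induces a basis of its fibre along a surjection
`χ : R → R'`. -/
theorem exists_basis_fibre [Fintype ι] (b : Basis ι R A) (χ : R →+* R') (Φ : A →+* A')
    (hχ : Function.Surjective χ) (hΦs : Function.Surjective Φ)
    (hΦ : ∀ r, Φ (algebraMap R A r) = algebraMap R' A' (χ r))
    (hker : RingHom.ker Φ ≤ (RingHom.ker χ).map (algebraMap R A)) :
    ∃ b' : Basis ι R' A', ∀ i, b' i = Φ (b i) := by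
  classical
  have hcoord : ∀ a ∈ (RingHom.ker χ).map (algebraMap R A), ∀ i, χ (b.repr a i) = 0 := by
    intro a ha
    induction ha using Submodule.span_induction with
    | mem x hx =>
      obtain ⟨r, hr, rfl⟩ := hx
      intro i
      rw [Algebra.algebraMap_eq_smul_one, map_smul, Finsupp.smul_apply, smul_eq_mul, map_mul,
        (RingHom.mem_ker).mp hr, zero_mul]
    | zero => simp
    | add x y _ _ hx hy => intro i; simp [hx i, hy i]
    | smul c x _ hx =>
      intro i
      have h : c * x = ∑ j, b.repr x j • (c * b j) := by
        conv_lhs => rw [← b.sum_repr x, Finset.mul_sum]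
        simp only [mul_smul_comm]
      rw [smul_eq_mul, h]
      simp [hx]
  have hsum : ∀ a, Φ a = ∑ j, χ (b.repr a j) • Φ (b j) := fun a => by
    conv_lhs => rw [← b.sum_repr a]
    simp [Algebra.smul_def, hΦ]
  have hli : LinearIndependent R' (fun i => Φ (b i)) := by
    rw [Fintype.linearIndependent_iff]
    intro g hg i
    choose y hy using fun i => hχ (g i)
    have h0 : Φ (∑ j, y j • b j) = 0 := by
      rw [← hg]
      simp [Algebra.smul_def, hΦ, hy]
    have := hcoord _ (hker h0) i
    rwa [Basis.repr_sum_self, hy] at this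
  have hsp : ⊤ ≤ Submodule.span R' (Set.range fun i => Φ (b i)) := by
    intro x _
    obtain ⟨a, rfl⟩ := hΦs x
    rw [hsum]
    exact Submodule.sum_mem _ fun j _ => Submodule.smul_mem _ _ (Submodule.subset_span ⟨j, rfl⟩)
  exact ⟨Basis.mk hli hsp, fun i => Basis.mk_apply hli hsp i⟩

/-- The structure constants of a product algebra in terms of those of the factors. -/
def prodConst (u : StructIndex ι → R) (v : StructIndex κ → R) : StructIndex (ι ⊕ κ) → R
  | .inl (.inl i, .inl j, .inl l) => u (.inl (i, j, l))
  | .inl (.inr i, .inr j, .inr l) => v (.inl (i, j, l))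
  | .inl _ => 0
  | .inr (.inl i) => u (.inr i)
  | .inr (.inr i) => v (.inr i)

theorem structConst_prod {A₂ : Type*} [CommRing A₂] [Algebra R A₂] (b : Basis ι R A)
    (b₂ : Basis κ R A₂) : structConst (b.prod b₂) = prodConst (structConst b) (structConst b₂) := by
  funext s
  rcases s with ⟨i | i, j | j, l | l⟩ | i | i <;>
    simp [structConst, prodConst, Basis.prod_repr_inl, Basis.prod_repr_inr]

/-- The discriminant as a polynomial in the structure constants: the determinant of the matrix of
the traces of the products of two basis elements. -/
def discrConst [Fintype ι] [DecidableEq ι] (u : StructIndex ι → R) : R :=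
  Matrix.det (Matrix.of fun i j => ∑ l, ∑ m, u (.inl (i, j, l)) * u (.inl (l, m, m)))

theorem map_discrConst [Fintype ι] [DecidableEq ι] (χ : R →+* R') (u : StructIndex ι → R) :
    χ (discrConst u) = discrConst (χ ∘ u) := by
  rw [discrConst, RingHom.map_det, discrConst]
  congr 1
  ext i j
  simp

theorem discr_eq_discrConst [Fintype ι] [DecidableEq ι] (b : Basis ι R A) :
    Algebra.discr R b = discrConst (structConst b) := by
  have ht : ∀ a, Algebra.trace R A a = ∑ m, b.repr (a * b m) m := fun a => by
    rw [Algebra.trace_eq_matrix_trace b, Matrix.trace]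
    simp [Algebra.leftMulMatrix_eq_repr_mul]
  rw [Algebra.discr_def, discrConst]
  congr 1
  ext i j
  rw [Algebra.traceMatrix_apply, Algebra.traceForm_apply, Matrix.of_apply]
  conv_lhs => rw [← b.sum_repr (b i * b j)]
  rw [map_sum]
  refine Finset.sum_congr rfl fun l _ => ?_
  rw [map_smul, ht, smul_eq_mul, Finset.mul_sum]
  rfl

theorem discrConst_basisFun [Fintype ι] [DecidableEq ι] :
    discrConst (structConst (Pi.basisFun R ι)) = 1 := by
  rw [discrConst]
  convert Matrix.det_one (n := ι) (R := R)
  ext i j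
  simp [structConst, Pi.single_apply, Matrix.one_apply]
  exact if_congr eq_comm rfl rfl

end StructureConstants

end

section

/-! ### Smoothable algebras as limits of split algebras -/

/-- The structure constants of the basis `b` lie in the Zariski closure of the set of structure
constants of all bases of the split algebra `ι → k`. -/
def IsLimitOfSplit {k : Type*} [Field k] {A : Type*} [CommRing A] [Algebra k A] {ι : Type}
    (b : Basis ι k A) : Prop :=
  ∀ F : MvPolynomial (StructIndex ι) k,
    (∀ e : Basis ι k (ι → k), MvPolynomial.eval (structConst e) F = 0) →
      MvPolynomial.eval (structConst b) F = 0

/-- A finite algebra over an algebraically closed field with nonzero discriminant is smooth: a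
nilpotent element has trace zero against every element, so that the algebra is reduced. -/
theorem smooth_of_discr_ne_zero {k : Type u} [Field k] [IsAlgClosed k] {A : Type u} [CommRing A]
    [Algebra k A] {ι : Type} [Fintype ι] [DecidableEq ι] (b : Basis ι k A)
    (h : Algebra.discr k b ≠ 0) : Algebra.Smooth k A := by
  have : Module.Finite k A := .of_basis b
  have : IsArtinianRing A := IsArtinianRing.of_finite k A
  have hred : IsReduced A := ⟨fun x hx => by
    have h0 : (Algebra.traceMatrix k b).mulVec (b.equivFun x) = 0 := by
      rw [Algebra.traceMatrix_of_basis_mulVec]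
      funext i
      have hxb : IsNilpotent (x * b i) := (Commute.all x (b i)).isNilpotent_mul_right hx
      exact (LinearMap.isNilpotent_trace_of_isNilpotent
        (hxb.map (Algebra.lmul k A))).eq_zero
    have := Matrix.eq_zero_of_mulVec_eq_zero h h0
    simpa using this⟩
  let e : A ≃ₐ[k] ∀ m : MaximalSpectrum A, A ⧸ m.asIdeal :=
    (IsArtinianRing.equivPi A).restrictScalars k
  have hm : ∀ m : MaximalSpectrum A, Algebra.FormallyEtale k (A ⧸ m.asIdeal) := fun m => by
    let _ := Ideal.Quotient.field m.asIdeal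
    exact Algebra.FormallyEtale.of_equiv (AlgEquiv.ofBijective (Algebra.ofId k (A ⧸ m.asIdeal))
      IsAlgClosed.algebraMap_bijective_of_isIntegral)
  have : Algebra.FormallyEtale k (∀ m : MaximalSpectrum A, A ⧸ m.asIdeal) :=
    (Algebra.FormallyEtale.pi_iff _).mpr hm
  have : Algebra.FormallyEtale k A := Algebra.FormallyEtale.of_equiv e.symm
  have : Algebra.FinitePresentation k A :=
    Algebra.FinitePresentation.of_finiteType.mp inferInstance
  exact { }

/-- The determinant of the generic square matrix. -/
abbrev genericDet (k : Type u) [Field k] (ι : Type) [Fintype ι] [DecidableEq ι] :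
    MvPolynomial (ι × ι) k :=
  Matrix.det (Matrix.of fun i j => MvPolynomial.X (i, j))

theorem eval_genericDet {k : Type u} [Field k] {ι : Type} [Fintype ι] [DecidableEq ι]
    (M : Matrix ι ι k) : MvPolynomial.eval (fun p => M p.1 p.2) (genericDet k ι) = M.det := by
  rw [genericDet, RingHom.map_det]
  congr 1
  ext i j
  simp

theorem genericDet_ne_zero {k : Type u} [Field k] {ι : Type} [Fintype ι] [DecidableEq ι] :
    genericDet k ι ≠ 0 := fun h => by
  have := eval_genericDet (1 : Matrix ι ι k)
  rw [h] at this
  simp at this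

/-- The coordinate ring of the general linear group. -/
abbrev GLRing (k : Type u) [Field k] (ι : Type) [Fintype ι] [DecidableEq ι] : Type u :=
  Localization.Away (genericDet k ι)

section Generic

variable (k : Type u) [Field k] (ι : Type) [Fintype ι] [DecidableEq ι]

instance : IsDomain (GLRing k ι) :=
  IsLocalization.isDomain_localization
    (powers_le_nonZeroDivisors_of_noZeroDivisors genericDet_ne_zero)

/-- The generic invertible matrix. -/
def genericMatrix : Matrix ι ι (GLRing k ι) :=
  Matrix.of fun i j => algebraMap (MvPolynomial (ι × ι) k) _ (MvPolynomial.X (i, j))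

theorem isUnit_det_genericMatrix : IsUnit (genericMatrix k ι).det := by
  have h : (genericMatrix k ι).det = algebraMap (MvPolynomial (ι × ι) k) _ (genericDet k ι) := by
    rw [RingHom.map_det]
    rfl
  rw [h]
  exact IsLocalization.Away.algebraMap_isUnit _

/-- The basis of the split algebra over the coordinate ring of `GL` formed by the rows of the
generic invertible matrix. -/
def genericBasis : Basis ι (GLRing k ι) (ι → GLRing k ι) :=
  (Pi.basisFun _ ι).map (LinearEquiv.ofIsUnitDet (f := Matrix.toLin' (genericMatrix k ι).transpose)
    (v := Pi.basisFun _ ι) (v' := Pi.basisFun _ ι) (by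
      rw [LinearMap.toMatrix_eq_toMatrix', LinearMap.toMatrix'_toLin', Matrix.det_transpose]
      exact isUnit_det_genericMatrix k ι))

theorem genericBasis_apply (i : ι) : genericBasis k ι i = genericMatrix k ι i := by
  funext j
  simp [genericBasis]

end Generic

variable {k : Type u} [Field k] {ι : Type} [Fintype ι] [DecidableEq ι]

/-- Every basis of the split algebra over `k` is a specialization of the generic one. -/
theorem exists_specialization (e : Basis ι k (ι → k)) : ∃ χ : GLRing k ι →ₐ[k] k,
    structConst e = χ ∘ structConst (genericBasis k ι) := by
  let M : Matrix ι ι k := Matrix.of fun i j => e i j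
  have hM : IsUnit M.det := by
    have := (Pi.basisFun k ι).isUnit_det e
    rw [Basis.det_apply] at this
    rw [← Matrix.det_transpose]
    convert this using 2
    ext i j
    simp [M, Basis.toMatrix_apply]
  let χ : GLRing k ι →ₐ[k] k := IsLocalization.liftAlgHom (M := Submonoid.powers (genericDet k ι))
    (f := MvPolynomial.aeval (fun p : ι × ι => M p.1 p.2)) (by
      rintro ⟨_, n, rfl⟩
      have : MvPolynomial.aeval (fun p : ι × ι => M p.1 p.2) (genericDet k ι) = M.det :=
        eval_genericDet M
      simp only [map_pow, this]
      exact hM.pow n)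
  have hχ : ∀ i j, χ (genericMatrix k ι i j) = e i j := fun i j => by
    simp [χ, genericMatrix, M]
  refine ⟨χ, ?_⟩
  refine structConst_of_semilinear (χ : GLRing k ι →+* k)
    (RingHom.pi fun j => (χ : GLRing k ι →+* k).comp (Pi.evalRingHom _ j)) ?_ _ _ ?_
  · intro r
    rfl
  · intro i
    funext j
    rw [genericBasis_apply]
    exact (hχ i j).symm

end

section

variable {k : Type u} [Field k]

theorem exists_basis_quotient {B C : Type*} [CommRing B] [CommRing C] [Algebra k B] [Algebra B C]
    [Algebra k C] [IsScalarTower k B C] {ι : Type} [Fintype ι] (c : Basis ι B C) (φ : B →ₐ[k] k) :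
    ∃ b : Basis ι k (C ⧸ (RingHom.ker φ).map (algebraMap B C)),
      structConst b = φ ∘ structConst c := by
  have hφ : Function.Surjective φ := fun x => ⟨algebraMap k B x, by simp⟩
  have hΦ : ∀ r, Ideal.Quotient.mk ((RingHom.ker φ).map (algebraMap B C)) (algebraMap B C r) =
      algebraMap k _ (φ r) := fun r => by
    change _ = Ideal.Quotient.mk _ (algebraMap k C (φ r))
    rw [Ideal.Quotient.eq, IsScalarTower.algebraMap_apply k B C, ← map_sub]
    exact Ideal.mem_map_of_mem _ (by simp [RingHom.mem_ker])
  obtain ⟨b, hb⟩ := exists_basis_fibre c (φ : B →+* k)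
    (Ideal.Quotient.mk ((RingHom.ker φ).map (algebraMap B C))) hφ Ideal.Quotient.mk_surjective hΦ
    (by rw [Ideal.mk_ker]; exact le_rfl)
  exact ⟨b, structConst_of_semilinear (φ : B →+* k) _ hΦ c b hb⟩

/-- Structure constants of a basis of a finite power of an overring `L` of `B` that lie in `B` are
the structure constants of an algebra over `B`, namely the span of the basis. -/
theorem exists_subalgebra_basis {B L : Type*} [CommRing B] [CommRing L] [Algebra B L]
    (hinj : Function.Injective (algebraMap B L)) {ι : Type} [Fintype ι]
    (E : Basis ι L (ι → L)) (u : StructIndex ι → B)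
    (hu : ∀ s, algebraMap B L (u s) = structConst E s) :
    ∃ (C : Subalgebra B (ι → L)) (c : Basis ι B C), structConst c = u := by
  have hmul : ∀ i j, E i * E j = ∑ l, u (.inl (i, j, l)) • E l := fun i j => by
    rw [← E.sum_repr (E i * E j)]
    refine Finset.sum_congr rfl fun l _ => ?_
    change structConst E (.inl (i, j, l)) • E l = _
    rw [← hu, algebraMap_smul]
  have hone : (1 : ι → L) = ∑ l, u (.inr l) • E l := by
    rw [← E.sum_repr 1]
    refine Finset.sum_congr rfl fun l _ => ?_
    change structConst E (.inr l) • E l = _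
    rw [← hu, algebraMap_smul]
  let C : Subalgebra B (ι → L) := (Submodule.span B (Set.range E)).toSubalgebra
    (by
      rw [hone]
      exact Submodule.sum_mem _ fun l _ =>
        Submodule.smul_mem _ _ (Submodule.subset_span ⟨l, rfl⟩))
    (fun x y hx hy => by
      induction hx, hy using Submodule.span_induction₂ with
      | mem_mem x y hx hy =>
        obtain ⟨i, rfl⟩ := hx
        obtain ⟨j, rfl⟩ := hy
        rw [hmul]
        exact Submodule.sum_mem _ fun l _ =>
          Submodule.smul_mem _ _ (Submodule.subset_span ⟨l, rfl⟩)
      | zero_left => simp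
      | zero_right => simp
      | add_left x y z _ _ _ h1 h2 => rw [add_mul]; exact add_mem h1 h2
      | add_right x y z _ _ _ h1 h2 => rw [mul_add]; exact add_mem h1 h2
      | smul_left r x y _ _ h => rw [smul_mul_assoc]; exact Submodule.smul_mem _ _ h
      | smul_right r x y _ _ h => rw [mul_smul_comm]; exact Submodule.smul_mem _ _ h)
  have hli : LinearIndependent B E := E.linearIndependent.restrict_scalars (by
    intro x y h
    exact hinj (by simpa [Algebra.smul_def] using h))
  let c : Basis ι B C := Basis.span hli
  have hc : ∀ i, C.val (c i) = E i := fun i =>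
    congr_arg Subtype.val (Basis.span_apply hli i)
  refine ⟨C, c, ?_⟩
  have h := structConst_of_semilinear (algebraMap B L) C.val.toRingHom (fun r => rfl) c E
    (fun i => (hc i).symm)
  funext s
  exact hinj ((congr_fun h s).symm.trans (hu s).symm)

variable {ι : Type} [Fintype ι] [DecidableEq ι]

/-- If the generic structure constants specialize to those of `A`, then `A` is a fibre of the
family that they define, and the fibres with nonzero discriminant are smooth. -/
theorem isSmoothable_of_specialization [IsAlgClosed k] {A : Type u} [CommRing A] [Algebra k A]
    (b : Basis ι k A) {B : Type u} [CommRing B] [IsDomain B] [Algebra k B]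
    [Algebra.FiniteType k B] [Algebra B (GLRing k ι)] [IsScalarTower k B (GLRing k ι)]
    (hinj : Function.Injective (algebraMap B (GLRing k ι))) (u : StructIndex ι → B)
    (hu : ∀ s, algebraMap B (GLRing k ι) (u s) = structConst (genericBasis k ι) s)
    (φ : B →ₐ[k] k) (hφ : φ ∘ u = structConst b) : IsSmoothable k A := by
  obtain ⟨C, c, hc⟩ := exists_subalgebra_basis hinj (genericBasis k ι) u hu
  have hfree := Module.Free.of_basis c
  refine ⟨B, C, inferInstance, inferInstance, inferInstance,
    inferInstance, inferInstance, inferInstance, inferInstance, inferInstance, .of_basis c,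
    inferInstance, ⟨φ, ?_⟩, discrConst u, ?_, fun ψ hψ => ?_⟩
  · obtain ⟨b', hb'⟩ := exists_basis_quotient c φ
    exact nonempty_algEquiv_of_structConst_eq b b' (by rw [hb', hc, hφ])
  · rw [isNilpotent_iff_eq_zero]
    intro h
    obtain ⟨χ, hχ⟩ := exists_specialization (Pi.basisFun k ι)
    have h1 : discrConst (structConst (genericBasis k ι)) = 0 := by
      rw [← funext hu]
      exact (map_discrConst (algebraMap B (GLRing k ι)) u).symm.trans (by rw [h, map_zero])
    have h2 := map_discrConst (χ : GLRing k ι →+* k) (structConst (genericBasis k ι))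
    rw [h1, map_zero] at h2
    refine one_ne_zero (α := k) ?_
    rw [← discrConst_basisFun (ι := ι), hχ]
    exact h2.symm
  · obtain ⟨b', hb'⟩ := exists_basis_quotient c ψ
    refine smooth_of_discr_ne_zero b' ?_
    rw [discr_eq_discrConst, hb', hc]
    exact fun h0 => hψ ((map_discrConst (ψ : B →+* k) u).trans h0)

/-- A limit of split algebras is smoothable. The structure constants of all bases of the split
algebra are the image of the general linear group in an affine space. The closure of this image,
whose coordinate ring is the image of the polynomial ring in `GLRing`, is the base of a family that
has the given algebra as a fibre. -/
theorem IsLimitOfSplit.isSmoothable [IsAlgClosed k] {A : Type u} [CommRing A] [Algebra k A]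
    {b : Basis ι k A} (hb : IsLimitOfSplit b) : IsSmoothable k A := by
  let g : MvPolynomial (StructIndex ι) k →ₐ[k] GLRing k ι :=
    MvPolynomial.aeval (structConst (genericBasis k ι))
  have hker : ∀ F ∈ RingHom.ker g, MvPolynomial.aeval (structConst b) F = 0 := by
    intro F hF
    refine hb F fun e => ?_
    obtain ⟨χ, hχ⟩ := exists_specialization e
    have h : χ (g F) = 0 := by
      rw [(RingHom.mem_ker).mp hF, map_zero]
    have hcomp : χ.comp g = MvPolynomial.aeval (structConst e) := by
      rw [hχ]
      ext s
      simp [g]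
    exact (congr($hcomp F)).symm.trans h
  have : IsDomain (MvPolynomial (StructIndex ι) k ⧸ RingHom.ker g) :=
    (Ideal.Quotient.isDomain_iff_prime _).mpr (RingHom.ker_isPrime g)
  let _ : Algebra (MvPolynomial (StructIndex ι) k ⧸ RingHom.ker g) (GLRing k ι) :=
    (Ideal.kerLiftAlg g).toRingHom.toAlgebra
  have : IsScalarTower k (MvPolynomial (StructIndex ι) k ⧸ RingHom.ker g) (GLRing k ι) :=
    IsScalarTower.of_algebraMap_eq' (Ideal.kerLiftAlg g).comp_algebraMap.symm
  refine isSmoothable_of_specialization b (Ideal.kerLiftAlg_injective g)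
    (fun s => Ideal.Quotient.mk _ (MvPolynomial.X s)) (fun s => ?_)
    (Ideal.Quotient.liftₐ (RingHom.ker g) (MvPolynomial.aeval (structConst b)) hker) ?_
  · exact MvPolynomial.aeval_X _ s
  · funext s
    exact MvPolynomial.aeval_X _ s

end

section

variable {k : Type u} [Field k]

open TensorProduct in
/-- The fibres of a finite flat family over a connected base have the same dimension. -/
theorem finrank_fibre_eq {B C : Type*} [CommRing B] [CommRing C] [Algebra k B] [Algebra B C]
    [Algebra k C] [IsScalarTower k B C] [IsNoetherianRing B] [Module.Finite B C] [Module.Flat B C]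
    [PreconnectedSpace (PrimeSpectrum B)] (φ ψ : B →ₐ[k] k) :
    finrank k (C ⧸ (RingHom.ker φ).map (algebraMap B C)) =
      finrank k (C ⧸ (RingHom.ker ψ).map (algebraMap B C)) := by
  have key : ∀ φ : B →ₐ[k] k, ∃ x : PrimeSpectrum B,
      finrank k (C ⧸ (RingHom.ker φ).map (algebraMap B C)) = rankAtStalk (R := B) C x := by
    intro φ
    have hφ : Function.Surjective φ := fun x => ⟨algebraMap k B x, by simp⟩
    have : (RingHom.ker φ).IsMaximal := RingHom.ker_isMaximal_of_surjective φ hφ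
    let _ := Ideal.Quotient.field (RingHom.ker φ)
    let e := Ideal.quotientKerAlgEquivOfSurjective hφ
    have h1 : finrank k (B ⧸ RingHom.ker φ) = 1 := by
      rw [e.toLinearEquiv.finrank_eq, finrank_self]
    let x : PrimeSpectrum (B ⧸ RingHom.ker φ) := ⊥
    refine ⟨x.comap (algebraMap B _), ?_⟩
    rw [← rankAtStalk_baseChange (S := B ⧸ RingHom.ker φ) (M := C) x,
      rankAtStalk_eq_finrank_of_free]
    have h2 := finrank_mul_finrank k (B ⧸ RingHom.ker φ) ((B ⧸ RingHom.ker φ) ⊗[B] C)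
    rw [h1, one_mul] at h2
    refine Eq.trans ?_ h2.symm
    let E := (Algebra.TensorProduct.quotIdealMapEquivQuotTensor C (RingHom.ker φ))
    let E' : (C ⧸ (RingHom.ker φ).map (algebraMap B C)) ≃ₗ[k] (B ⧸ RingHom.ker φ) ⊗[B] C :=
      { E.toRingEquiv.toAddEquiv with
        map_smul' := fun c x => by
          obtain ⟨x, rfl⟩ := Ideal.Quotient.mk_surjective x
          have h3 : c • Ideal.Quotient.mk ((RingHom.ker φ).map (algebraMap B C)) x =
              Ideal.Quotient.mk _ (algebraMap k B c • x) := by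
            rw [algebraMap_smul]
            rfl
          change E (c • Ideal.Quotient.mk _ x) = c • E (Ideal.Quotient.mk _ x)
          rw [h3]
          change 1 ⊗ₜ[B] (algebraMap k B c • x) = c • (1 ⊗ₜ[B] x)
          rw [tmul_smul, algebraMap_smul] }
    exact E'.finrank_eq
  obtain ⟨x, hx⟩ := key φ
  obtain ⟨y, hy⟩ := key ψ
  have : Module.FinitePresentation B C := Module.finitePresentation_of_finite B C
  rw [hx, hy, (isLocallyConstant_rankAtStalk (R := B) (M := C)).apply_eq_of_preconnectedSpace x y]

/-- An element of a finite type algebra over an algebraically closed field that vanishes at all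
`k`-points is nilpotent. -/
theorem isNilpotent_of_forall_algHom [IsAlgClosed k] {B : Type*} [CommRing B] [Algebra k B]
    [Algebra.FiniteType k B] (x : B) (h : ∀ φ : B →ₐ[k] k, φ x = 0) : IsNilpotent x := by
  have : IsJacobsonRing B := isJacobsonRing_of_finiteType (A := k)
  rw [← mem_nilradical, nilradical, Ideal.radical_eq_jacobson, Ideal.jacobson, Ideal.mem_sInf]
  intro m hm
  have := hm.2
  let _ := Ideal.Quotient.field m
  have : Module.Finite k (B ⧸ m) := finite_of_finite_type_of_isJacobsonRing k (B ⧸ m)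
  let ψ : (B ⧸ m) ≃ₐ[k] k := (AlgEquiv.ofBijective (Algebra.ofId k (B ⧸ m))
    IsAlgClosed.algebraMap_bijective_of_isIntegral).symm
  have := h ((ψ : (B ⧸ m) →ₐ[k] k).comp (Ideal.Quotient.mkₐ k m))
  rw [← Ideal.Quotient.eq_zero_iff_mem]
  simpa using this

/-- A smoothable algebra is a limit of split algebras. Lifts of a basis of the special fibre form a
basis of every fibre over a neighbourhood `{f ≠ 0}`, with structure constants that are regular
functions there. A polynomial that vanishes on all structure constants of the split algebra vanishes
on those of the smooth fibres, which are dense, and hence on those of the special fibre. -/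
theorem IsSmoothable.isLimitOfSplit [IsAlgClosed k] {A : Type u} [CommRing A] [Algebra k A]
    (h : IsSmoothable k A) {ι : Type} [Fintype ι] (b : Basis ι k A) : IsLimitOfSplit b := by
  classical
  obtain ⟨B, C, _, _, _, _, _, _, _, hirr, _, _, ⟨φ, ⟨eA⟩⟩, r, hr, hsm⟩ := h
  have : IsNoetherianRing B := Algebra.FiniteType.isNoetherianRing k B
  have hnil := PrimeSpectrum.irreducibleSpace_iff_isPrime_nilradical.mp hirr
  -- lifts of the basis elements generate the family near the special fibre
  choose c hc using fun i => Ideal.Quotient.mk_surjective (eA (b i))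
  obtain ⟨f, hf1, hfle⟩ : ∃ f : B, f - 1 ∈ RingHom.ker φ ∧
      ∀ x : C, f • x ∈ Submodule.span B (Set.range c) := by
    have hle : (⊤ : Submodule B C) ≤ Submodule.span B (Set.range c) ⊔
        RingHom.ker φ • (⊤ : Submodule B C) := by
      intro x _
      have hx : x - ∑ i, algebraMap k B (b.repr (eA.symm (Ideal.Quotient.mk _ x)) i) • c i ∈
          RingHom.ker φ • (⊤ : Submodule B C) := by
        rw [Ideal.smul_top_eq_map]
        refine Ideal.Quotient.eq.mp ?_
        have h1 := congr_arg eA (b.sum_repr (eA.symm (Ideal.Quotient.mk _ x)))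
        rw [AlgEquiv.apply_symm_apply, map_sum] at h1
        refine h1.symm.trans ?_
        rw [map_sum]
        refine Finset.sum_congr rfl fun i _ => ?_
        rw [map_smul, ← hc, algebraMap_smul]
        rfl
      have hs := Submodule.sum_mem (Submodule.span B (Set.range c)) (t := Finset.univ)
        fun i _ => Submodule.smul_mem _
          (algebraMap k B (b.repr (eA.symm (Ideal.Quotient.mk _ x)) i))
          (Submodule.subset_span ⟨i, rfl⟩)
      rw [← sub_add_cancel x (∑ i, algebraMap k B
        (b.repr (eA.symm (Ideal.Quotient.mk _ x)) i) • c i), add_comm]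
      exact Submodule.add_mem_sup hs hx
    obtain ⟨f, hf, hfle⟩ := Submodule.exists_sub_one_mem_and_smul_le_of_fg_of_le_sup
      (Module.Finite.fg_top (R := B) (M := C)) le_rfl hle
    exact ⟨f, hf, fun x => hfle (Submodule.smul_mem_pointwise_smul x f ⊤ trivial)⟩
  have hφf : φ f = 1 := by
    have := (RingHom.mem_ker).mp hf1
    rwa [map_sub, map_one, sub_eq_zero] at this
  have hcoord : ∀ x : C, ∃ y : ι → B, f • x = ∑ i, y i • c i := fun x => by
    obtain ⟨y, hy⟩ := (Submodule.mem_span_range_iff_exists_fun B).mp (hfle x)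
    exact ⟨y, hy.symm⟩
  choose y hy using hcoord
  let s : StructIndex ι → B := Sum.elim (fun p => y (c p.1 * c p.2.1) p.2.2) (y 1)
  have hdim : Fintype.card ι = finrank k (C ⧸ (RingHom.ker φ).map (algebraMap B C)) := by
    rw [← eA.toLinearEquiv.finrank_eq, finrank_eq_card_basis b]
  -- structure constants at a nearby point
  have hfib : ∀ ψ : B →ₐ[k] k, ψ f ≠ 0 →
      ∃ b' : Basis ι k (C ⧸ (RingHom.ker ψ).map (algebraMap B C)),
        (∀ i, b' i = Ideal.Quotient.mk _ (c i)) ∧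
        ∀ t, ψ f * structConst b' t = ψ (s t) := by
    intro ψ hψ
    let π := Ideal.Quotient.mk ((RingHom.ker ψ).map (algebraMap B C))
    have hπ : ∀ (a : B) (x : C), π (a • x) = ψ a • π x := fun a x => by
      have h1 : π ((a - algebraMap k B (ψ a)) • x) = 0 := by
        rw [Ideal.Quotient.eq_zero_iff_mem, Algebra.smul_def]
        exact Ideal.mul_mem_right _ _ (Ideal.mem_map_of_mem _ (by simp [RingHom.mem_ker]))
      rw [sub_smul, map_sub, sub_eq_zero, algebraMap_smul] at h1
      exact h1
    have hsum : ∀ x, ψ f • π x = ∑ i, ψ (y x i) • π (c i) := fun x => by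
      rw [← hπ, hy, map_sum]
      simp only [hπ]
    have hsp : ⊤ ≤ Submodule.span k (Set.range fun i => π (c i)) := by
      intro x _
      obtain ⟨x, rfl⟩ := Ideal.Quotient.mk_surjective x
      have h1 : ψ f • π x ∈ Submodule.span k (Set.range fun i => π (c i)) := by
        rw [hsum]
        exact Submodule.sum_mem _ fun i _ => Submodule.smul_mem _ _ (Submodule.subset_span ⟨i, rfl⟩)
      rwa [Submodule.smul_mem_iff _ hψ] at h1
    let b' := basisOfTopLeSpanOfCardEqFinrank _ hsp (hdim.trans (finrank_fibre_eq φ ψ))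
    have hb' : ∀ i, b' i = π (c i) := fun i => by
      simp only [b', coe_basisOfTopLeSpanOfCardEqFinrank]
    have hrepr : ∀ x i, ψ f * b'.repr (π x) i = ψ (y x i) := fun x i => by
      rw [← smul_eq_mul, ← Finsupp.smul_apply, ← map_smul, hsum]
      simp only [← hb']
      rw [Basis.repr_sum_self]
    refine ⟨b', hb', fun t => ?_⟩
    rcases t with ⟨i, j, l⟩ | i
    · simp only [structConst, Sum.elim_inl, hb', ← map_mul π, hrepr, s]
    · simp only [structConst, Sum.elim_inr, ← map_one π, hrepr, s]
  intro F hF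
  -- clear denominators in `F (s / f)`
  obtain ⟨z, N, hz⟩ : ∃ (z : B) (N : ℕ), ∀ ψ : B →ₐ[k] k, ∀ v : StructIndex ι → k,
      ψ f ≠ 0 → (∀ t, ψ f * v t = ψ (s t)) → ψ z = ψ f ^ N * MvPolynomial.eval v F := by
    clear hF
    induction F using MvPolynomial.induction_on with
    | C a => exact ⟨algebraMap k B a, 0, fun ψ v _ _ => by simp⟩
    | add F₁ F₂ h₁ h₂ =>
      obtain ⟨z₁, N₁, h₁⟩ := h₁
      obtain ⟨z₂, N₂, h₂⟩ := h₂
      refine ⟨f ^ N₂ * z₁ + f ^ N₁ * z₂, N₁ + N₂, fun ψ v h0 hv => ?_⟩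
      rw [map_add, map_mul, map_mul, map_pow, map_pow, h₁ ψ v h0 hv, h₂ ψ v h0 hv, map_add]
      ring
    | mul_X F t h₁ =>
      obtain ⟨z₁, N₁, h₁⟩ := h₁
      refine ⟨z₁ * s t, N₁ + 1, fun ψ v h0 hv => ?_⟩
      rw [map_mul, h₁ ψ v h0 hv, ← hv, map_mul, MvPolynomial.eval_X]
      ring
  have hzr : IsNilpotent (z * f * r) := by
    refine isNilpotent_of_forall_algHom (k := k) _ fun ψ => ?_
    by_cases hψf : ψ f = 0
    · simp [hψf]
    by_cases hψr : ψ r = 0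
    · simp [hψr]
    obtain ⟨b', -, hb'⟩ := hfib ψ hψf
    have := Module.Finite.of_basis b'
    have := hsm ψ hψr
    obtain ⟨κ, _, ⟨e⟩⟩ := exists_algEquiv_pi_of_smooth k (C ⧸ (RingHom.ker ψ).map (algebraMap B C))
    have hcard : Fintype.card ι = Fintype.card κ := by
      rw [← finrank_eq_card_basis b', e.toLinearEquiv.finrank_eq, finrank_fintype_fun_eq_card]
    let e' := e.trans (AlgEquiv.piCongrLeft k (fun _ => k) (Fintype.equivOfCardEq hcard)).symm
    have h0 := hF (b'.map e'.toLinearEquiv)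
    rw [structConst_map] at h0
    rw [map_mul, map_mul, hz ψ _ hψf hb', h0]
    simp
  have hz0 : IsNilpotent z := by
    rcases hnil.mem_or_mem (show (z * f) * r ∈ nilradical B from hzr) with h | h
    · rcases hnil.mem_or_mem h with h | h
      · exact h
      · have := (show IsNilpotent f from h).map φ
        rw [hφf] at this
        exact absurd this.eq_zero one_ne_zero
    · exact absurd h hr
  obtain ⟨b', hb'c, hb'⟩ := hfib φ (by rw [hφf]; exact one_ne_zero)
  have hbb : structConst b = structConst b' := by
    rw [← structConst_map b eA]
    congr 1
    ext i
    rw [hb'c, hc]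
    rfl
  have h1 := hz φ (structConst b) (by rw [hφf]; exact one_ne_zero) (by rwa [hbb])
  rw [hφf, one_pow, one_mul, (hz0.map φ).eq_zero] at h1
  exact h1.symm

end

section

variable {k : Type u} [Field k]

/-! ### Products and limits of smoothable algebras -/

theorem IsSmoothable.of_algEquiv {A A' : Type u} [CommRing A] [CommRing A'] [Algebra k A]
    [Algebra k A'] (h : IsSmoothable k A) (e : A ≃ₐ[k] A') : IsSmoothable k A' := by
  obtain ⟨B, C, i₁, i₂, i₃, i₄, i₅, i₆, h₁, h₂, h₃, h₄, ⟨φ, ⟨eA⟩⟩, h₅⟩ := h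
  exact ⟨B, C, i₁, i₂, i₃, i₄, i₅, i₆, h₁, h₂, h₃, h₄, ⟨φ, ⟨e.symm.trans eA⟩⟩, h₅⟩

theorem IsSmoothable.of_subsingleton [IsAlgClosed k] (A : Type u) [CommRing A] [Algebra k A]
    [Subsingleton A] : IsSmoothable k A := by
  let b : Basis (Fin 0) k A := Basis.empty A
  refine IsLimitOfSplit.isSmoothable (b := b) fun F hF => ?_
  convert hF (Basis.empty _) using 2
  congr 1

/-- Products of smoothable algebras are smoothable: the structure constants of a product are
polynomials in those of each factor, so that limits may be taken in one factor at a time. -/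
theorem IsSmoothable.prod [IsAlgClosed k] {A A' : Type u} [CommRing A] [CommRing A'] [Algebra k A]
    [Algebra k A'] [Module.Finite k A] [Module.Finite k A'] (h : IsSmoothable k A)
    (h' : IsSmoothable k A') : IsSmoothable k (A × A') := by
  let b := finBasis k A
  let b' := finBasis k A'
  refine IsLimitOfSplit.isSmoothable (b := b.prod b') fun F hF => ?_
  rw [structConst_prod]
  -- `F` as a polynomial in the coordinates of one factor, those of the other being fixed
  have left : ∀ (u : StructIndex (Fin (finrank k A)) → k)
      (v : StructIndex (Fin (finrank k A')) → k),
      MvPolynomial.eval u (MvPolynomial.aeval (prodConst MvPolynomial.X (MvPolynomial.C ∘ v)) F) =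
        MvPolynomial.eval (prodConst u v) F := by
    intro u v
    have hcomp : ((MvPolynomial.aeval u : MvPolynomial _ k →ₐ[k] k).comp
        (MvPolynomial.aeval (prodConst MvPolynomial.X (MvPolynomial.C ∘ v)))) =
        MvPolynomial.aeval (prodConst u v) := by
      ext s
      rcases s with ⟨i | i, j | j, l | l⟩ | i | i <;> simp [prodConst]
    exact congr($hcomp F)
  have right : ∀ (u : StructIndex (Fin (finrank k A)) → k)
      (v : StructIndex (Fin (finrank k A')) → k),
      MvPolynomial.eval v (MvPolynomial.aeval (prodConst (MvPolynomial.C ∘ u) MvPolynomial.X) F) =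
        MvPolynomial.eval (prodConst u v) F := by
    intro u v
    have hcomp : ((MvPolynomial.aeval v : MvPolynomial _ k →ₐ[k] k).comp
        (MvPolynomial.aeval (prodConst (MvPolynomial.C ∘ u) MvPolynomial.X))) =
        MvPolynomial.aeval (prodConst u v) := by
      ext s
      rcases s with ⟨i | i, j | j, l | l⟩ | i | i <;> simp [prodConst]
    exact congr($hcomp F)
  rw [← right]
  refine h'.isLimitOfSplit b' _ fun e' => ?_
  rw [right, ← left]
  refine h.isLimitOfSplit b _ fun e => ?_
  rw [left, ← structConst_prod]
  let E : ((Fin (finrank k A) → k) × (Fin (finrank k A') → k)) ≃ₐ[k]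
      (Fin (finrank k A) ⊕ Fin (finrank k A') → k) :=
    AlgEquiv.ofLinearEquiv (LinearEquiv.sumArrowLequivProdArrow _ _ k k).symm
      (by ext (i | i) <;> rfl) (fun x y => by ext (i | i) <;> rfl)
  rw [← structConst_map _ E]
  exact hF _

/-- Smoothability is closed: a fibre of a finite free family over the affine line is smoothable if
the other fibres are, as a polynomial in `t` that vanishes at all `a ≠ 0` is zero. -/
theorem IsSmoothable.of_family [IsAlgClosed k] {C : Type u} [CommRing C] [Algebra (Polynomial k) C]
    [Algebra k C] [IsScalarTower k (Polynomial k) C] [Module.Finite (Polynomial k) C]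
    [Module.Free (Polynomial k) C]
    (h : ∀ a : k, a ≠ 0 → IsSmoothable k
      (C ⧸ (RingHom.ker (Polynomial.aeval a : Polynomial k →ₐ[k] k)).map
        (algebraMap (Polynomial k) C))) :
    IsSmoothable k (C ⧸ (RingHom.ker (Polynomial.aeval 0 : Polynomial k →ₐ[k] k)).map
        (algebraMap (Polynomial k) C)) := by
  let c := finBasis (Polynomial k) C
  obtain ⟨b, hb⟩ := exists_basis_quotient c (Polynomial.aeval 0 : Polynomial k →ₐ[k] k)
  refine IsLimitOfSplit.isSmoothable (b := b) fun F hF => ?_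
  have heval : ∀ a : k, Polynomial.aeval a (MvPolynomial.aeval (structConst c) F) =
      MvPolynomial.eval (Polynomial.aeval a ∘ structConst c) F := fun a => by
    have hcomp : (Polynomial.aeval a : Polynomial k →ₐ[k] k).comp
        (MvPolynomial.aeval (structConst c)) =
        MvPolynomial.aeval ((Polynomial.aeval a : Polynomial k →ₐ[k] k) ∘ structConst c) := by
      ext s
      simp
    exact congr($hcomp F)
  have hzero : MvPolynomial.aeval (structConst c) F = (0 : Polynomial k) := by
    refine Polynomial.eq_zero_of_infinite_isRoot _
      ((Set.finite_singleton (0 : k)).infinite_compl.mono fun a ha => ?_)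
    obtain ⟨b', hb'⟩ := exists_basis_quotient c (Polynomial.aeval a : Polynomial k →ₐ[k] k)
    have := (h a ha).isLimitOfSplit b' F hF
    rw [hb', ← heval] at this
    simpa using this
  rw [hb, ← heval, hzero, map_zero]

end

open Polynomial

/-! ### Colengths of ideals -/

section Colength

variable {k R : Type*} [Field k] [CommRing R] [Algebra k R]

theorem finite_quotient_of_le {I J : Ideal R} (h : I ≤ J) [Module.Finite k (R ⧸ I)] :
    Module.Finite k (R ⧸ J) :=
  Module.Finite.of_surjective (Ideal.Quotient.factorₐ k h).toLinearMap
    (Ideal.Quotient.factor_surjective h)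

/-- Multiplication by `p` on `M` with values in `R ⧸ I`. -/
def mulQuot (I M : Ideal R) (p : R) : M →ₗ[R] R ⧸ I :=
  (Submodule.mkQ I).comp ((LinearMap.mulLeft R p).comp M.subtype)

variable (k) in
theorem finrank_quotient_eq_add_range (I M : Ideal R) (p : R)
    [Module.Finite k ((LinearMap.range (mulQuot I M p)).restrictScalars k)]
    [Module.Finite k (R ⧸ (I ⊔ Ideal.span {p} * M))] :
    Module.Finite k (R ⧸ I) ∧ finrank k (R ⧸ I) = finrank k (R ⧸ (I ⊔ Ideal.span {p} * M)) +
      finrank k ((LinearMap.range (mulQuot I M p)).restrictScalars k) := by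
  let g : (R ⧸ I) →ₗ[k] R ⧸ (I ⊔ Ideal.span {p} * M) :=
    (Ideal.Quotient.factorₐ k le_sup_left).toLinearMap
  have hg : Function.Surjective g := Ideal.Quotient.factor_surjective le_sup_left
  have hker : LinearMap.ker g = (LinearMap.range (mulQuot I M p)).restrictScalars k := by
    ext x
    obtain ⟨x, rfl⟩ := Ideal.Quotient.mk_surjective x
    have h1 : Ideal.Quotient.mk I x ∈ LinearMap.ker g ↔ x ∈ I ⊔ Ideal.span {p} * M :=
      Ideal.Quotient.eq_zero_iff_mem
    rw [h1, Submodule.restrictScalars_mem, Submodule.mem_sup]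
    constructor
    · rintro ⟨y, hy, z, hz, rfl⟩
      obtain ⟨m, hm, rfl⟩ := Ideal.mem_span_singleton_mul.mp hz
      refine ⟨⟨m, hm⟩, ?_⟩
      rw [map_add, Ideal.Quotient.eq_zero_iff_mem.mpr hy, zero_add]
      rfl
    · rintro ⟨m, hm⟩
      refine ⟨x - p * m, Ideal.Quotient.eq.mp hm.symm, p * m,
        Ideal.mul_mem_mul (Ideal.mem_span_singleton_self p) m.2, by ring⟩
  let e := g.quotKerEquivOfSurjective hg
  have hk : Module.Finite k (LinearMap.ker g) := by rwa [hker]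
  have hq : Module.Finite k ((R ⧸ I) ⧸ LinearMap.ker g) := Module.Finite.equiv e.symm
  have hfin : Module.Finite k (R ⧸ I) := Module.Finite.of_submodule_quotient (LinearMap.ker g)
  refine ⟨hfin, ?_⟩
  rw [← Submodule.finrank_quotient_add_finrank (LinearMap.ker g), e.finrank_eq, hker]

/-- The colength formula that comes from the exact sequence
`0 → M ⧸ (M ⊓ (I : p)) → R ⧸ I → R ⧸ (I + p M) → 0`. -/
theorem finrank_quotient_add_finrank_quotient (I M N : Ideal R) (p : R)
    (hN : ∀ x, x ∈ N ↔ x ∈ M ∧ p * x ∈ I) [Module.Finite k (R ⧸ N)]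
    [Module.Finite k (R ⧸ (I ⊔ Ideal.span {p} * M))] :
    Module.Finite k (R ⧸ I) ∧ finrank k (R ⧸ I) + finrank k (R ⧸ M) =
      finrank k (R ⧸ (I ⊔ Ideal.span {p} * M)) + finrank k (R ⧸ N) := by
  have hsup : N ⊔ Ideal.span {1} * M = M := by
    rw [Ideal.span_singleton_one, Ideal.top_mul, sup_eq_right]
    exact fun x hx => ((hN x).mp hx).1
  have hle : N ≤ M := fun x hx => ((hN x).mp hx).1
  have hker : LinearMap.ker (mulQuot I M p) = LinearMap.ker (mulQuot N M 1) := by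
    ext m
    simp only [mulQuot, LinearMap.mem_ker, LinearMap.comp_apply, Submodule.mkQ_apply,
      Submodule.Quotient.mk_eq_zero, LinearMap.mulLeft_apply, Submodule.subtype_apply, one_mul, hN,
      m.2, true_and]
  let e : LinearMap.range (mulQuot I M p) ≃ₗ[R] LinearMap.range (mulQuot N M 1) :=
    (mulQuot I M p).quotKerEquivRange.symm.trans
      ((Submodule.quotEquivOfEq _ _ hker).trans (mulQuot N M 1).quotKerEquivRange)
  let e' : (LinearMap.range (mulQuot I M p)).restrictScalars k ≃ₗ[k]
      (LinearMap.range (mulQuot N M 1)).restrictScalars k := e.restrictScalars k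
  have hf1 : Module.Finite k (R ⧸ (N ⊔ Ideal.span {1} * M)) := by
    rw [hsup]
    exact finite_quotient_of_le hle
  have hf2 : Module.Finite k ((LinearMap.range (mulQuot I M p)).restrictScalars k) :=
    Module.Finite.equiv e'.symm
  obtain ⟨h1, h2⟩ := finrank_quotient_eq_add_range k I M p
  obtain ⟨-, h3⟩ := finrank_quotient_eq_add_range k N M 1
  rw [hsup] at h3
  refine ⟨h1, ?_⟩
  rw [h2, h3, e'.finrank_eq]
  ring

theorem finrank_quotient_sup_add_inf (I J : Ideal R) [Module.Finite k (R ⧸ (I ⊓ J))] :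
    finrank k (R ⧸ (I ⊔ J)) + finrank k (R ⧸ (I ⊓ J)) =
      finrank k (R ⧸ I) + finrank k (R ⧸ J) := by
  have hs : I ⊔ Ideal.span {1} * J = I ⊔ J := by rw [Ideal.span_singleton_one, Ideal.top_mul]
  have : Module.Finite k (R ⧸ (I ⊔ Ideal.span {1} * J)) := by
    rw [hs]
    exact finite_quotient_of_le (inf_le_left.trans le_sup_left : I ⊓ J ≤ I ⊔ J)
  obtain ⟨-, h⟩ := finrank_quotient_add_finrank_quotient (k := k) I J (I ⊓ J) 1
    (fun x => by rw [one_mul, Submodule.mem_inf, and_comm])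
  rw [h, hs]

theorem eq_of_le_of_finrank_quotient_eq {I J : Ideal R} (h : I ≤ J) [Module.Finite k (R ⧸ I)]
    (hf : finrank k (R ⧸ I) = finrank k (R ⧸ J)) : I = J := by
  refine le_antisymm h fun x hx => ?_
  have : Module.Finite k (R ⧸ J) := finite_quotient_of_le h
  have hinj := (LinearMap.injective_iff_surjective_of_finrank_eq_finrank hf
    (f := (Ideal.Quotient.factorₐ k h).toLinearMap)).mpr (Ideal.Quotient.factor_surjective h)
  rw [← Ideal.Quotient.eq_zero_iff_mem]
  apply hinj
  rw [map_zero]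
  exact Ideal.Quotient.eq_zero_iff_mem.mpr hx

end Colength

/-! ### Ideals given by remainders -/

section Remainder

variable {S : Type*} [CommRing S]

/-- The condition on ideals `c 0, …, c (d - 1)`, `d = deg δ`, under which the polynomials whose
remainder modulo the monic polynomial `δ` has its `i`-th coefficient in `c i` form an ideal. The
two inclusions say that the set is stable under multiplication by `X`. -/
structure RemainderCompatible (δ : S[X]) (c : ℕ → Ideal S) : Prop where
  monic : δ.Monic
  mono : ∀ i, i + 1 < δ.natDegree → c i ≤ c (i + 1)
  last : ∀ i, i < δ.natDegree → ∀ s ∈ c (δ.natDegree - 1), δ.coeff i * s ∈ c i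

namespace RemainderCompatible

variable {δ : S[X]} {c : ℕ → Ideal S} (h : RemainderCompatible δ c)

/-- The ideal of polynomials whose remainder modulo `δ` has its `i`-th coefficient in `c i`. -/
def ideal (h : RemainderCompatible δ c) : Ideal S[X] where
  carrier := {q | ∀ i < δ.natDegree, (q %ₘ δ).coeff i ∈ c i}
  add_mem' := fun {a b} ha hb i hi => by
    rw [add_modByMonic, coeff_add]
    exact (c i).add_mem (ha i hi) (hb i hi)
  zero_mem' := fun i _ => by simp
  smul_mem' := fun q r hr => by
    simp only [Set.mem_ofPred_eq, smul_eq_mul] at hr ⊢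
    induction q using Polynomial.induction_on' with
    | add q₁ q₂ h₁ h₂ =>
      intro i hi
      rw [add_mul, add_modByMonic, coeff_add]
      exact (c i).add_mem (h₁ i hi) (h₂ i hi)
    | monomial m s =>
      rw [← C_mul_X_pow_eq_monomial, mul_assoc]
      have hX : ∀ r : S[X], (∀ i < δ.natDegree, (r %ₘ δ).coeff i ∈ c i) →
          ∀ i < δ.natDegree, ((X * r) %ₘ δ).coeff i ∈ c i := by
        intro r hr i hi
        set d := δ.natDegree with hd
        nontriviality S
        have hdeg : (r %ₘ δ).degree < δ.degree := degree_modByMonic_lt r h.monic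
        set ρ := r %ₘ δ with hρ
        have hlt : ∀ j, d ≤ j → ρ.coeff j = 0 := fun j hj =>
          coeff_eq_zero_of_degree_lt (hdeg.trans_le (by
            rw [degree_eq_natDegree h.monic.ne_zero]; exact_mod_cast hj))
        have hρd : (X * ρ - C (ρ.coeff (d - 1)) * δ).degree < δ.degree := by
          rw [degree_eq_natDegree h.monic.ne_zero, degree_lt_iff_coeff_zero]
          intro m hm
          rw [← hd] at hm
          obtain ⟨m, rfl⟩ : ∃ m', m = m' + 1 := ⟨m - 1, by omega⟩
          rw [coeff_sub, coeff_X_mul, coeff_C_mul]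
          rcases hm.eq_or_lt with hm | hm
          · rw [← hm, hd, h.monic.coeff_natDegree, ← hd, hm, Nat.add_sub_cancel, mul_one, sub_self]
          · rw [hlt m (by omega), coeff_eq_zero_of_natDegree_lt (p := δ) (by omega), mul_zero,
              sub_zero]
        have hmod : (X * r) %ₘ δ = X * ρ - C (ρ.coeff (d - 1)) * δ := by
          refine (div_modByMonic_unique (X * (r /ₘ δ) + C (ρ.coeff (d - 1))) _ h.monic
            ⟨?_, hρd⟩).2
          have := modByMonic_add_div r δ
          rw [← hρ] at this
          linear_combination X * this
        rw [hmod, coeff_sub, coeff_C_mul]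
        refine (c i).sub_mem ?_ ?_
        · rcases i with _ | i
          · simp
          · rw [coeff_X_mul]
            exact h.mono i (hd ▸ hi) (hr i (by omega))
        · rw [mul_comm]
          exact h.last i (hd ▸ hi) _ (hr (d - 1) (by omega))
      have hpow : ∀ m : ℕ, ∀ i < δ.natDegree, ((X ^ m * r) %ₘ δ).coeff i ∈ c i := by
        intro m
        induction m with
        | zero => simpa using hr
        | succ m ih =>
          rw [pow_succ', mul_assoc]
          exact hX _ ih
      intro i hi
      rw [← smul_eq_C_mul, smul_modByMonic, coeff_smul, smul_eq_mul]
      exact (c i).mul_mem_left _ (hpow m i hi)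

theorem mem_ideal {q : S[X]} : q ∈ h.ideal ↔ ∀ i < δ.natDegree, (q %ₘ δ).coeff i ∈ c i := Iff.rfl

theorem mul_mem_ideal (q : S[X]) : δ * q ∈ h.ideal := fun i _ => by
  rw [(modByMonic_eq_zero_iff_dvd h.monic).mpr ⟨q, rfl⟩, coeff_zero]
  exact (c i).zero_mem

theorem self_mem_ideal : δ ∈ h.ideal := by simpa using h.mul_mem_ideal 1

theorem C_mul_X_pow_mem_ideal {i : ℕ} (hi : i < δ.natDegree) {s : S} (hs : s ∈ c i) :
    C s * X ^ i ∈ h.ideal := by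
  nontriviality S
  have hdeg : (C s * X ^ i : S[X]).degree < δ.degree :=
    (degree_C_mul_X_pow_le i s).trans_lt (by
      rw [degree_eq_natDegree h.monic.ne_zero]; exact_mod_cast hi)
  intro j _
  rw [(modByMonic_eq_self_iff h.monic).mpr hdeg, coeff_C_mul_X_pow]
  split_ifs with hj
  · rwa [hj]
  · exact (c j).zero_mem

theorem ideal_le {K : Ideal S[X]} (hδ : δ ∈ K)
    (hc : ∀ i < δ.natDegree, ∀ s ∈ c i, C s * X ^ i ∈ K) : h.ideal ≤ K := by
  intro q hq
  nontriviality S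
  rw [← modByMonic_add_div q δ]
  refine K.add_mem ?_ (K.mul_mem_right _ hδ)
  rw [as_sum_range_C_mul_X_pow (q %ₘ δ)]
  refine K.sum_mem fun i hi => ?_
  by_cases hid : i < δ.natDegree
  · exact hc i hid _ (hq i hid)
  · rw [coeff_eq_zero_of_degree_lt ((degree_modByMonic_lt q h.monic).trans_le (by
      rw [degree_eq_natDegree h.monic.ne_zero]; exact_mod_cast (not_lt.mp hid)))]
    simp

theorem ideal_mono {c' : ℕ → Ideal S} (h' : RemainderCompatible δ c') (hc : ∀ i, c i ≤ c' i) :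
    h.ideal ≤ h'.ideal := fun _ hq i hi => hc i (hq i hi)

variable {k : Type*} [Field k] [Algebra k S]

/-- The quotient by a remainder ideal is the direct sum of the quotients `S ⧸ c i`. -/
theorem finrank_quotient_ideal [Nontrivial S] [∀ i, Module.Finite k (S ⧸ c i)] :
    Module.Finite k (S[X] ⧸ h.ideal) ∧ finrank k (S[X] ⧸ h.ideal) =
      ∑ i ∈ Finset.range δ.natDegree, finrank k (S ⧸ c i) := by
  let g : S[X] →ₗ[k] (i : Fin δ.natDegree) → S ⧸ c i := LinearMap.pi fun i =>
    (Ideal.Quotient.mkₐ k (c i)).toLinearMap ∘ₗ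
      ((lcoeff S i).restrictScalars k ∘ₗ (modByMonicHom δ).restrictScalars k)
  have hgap : ∀ q i, g q i = Ideal.Quotient.mk (c i) ((q %ₘ δ).coeff i) := fun q i => rfl
  have hg : Function.Surjective g := by
    intro v
    choose s hs using fun i => Ideal.Quotient.mk_surjective (v i)
    refine ⟨∑ i : Fin δ.natDegree, C (s i) * X ^ (i : ℕ), ?_⟩
    have hdeg : (∑ i : Fin δ.natDegree, C (s i) * X ^ (i : ℕ)).degree < δ.degree := by
      rw [degree_eq_natDegree h.monic.ne_zero]
      refine (degree_sum_le _ _).trans_lt ((Finset.sup_lt_iff (WithBot.bot_lt_coe _)).mpr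
        fun i _ => (degree_C_mul_X_pow_le _ _).trans_lt (by exact_mod_cast i.2))
    funext i
    rw [hgap, (modByMonic_eq_self_iff h.monic).mpr hdeg, finsetSum_coeff, ← hs i]
    congr 1
    simp only [coeff_C_mul_X_pow, Fin.val_inj]
    simp
  have hker : LinearMap.ker g = h.ideal.restrictScalars k := by
    ext q
    rw [LinearMap.mem_ker, Submodule.restrictScalars_mem, mem_ideal, funext_iff]
    constructor
    · intro hq i hi
      exact Ideal.Quotient.eq_zero_iff_mem.mp (hq ⟨i, hi⟩)
    · intro hq i
      exact Ideal.Quotient.eq_zero_iff_mem.mpr (hq i i.2)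
  let e : (S[X] ⧸ h.ideal) ≃ₗ[k] (i : Fin δ.natDegree) → S ⧸ c i :=
    (Submodule.Quotient.restrictScalarsEquiv k h.ideal).symm.trans
      ((Submodule.quotEquivOfEq _ _ hker.symm).trans (g.quotKerEquivOfSurjective hg))
  refine ⟨Module.Finite.equiv e.symm, ?_⟩
  rw [e.finrank_eq, finrank_pi_fintype, Finset.sum_range]

end RemainderCompatible
end Remainder

/-! ### Ray ideals over a general ring -/

section Ray

variable {S : Type*} [CommRing S] (I J : Ideal S)

/-- The ideal `I + X J` of `S[X]`. -/
def stepIdeal : Ideal S[X] := J.map C ⊓ I.comap constantCoeff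

variable {I J} in
theorem mem_stepIdeal {q : S[X]} :
    q ∈ stepIdeal I J ↔ (∀ i, q.coeff i ∈ J) ∧ q.coeff 0 ∈ I := by
  rw [stepIdeal, Submodule.mem_inf, Ideal.mem_map_C_iff, Ideal.mem_comap, constantCoeff_apply]

/-- The polynomial `X ^ d - l X - p`. -/
def rayPoly (d : ℕ) (l p : S) : S[X] := X ^ d - C l * X - C p

/-- The ideal `I + X J + (X ^ d - l X - p)` of `S[X]`. -/
def rayIdeal (d : ℕ) (l p : S) : Ideal S[X] := stepIdeal I J ⊔ Ideal.span {rayPoly d l p}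

variable {I J} in
theorem C_mem_stepIdeal (hIJ : I ≤ J) {s : S} (hs : s ∈ I) : C s ∈ stepIdeal I J := by
  rw [mem_stepIdeal]
  refine ⟨fun i => ?_, by simpa using hs⟩
  rw [coeff_C]
  split_ifs
  · exact hIJ hs
  · exact J.zero_mem

variable {I J} in
theorem C_mul_X_pow_mem_stepIdeal {s : S} (hs : s ∈ J) {i : ℕ} (hi : i ≠ 0) :
    C s * X ^ i ∈ stepIdeal I J := by
  rw [mem_stepIdeal]
  refine ⟨fun j => ?_, ?_⟩
  · rw [coeff_C_mul_X_pow]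
    split_ifs
    · exact hs
    · exact J.zero_mem
  · rw [coeff_C_mul_X_pow, if_neg hi.symm]
    exact I.zero_mem

theorem rayPoly_eq (d : ℕ) (l p : S) : rayPoly d l p = X ^ d - (C l * X + C p) := by
  rw [rayPoly, sub_sub]

theorem degree_linear_lt [Nontrivial S] {d : ℕ} (hd : 2 ≤ d) (l p : S) :
    (C l * X + C p).degree < (d : WithBot ℕ) :=
  degree_linear_le.trans_lt (by exact_mod_cast hd)

theorem monic_rayPoly {d : ℕ} (hd : 2 ≤ d) (l p : S) : (rayPoly d l p).Monic := by
  nontriviality S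
  rw [rayPoly_eq]
  exact monic_X_pow_sub (degree_linear_lt hd l p)

theorem natDegree_rayPoly [Nontrivial S] {d : ℕ} (hd : 2 ≤ d) (l p : S) :
    (rayPoly d l p).natDegree = d := by
  rw [rayPoly_eq]
  refine natDegree_eq_of_degree_eq_some ?_
  rw [degree_sub_eq_left_of_degree_lt, degree_X_pow]
  rw [degree_X_pow]
  exact degree_linear_lt hd l p

variable {I J}

/-- The sequence `A, J, J, …` of ideals. -/
def raySeq (A J : Ideal S) : ℕ → Ideal S
  | 0 => A
  | _ + 1 => J

theorem remainderCompatible_ray [Nontrivial S] {d : ℕ} (hd : 2 ≤ d) (l : S) {p : S} {A : Ideal S}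
    (hAJ : A ≤ J) (hp : ∀ s ∈ J, p * s ∈ A) :
    RemainderCompatible (rayPoly d l p) (raySeq A J) where
  monic := monic_rayPoly hd l p
  mono := fun i _ => by
    rcases i with _ | i
    · exact hAJ
    · exact le_rfl
  last := fun i _ s hs => by
    rw [natDegree_rayPoly hd] at hs
    obtain ⟨e, rfl⟩ : ∃ e, d = e + 2 := ⟨d - 2, by omega⟩
    have hs : s ∈ J := hs
    rcases i with _ | i
    · have h0 : (rayPoly (e + 2) l p).coeff 0 = -p := by
        simp [rayPoly, coeff_X_pow]
      rw [h0, neg_mul]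
      exact A.neg_mem (hp s hs)
    · exact J.mul_mem_left _ hs

theorem mem_of_forall_coeff {K : Ideal S[X]} {q : S[X]} (h : ∀ i, C (q.coeff i) * X ^ i ∈ K) :
    q ∈ K := by
  rw [as_sum_range_C_mul_X_pow q]
  exact K.sum_mem fun i _ => h i

theorem stepIdeal_le {K : Ideal S[X]} (h0 : ∀ s ∈ I, C s ∈ K) (h1 : ∀ s ∈ J, C s * X ∈ K) :
    stepIdeal I J ≤ K := by
  intro q hq
  rw [mem_stepIdeal] at hq
  refine mem_of_forall_coeff fun i => ?_
  rcases i with _ | i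
  · simpa using h0 _ hq.2
  · rw [pow_succ', ← mul_assoc]
    exact K.mul_mem_right _ (h1 _ (hq.1 _))

/-- The ray ideal is given by the remainders modulo `X ^ d - l X - p` with constant term in `I` and
the other coefficients in `J`. -/
theorem rayIdeal_eq [Nontrivial S] {d : ℕ} (hd : 2 ≤ d) (l : S) {p : S} (hIJ : I ≤ J)
    (hp : ∀ s ∈ J, p * s ∈ I) :
    rayIdeal I J d l p = (remainderCompatible_ray hd l hIJ hp).ideal := by
  set h := remainderCompatible_ray hd l hIJ hp
  refine le_antisymm (sup_le (stepIdeal_le (fun s hs => ?_) fun s hs => ?_) ?_) ?_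
  · simpa using h.C_mul_X_pow_mem_ideal (i := 0) (by rw [natDegree_rayPoly hd]; omega)
      hs
  · simpa using h.C_mul_X_pow_mem_ideal (i := 1) (by rw [natDegree_rayPoly hd]; omega)
      hs
  · rw [Ideal.span_singleton_le_iff_mem]
    exact h.self_mem_ideal
  · refine h.ideal_le (Ideal.mem_sup_right (Ideal.mem_span_singleton_self _)) fun i _ s hs => ?_
    refine Ideal.mem_sup_left ?_
    rcases i with _ | i
    · simpa using C_mem_stepIdeal hIJ (s := s) hs
    · exact C_mul_X_pow_mem_stepIdeal hs (by omega)

theorem mem_stepIdeal_mul_self (hIJ : I ≤ J) {q : S[X]} : q ∈ stepIdeal I J * stepIdeal I J ↔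
    q.coeff 0 ∈ I ^ 2 ∧ q.coeff 1 ∈ I * J ∧ ∀ i, q.coeff i ∈ J ^ 2 := by
  constructor
  · intro hq
    induction hq using Submodule.mul_induction_on' with
    | mem_mul_mem a ha b hb =>
      rw [mem_stepIdeal] at ha hb
      refine ⟨?_, ?_, fun i => ?_⟩
      · rw [mul_coeff_zero, sq]
        exact Ideal.mul_mem_mul ha.2 hb.2
      · rw [mul_coeff_one]
        refine add_mem (Ideal.mul_mem_mul ha.2 (hb.1 1)) ?_
        rw [mul_comm (a.coeff 1)]
        exact Ideal.mul_mem_mul hb.2 (ha.1 1)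
      · rw [coeff_mul, sq]
        exact Submodule.sum_mem _ fun x _ => Ideal.mul_mem_mul (ha.1 _) (hb.1 _)
    | add a _ b _ ha hb =>
      simp only [coeff_add]
      exact ⟨add_mem ha.1 hb.1, add_mem ha.2.1 hb.2.1, fun i => add_mem (ha.2.2 i) (hb.2.2 i)⟩
  · rintro ⟨h0, h1, h2⟩
    have key : ∀ (A B : Ideal S) (i : ℕ), (∀ a ∈ A, ∀ b ∈ B,
        C (a * b) * X ^ i ∈ stepIdeal I J * stepIdeal I J) → ∀ s ∈ A * B,
        C s * X ^ i ∈ stepIdeal I J * stepIdeal I J := by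
      intro A B i h s hs
      induction hs using Submodule.mul_induction_on' with
      | mem_mul_mem a ha b hb => exact h a ha b hb
      | add a _ b _ ha hb =>
        rw [C_add, add_mul]
        exact add_mem ha hb
    refine mem_of_forall_coeff fun i => ?_
    rcases i with _ | _ | i
    · rw [sq] at h0
      refine key I I 0 (fun a ha b hb => ?_) _ h0
      rw [pow_zero, mul_one, C_mul]
      exact Ideal.mul_mem_mul (C_mem_stepIdeal hIJ ha) (C_mem_stepIdeal hIJ hb)
    · refine key I J 1 (fun a ha b hb => ?_) _ h1
      rw [C_mul, mul_assoc]
      exact Ideal.mul_mem_mul (C_mem_stepIdeal hIJ ha) (C_mul_X_pow_mem_stepIdeal hb one_ne_zero)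
    · have h3 := h2 (i + 1 + 1)
      rw [sq] at h3
      refine key J J (i + 1 + 1) (fun a ha b hb => ?_) _ h3
      rw [C_mul, pow_succ, show C a * C b * (X ^ (i + 1) * X) = C a * X ^ (i + 1) * (C b * X ^ 1) by
        ring]
      exact Ideal.mul_mem_mul (C_mul_X_pow_mem_stepIdeal ha (by omega))
        (C_mul_X_pow_mem_stepIdeal hb one_ne_zero)

/-! ### The square of the ideal of the special fibre -/

/-- The sequence of ideals of coefficients of remainders for `(I + X J) ^ 2 + (X ^ d - p)`. -/
def sqSeq (I J : Ideal S) (p : S) : ℕ → Ideal S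
  | 0 => I ^ 2 ⊔ Ideal.span {p} * J ^ 2
  | 1 => I * J
  | _ + 2 => J ^ 2

theorem remainderCompatible_sqSeq [Nontrivial S] {d : ℕ} (hd : 2 ≤ d) {p : S} (hIJ : I ≤ J)
    (hp : ∀ s ∈ J, p * s ∈ I) :
    RemainderCompatible (rayPoly d 0 p) (sqSeq I J p) where
  monic := monic_rayPoly hd 0 p
  mono := fun i _ => by
    have hp2 : Ideal.span {p} * J ^ 2 ≤ I * J := by
      rw [sq, ← mul_assoc]
      refine Ideal.mul_mono_left ?_
      rw [Ideal.span_singleton_mul_le_iff]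
      exact hp
    rcases i with _ | _ | i
    · change I ^ 2 ⊔ Ideal.span {p} * J ^ 2 ≤ I * J
      refine sup_le ?_ hp2
      rw [sq]
      exact Ideal.mul_mono_right hIJ
    · change I * J ≤ J ^ 2
      rw [sq]
      exact Ideal.mul_mono_left hIJ
    · exact le_rfl
  last := fun i hi s hs => by
    rw [natDegree_rayPoly hd] at hi hs
    have hs' : s ∈ J ^ 2 := by
      have hIJ2 : I * J ≤ J ^ 2 := by
        rw [sq]
        exact Ideal.mul_mono_left hIJ
      obtain ⟨e, rfl⟩ : ∃ e, d = e + 2 := ⟨d - 2, by omega⟩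
      rcases e with _ | e
      · exact hIJ2 hs
      · exact hs
    rcases i with _ | i
    · have h0 : (rayPoly d 0 p).coeff 0 = -p := by
        simp [rayPoly, coeff_X_pow, (by omega : d ≠ 0).symm]
      rw [h0, neg_mul]
      exact neg_mem (Ideal.mem_sup_right (Ideal.mul_mem_mul (Ideal.mem_span_singleton_self p) hs'))
    · have h0 : (rayPoly d 0 p).coeff (i + 1) = 0 := by
        simp [rayPoly, coeff_X_pow, hi.ne]
      rw [h0, zero_mul]
      exact zero_mem _

theorem C_mul_X_pow_mem_mul_self (hIJ : I ≤ J) {s : S} (hs : s ∈ J ^ 2) {i : ℕ} (hi : 2 ≤ i) :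
    C s * X ^ i ∈ stepIdeal I J * stepIdeal I J := by
  rw [mem_stepIdeal_mul_self hIJ]
  refine ⟨?_, ?_, fun j => ?_⟩
  · rw [coeff_C_mul_X_pow, if_neg (by omega)]
    exact zero_mem _
  · rw [coeff_C_mul_X_pow, if_neg (by omega)]
    exact zero_mem _
  · rw [coeff_C_mul_X_pow]
    split_ifs
    · exact hs
    · exact zero_mem _

theorem C_mem_mul_self (hIJ : I ≤ J) {s : S} (hs : s ∈ I ^ 2) :
    C s ∈ stepIdeal I J * stepIdeal I J := by
  rw [mem_stepIdeal_mul_self hIJ]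
  refine ⟨by simpa using hs, by simp, fun j => ?_⟩
  rw [coeff_C]
  split_ifs
  · exact Ideal.pow_right_mono hIJ 2 hs
  · exact zero_mem _

/-- If `𝔰 = I + X J` and `δ` is the ray polynomial, so that the ray ideal is `𝔰 + (δ)`, its square
is `𝔰 ^ 2 + δ (𝔰 + (δ))`. -/
theorem mem_rayIdeal_sq {d : ℕ} {l p : S} {q : S[X]} : q ∈ rayIdeal I J d l p ^ 2 ↔
    ∃ a ∈ stepIdeal I J * stepIdeal I J, ∃ b ∈ rayIdeal I J d l p, a + rayPoly d l p * b = q := by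
  have h : rayIdeal I J d l p ^ 2 = stepIdeal I J * stepIdeal I J ⊔
      Ideal.span {rayPoly d l p} * rayIdeal I J d l p := by
    rw [sq]
    conv_lhs => rw [rayIdeal, Ideal.sup_mul, Ideal.mul_sup, Ideal.mul_sup]
    rw [rayIdeal, Ideal.mul_sup, mul_comm (stepIdeal I J) (Ideal.span _)]
    refine le_antisymm (sup_le (sup_le le_sup_left ?_) le_sup_right)
      (sup_le (le_sup_left.trans le_sup_left) le_sup_right)
    exact le_sup_left.trans le_sup_right
  rw [h, Submodule.mem_sup]
  constructor
  · rintro ⟨a, ha, b, hb, rfl⟩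
    obtain ⟨b', hb', rfl⟩ := Ideal.mem_span_singleton_mul.mp hb
    exact ⟨a, ha, b', hb', rfl⟩
  · rintro ⟨a, ha, b, hb, rfl⟩
    exact ⟨a, ha, _, Ideal.mem_span_singleton_mul.mpr ⟨b, hb, rfl⟩, rfl⟩

theorem rayPoly_mul_mem_sq {d : ℕ} {l p : S} {b : S[X]} (hb : b ∈ rayIdeal I J d l p) :
    rayPoly d l p * b ∈ rayIdeal I J d l p ^ 2 := by
  rw [sq]
  exact Ideal.mul_mem_mul (Ideal.mem_sup_right (Ideal.mem_span_singleton_self _)) hb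

theorem mul_self_le_rayIdeal_sq {d : ℕ} {l p : S} :
    stepIdeal I J * stepIdeal I J ≤ rayIdeal I J d l p ^ 2 := by
  rw [sq]
  exact Ideal.mul_mono le_sup_left le_sup_left

theorem colon_sup_le {p : S} (hIJ : I ≤ J) : I ⊔ (J ^ 2 ⊓ (I ^ 2).colon {p}) ≤ J :=
  sup_le hIJ (inf_le_left.trans (Ideal.pow_le_self two_ne_zero))

variable [Nontrivial S] {d : ℕ} {p : S}

/-- The ideal `𝔞 ^ 2 + (δ)`, where `𝔞` is the ideal of the special fibre and `δ = X ^ d - p`, in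
terms of remainders modulo `δ`. -/
theorem rayIdeal_sq_sup (hd : 2 ≤ d) (hIJ : I ≤ J) (hp : ∀ s ∈ J, p * s ∈ I) :
    rayIdeal I J d 0 p ^ 2 ⊔ Ideal.span {rayPoly d 0 p} =
      (remainderCompatible_sqSeq hd hIJ hp).ideal := by
  set h := remainderCompatible_sqSeq hd hIJ hp with hh
  have hdeg := natDegree_rayPoly hd 0 p
  have hδ : rayPoly d 0 p = X ^ d - C p := by simp [rayPoly]
  -- in degrees at least `d` the relation `X ^ d = p` is used
  have hX : ∀ s ∈ J ^ 2, ∀ i, 2 ≤ i → C s * X ^ i ∈ h.ideal := by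
    intro s hs i hi
    by_cases hid : i < d
    · refine h.C_mul_X_pow_mem_ideal (by rwa [hdeg]) ?_
      obtain ⟨e, rfl⟩ : ∃ e, i = e + 2 := ⟨i - 2, by omega⟩
      exact hs
    · obtain ⟨m, rfl⟩ := Nat.exists_eq_add_of_le (not_lt.mp hid)
      have h1 : C (p * s) ∈ h.ideal := by
        have := h.C_mul_X_pow_mem_ideal (i := 0) (by rw [hdeg]; omega) (s := p * s)
          (Ideal.mem_sup_right (Ideal.mul_mem_mul (Ideal.mem_span_singleton_self p) hs))
        simpa using this
      have h2 : C s * X ^ (d + m) = X ^ m * C (p * s) + rayPoly d 0 p * (C s * X ^ m) := by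
        rw [hδ, C_mul]
        ring
      rw [h2]
      exact add_mem (h.ideal.mul_mem_left _ h1) (h.mul_mem_ideal _)
  refine le_antisymm (sup_le ?_ ?_) ?_
  · intro q hq
    obtain ⟨a, ha, b, -, rfl⟩ := mem_rayIdeal_sq.mp hq
    refine add_mem ?_ (h.mul_mem_ideal b)
    rw [mem_stepIdeal_mul_self hIJ] at ha
    refine mem_of_forall_coeff fun i => ?_
    rcases i with _ | _ | i
    · exact h.C_mul_X_pow_mem_ideal (by rw [hdeg]; omega) (Ideal.mem_sup_left ha.1)
    · exact h.C_mul_X_pow_mem_ideal (by rw [hdeg]; omega) ha.2.1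
    · exact hX _ (ha.2.2 _) _ (by omega)
  · rw [Ideal.span_singleton_le_iff_mem]
    exact h.self_mem_ideal
  · refine h.ideal_le (Ideal.mem_sup_right (Ideal.mem_span_singleton_self _)) fun i _ s hs => ?_
    rcases i with _ | _ | i
    · obtain ⟨a, ha, b, hb, rfl⟩ := Submodule.mem_sup.mp hs
      obtain ⟨b', hb', rfl⟩ := Ideal.mem_span_singleton_mul.mp hb
      have h2 : C (a + p * b') * X ^ 0 = (C a + C b' * X ^ d) + rayPoly d 0 p * (- C b') := by
        rw [hδ, C_add, C_mul]
        ring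
      rw [h2]
      refine add_mem (Ideal.mem_sup_left (mul_self_le_rayIdeal_sq (add_mem (C_mem_mul_self hIJ ha)
        (C_mul_X_pow_mem_mul_self hIJ hb' hd)))) (Ideal.mem_sup_right ?_)
      exact Ideal.mul_mem_right _ _ (Ideal.mem_span_singleton_self _)
    · refine Ideal.mem_sup_left (mul_self_le_rayIdeal_sq ?_)
      have hs' : s ∈ I * J := hs
      rw [mem_stepIdeal_mul_self hIJ]
      refine ⟨by simp [coeff_X], by simpa using hs', fun j => ?_⟩
      rw [coeff_C_mul_X_pow]
      split_ifs
      · rw [sq]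
        exact Ideal.mul_mono_left hIJ hs'
      · exact zero_mem _
    · refine Ideal.mem_sup_left (mul_self_le_rayIdeal_sq ?_)
      exact C_mul_X_pow_mem_mul_self hIJ hs (by omega)

/-- The ideal `(𝔞 ^ 2 : δ)`, where `𝔞` is the ideal of the special fibre and `δ = X ^ d - p`: it
differs from `𝔞` in the constant terms of the remainders modulo `δ`, which may lie in
`I + (J ^ 2 ⊓ (I ^ 2 : p))`. -/
theorem rayPoly_mul_mem_iff (hd : 2 ≤ d) (hIJ : I ≤ J) (hpJ : p ∈ J) (hp : ∀ s ∈ J, p * s ∈ I)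
    (h : S[X]) : rayPoly d 0 p * h ∈ rayIdeal I J d 0 p ^ 2 ↔
      h ∈ (remainderCompatible_ray hd 0 (colon_sup_le hIJ (p := p))
        (fun s hs => Ideal.mem_sup_left (hp s hs))).ideal := by
  set h₁ := remainderCompatible_ray hd 0 hIJ hp
  set h₃ := remainderCompatible_ray hd 0 (colon_sup_le hIJ (p := p))
        (fun s hs => Ideal.mem_sup_left (hp s hs))
  have hdeg := natDegree_rayPoly hd 0 p
  have hδ : rayPoly d 0 p = X ^ d - C p := by simp [rayPoly]
  have hle : rayIdeal I J d 0 p ≤ h₃.ideal := by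
    rw [rayIdeal_eq hd 0 hIJ hp]
    refine h₁.ideal_mono h₃ fun i => ?_
    rcases i with _ | i
    · exact le_sup_left
    · exact le_rfl
  constructor
  · intro hh
    obtain ⟨a, ha, b, hb, hab⟩ := mem_rayIdeal_sq.mp hh
    set g := h - b with hg
    have hga : rayPoly d 0 p * g = a := by
      rw [hg]
      linear_combination -hab
    rw [← hga, mem_stepIdeal_mul_self hIJ] at ha
    have hcoeff : ∀ i, (rayPoly d 0 p * g).coeff i =
        (if d ≤ i then g.coeff (i - d) else 0) - p * g.coeff i := fun i => by
      rw [hδ, sub_mul, coeff_sub, coeff_C_mul, coeff_X_pow_mul']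
    -- each coefficient is congruent to `p` times a later one, and `p ^ 2 ∈ J ^ 2`
    have hrec : ∀ j, g.coeff j - p * g.coeff (j + d) ∈ J ^ 2 := fun j => by
      have := ha.2.2 (j + d)
      rwa [hcoeff, if_pos (by omega), Nat.add_sub_cancel] at this
    have hgJ : ∀ j, g.coeff j ∈ J ^ 2 := fun j => by
      have h2 : g.coeff j = (g.coeff j - p * g.coeff (j + d)) +
          p * (g.coeff (j + d) - p * g.coeff (j + d + d)) + p ^ 2 * g.coeff (j + d + d) := by ring
      rw [h2]
      exact add_mem (add_mem (hrec j) (Ideal.mul_mem_left _ _ (hrec _)))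
        (Ideal.mul_mem_right _ _ (Ideal.pow_mem_pow hpJ 2))
    have hg0 : p * g.coeff 0 ∈ I ^ 2 := by
      have := ha.1
      rwa [hcoeff, if_neg (by omega), zero_sub, neg_mem_iff] at this
    have hh' : h = g + b := by rw [hg]; ring
    rw [hh']
    refine add_mem (mem_of_forall_coeff fun i => ?_) (hle hb)
    rcases i with _ | i
    · refine h₃.C_mul_X_pow_mem_ideal (by rw [hdeg]; omega) (Ideal.mem_sup_right ⟨hgJ 0, ?_⟩)
      simp only [SetLike.mem_coe]
      rw [Submodule.mem_colon_singleton, smul_eq_mul, mul_comm]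
      exact hg0
    · exact hle (Ideal.mem_sup_left (C_mul_X_pow_mem_stepIdeal
        (Ideal.pow_le_self two_ne_zero (hgJ _)) (by omega)))
  · have key : h₃.ideal ≤ (rayIdeal I J d 0 p ^ 2).colon {rayPoly d 0 p} := by
      refine h₃.ideal_le ?_ fun i _ s hs => ?_
      · rw [Submodule.mem_colon_singleton]
        exact rayPoly_mul_mem_sq (Ideal.mem_sup_right (Ideal.mem_span_singleton_self _))
      rw [Submodule.mem_colon_singleton, smul_eq_mul, mul_comm]
      rcases i with _ | i
      · obtain ⟨a, ha, b, ⟨hb, hb'⟩, rfl⟩ := Submodule.mem_sup.mp hs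
        simp only [SetLike.mem_coe] at hb hb'
        rw [Submodule.mem_colon_singleton, smul_eq_mul, mul_comm] at hb'
        have h2 : rayPoly d 0 p * (C (a + b) * X ^ 0) =
            rayPoly d 0 p * C a + (C b * X ^ d - C (p * b)) := by
          rw [hδ, C_add, C_mul]
          ring
        rw [h2]
        exact add_mem (rayPoly_mul_mem_sq (Ideal.mem_sup_left (C_mem_stepIdeal hIJ ha)))
          (mul_self_le_rayIdeal_sq (sub_mem (C_mul_X_pow_mem_mul_self hIJ hb hd)
            (C_mem_mul_self hIJ hb')))
      · exact rayPoly_mul_mem_sq (Ideal.mem_sup_left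
          (C_mul_X_pow_mem_stepIdeal hs (by omega)))
    intro hh
    have := Submodule.mem_colon_singleton.mp (key hh)
    rwa [smul_eq_mul, mul_comm] at this

end Ray

/-! ### Colengths of ray ideals -/

section RayColength

variable {k S : Type*} [Field k] [CommRing S] [Algebra k S] [Nontrivial S] {I J : Ideal S} {d : ℕ}
  {p : S}

/-- All ray ideals with the same `I`, `J` and `d` have the same colength. -/
theorem finrank_quotient_rayIdeal (hd : 2 ≤ d) (l : S) (hIJ : I ≤ J) (hp : ∀ s ∈ J, p * s ∈ I)
    [Module.Finite k (S ⧸ I)] :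
    Module.Finite k (S[X] ⧸ rayIdeal I J d l p) ∧ finrank k (S[X] ⧸ rayIdeal I J d l p) =
      finrank k (S ⧸ I) + (d - 1) * finrank k (S ⧸ J) := by
  have : ∀ i : ℕ, Module.Finite k (S ⧸ raySeq I J i) := fun i => by
    rcases i with _ | i
    · exact inferInstanceAs (Module.Finite k (S ⧸ I))
    · exact finite_quotient_of_le hIJ
  obtain ⟨h1, h2⟩ := (remainderCompatible_ray hd l hIJ hp).finrank_quotient_ideal (k := k)
  rw [rayIdeal_eq hd l hIJ hp]
  refine ⟨h1, ?_⟩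
  rw [h2, natDegree_rayPoly hd]
  obtain ⟨e, rfl⟩ : ∃ e, d = e + 1 := ⟨d - 1, by omega⟩
  rw [Finset.sum_range_succ']
  have h0 : finrank k (S ⧸ raySeq I J 0) = finrank k (S ⧸ I) := rfl
  have h1 : ∀ i, finrank k (S ⧸ raySeq I J (i + 1)) = finrank k (S ⧸ J) := fun i => rfl
  rw [Finset.sum_congr rfl fun i _ => h1 i, h0]
  simp [add_comm]

theorem mul_le_sq_inf_colon {S : Type*} [CommRing S] {I J : Ideal S} {p : S} (hIJ : I ≤ J)
    (hp : ∀ s ∈ J, p * s ∈ I) : I * J ≤ J ^ 2 ⊓ (I ^ 2).colon {p} := by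
  refine le_inf ?_ fun x hx => ?_
  · rw [sq]
    exact Ideal.mul_mono_left hIJ
  · have h1 : p * x ∈ I * (Ideal.span {p} * J) := by
      rw [mul_left_comm]
      exact Ideal.mul_mem_mul (Ideal.mem_span_singleton_self p) hx
    rw [Submodule.mem_colon_singleton, smul_eq_mul, mul_comm, sq]
    refine Ideal.mul_mono_right ?_ h1
    rw [Ideal.span_singleton_mul_le_iff]
    exact hp

/-- The square of the ideal `𝔞` of the special fibre has the colength that is expected of an
unobstructed scheme if and only if `I ⊓ J ^ 2 ⊓ (I ^ 2 : p) = I * J`. Its colength is the sum of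
those of `𝔞 ^ 2 + (δ)` and `(𝔞 ^ 2 : δ)` for `δ = X ^ d - p`, which are sums of colengths in `S`. -/
theorem finrank_quotient_rayIdeal_sq_iff (hd : 2 ≤ d) (hIJ : I ≤ J) (hpJ : p ∈ J)
    (hp : ∀ s ∈ J, p * s ∈ I) [Module.Finite k (S ⧸ I ^ 2)] {m : ℕ}
    (hI : finrank k (S ⧸ I ^ 2) = (m + 1) * finrank k (S ⧸ I))
    (hJ : finrank k (S ⧸ J ^ 2) = (m + 1) * finrank k (S ⧸ J)) :
    Module.Finite k (S[X] ⧸ rayIdeal I J d 0 p ^ 2) ∧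
    (finrank k (S[X] ⧸ rayIdeal I J d 0 p ^ 2) =
      (m + 2) * (finrank k (S ⧸ I) + (d - 1) * finrank k (S ⧸ J)) ↔
      I ⊓ J ^ 2 ⊓ (I ^ 2).colon {p} = I * J) := by
  set N : Ideal S := J ^ 2 ⊓ (I ^ 2).colon {p} with hN
  have hmemN : ∀ x, x ∈ N ↔ x ∈ J ^ 2 ∧ p * x ∈ I ^ 2 := fun x => by
    rw [hN, Submodule.mem_inf, Submodule.mem_colon_singleton, smul_eq_mul, mul_comm]
  have hI2 : I ^ 2 ≤ I * J := by
    rw [sq]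
    exact Ideal.mul_mono_right hIJ
  have hIJJ : I * J ≤ J ^ 2 := by
    rw [sq]
    exact Ideal.mul_mono_left hIJ
  have hIJN : I * J ≤ N := mul_le_sq_inf_colon hIJ hp
  have fin : ∀ {K : Ideal S}, I ^ 2 ≤ K → Module.Finite k (S ⧸ K) := fun h =>
    finite_quotient_of_le h
  have fI : Module.Finite k (S ⧸ I) := fin (Ideal.pow_le_self two_ne_zero)
  have fJ : Module.Finite k (S ⧸ J) := finite_quotient_of_le hIJ
  have fN : Module.Finite k (S ⧸ N) := fin (hI2.trans hIJN)
  have fseq : ∀ i, Module.Finite k (S ⧸ sqSeq I J p i) := fun i => fin (by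
    rcases i with _ | _ | i
    · exact le_sup_left
    · exact hI2
    · exact hI2.trans hIJJ)
  have fray : ∀ i : ℕ, Module.Finite k (S ⧸ raySeq (I ⊔ N) J i) := fun i => by
    rcases i with _ | i
    · exact fin ((Ideal.pow_le_self two_ne_zero).trans le_sup_left)
    · exact fJ
  obtain ⟨f2, h2⟩ := (remainderCompatible_sqSeq hd hIJ hp).finrank_quotient_ideal (k := k)
  obtain ⟨f3, h3⟩ := (remainderCompatible_ray hd 0 (colon_sup_le hIJ (p := p))
        (fun s hs => Ideal.mem_sup_left (hp s hs))).finrank_quotient_ideal (k := k)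
  rw [← rayIdeal_sq_sup hd hIJ hp] at f2 h2
  have fs : Module.Finite k (S[X] ⧸ rayIdeal I J d 0 p ^ 2 ⊔ Ideal.span {rayPoly d 0 p} * ⊤) := by
    rwa [Ideal.mul_top]
  obtain ⟨f4, h4⟩ := finrank_quotient_add_finrank_quotient (k := k) (rayIdeal I J d 0 p ^ 2) ⊤
    (remainderCompatible_ray hd 0 (colon_sup_le hIJ (p := p))
        (fun s hs => Ideal.mem_sup_left (hp s hs))).ideal (rayPoly d 0 p) (fun x => by
      rw [rayPoly_mul_mem_iff hd hIJ hpJ hp]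
      simp)
  refine ⟨f4, ?_⟩
  have f0 : Module.Finite k (S ⧸ I ^ 2 ⊔ Ideal.span {p} * J ^ 2) := fin le_sup_left
  obtain ⟨-, h5⟩ := finrank_quotient_add_finrank_quotient (k := k) (I ^ 2) (J ^ 2) N p hmemN
  have f6 : Module.Finite k (S ⧸ I ⊓ N) := fin (le_inf (Ideal.pow_le_self two_ne_zero)
    (hI2.trans hIJN))
  have h6 := finrank_quotient_sup_add_inf (k := k) I N
  have htop : finrank k (S[X] ⧸ (⊤ : Ideal S[X])) = 0 :=
    finrank_zero_of_subsingleton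
  rw [Ideal.mul_top, htop, add_zero] at h4
  obtain ⟨e, rfl⟩ : ∃ e, d = e + 2 := ⟨d - 2, by omega⟩
  rw [natDegree_rayPoly hd] at h2 h3
  rw [Finset.sum_range_succ', Finset.sum_range_succ'] at h2
  rw [Finset.sum_range_succ'] at h3
  have s0 : finrank k (S ⧸ sqSeq I J p 0) = finrank k (S ⧸ I ^ 2 ⊔ Ideal.span {p} * J ^ 2) := rfl
  have s1 : finrank k (S ⧸ sqSeq I J p (0 + 1)) = finrank k (S ⧸ I * J) := rfl
  have s2 : ∀ i, finrank k (S ⧸ sqSeq I J p (i + 1 + 1)) = finrank k (S ⧸ J ^ 2) := fun i => rfl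
  have t0 : finrank k (S ⧸ raySeq (I ⊔ (J ^ 2 ⊓ (I ^ 2).colon {p})) J 0) =
      finrank k (S ⧸ I ⊔ N) := rfl
  have t1 : ∀ i, finrank k (S ⧸ raySeq (I ⊔ (J ^ 2 ⊓ (I ^ 2).colon {p})) J (i + 1)) =
      finrank k (S ⧸ J) := fun i => rfl
  rw [Finset.sum_congr rfl fun i _ => s2 i, s0, s1, Finset.sum_const, Finset.card_range,
    smul_eq_mul] at h2
  rw [Finset.sum_congr rfl fun i _ => t1 i, t0, Finset.sum_const, Finset.card_range,
    smul_eq_mul] at h3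
  have hd1 : e + 2 - 1 = e + 1 := rfl
  -- the colength of the square exceeds the expected one by the dimension of `(I ⊓ N) ⧸ I * J`
  have key : finrank k (S[X] ⧸ rayIdeal I J (e + 2) 0 p ^ 2) + finrank k (S ⧸ I ⊓ N) =
      (m + 2) * (finrank k (S ⧸ I) + (e + 1) * finrank k (S ⧸ J)) + finrank k (S ⧸ I * J) := by
    rw [h4, h2, h3]
    zify at *
    linear_combination h6 - h5 + hI + (e + 1) * hJ
  rw [hd1, inf_assoc]
  have fIJ : Module.Finite k (S ⧸ I * J) := fin hI2
  constructor
  · intro h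
    refine (eq_of_le_of_finrank_quotient_eq (k := k) (le_inf Ideal.mul_le_left hIJN) ?_).symm
    omega
  · intro h
    rw [h] at key
    omega

end RayColength

/-! ### The general fibre -/

theorem finite_quotient_inf {k R : Type*} [Field k] [CommRing R] [Algebra k R] (I J : Ideal R)
    [Module.Finite k (R ⧸ I)] [Module.Finite k (R ⧸ J)] : Module.Finite k (R ⧸ I ⊓ J) := by
  refine Module.Finite.of_injective
    ((Ideal.Quotient.factorₐ k (inf_le_left : I ⊓ J ≤ I)).toLinearMap.prod
      (Ideal.Quotient.factorₐ k (inf_le_right : I ⊓ J ≤ J)).toLinearMap) ?_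
  rw [injective_iff_map_eq_zero]
  intro x hx
  obtain ⟨x, rfl⟩ := Ideal.Quotient.mk_surjective x
  have h1 := congrArg Prod.fst hx
  have h2 := congrArg Prod.snd hx
  exact Ideal.Quotient.eq_zero_iff_mem.mpr
    ⟨Ideal.Quotient.eq_zero_iff_mem.mp h1, Ideal.Quotient.eq_zero_iff_mem.mp h2⟩

section General

variable {S : Type*} [CommRing S] {I J B : Ideal S} {d : ℕ} {l p v : S}

theorem remainderCompatible_const {q : S[X]} (hq : q.Monic) :
    RemainderCompatible q (fun _ => B) where
  monic := hq
  mono := fun _ _ => le_rfl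
  last := fun _ _ _ hs => B.mul_mem_left _ hs

theorem map_C_sup_span_eq {q : S[X]} (hq : q.Monic) :
    B.map C ⊔ Ideal.span {q} = (remainderCompatible_const hq (B := B)).ideal := by
  set h := remainderCompatible_const hq (B := B)
  refine le_antisymm (sup_le ?_ ?_) ?_
  · rw [Ideal.map_le_iff_le_comap]
    intro s hs i hi
    have h0 : 0 < q.natDegree := by omega
    have := h.C_mul_X_pow_mem_ideal h0 hs
    rw [pow_zero, mul_one] at this
    exact this i hi
  · rw [Ideal.span_singleton_le_iff_mem]
    exact h.self_mem_ideal
  · exact h.ideal_le (Ideal.mem_sup_right (Ideal.mem_span_singleton_self _)) fun i _ s hs =>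
      Ideal.mem_sup_left (Ideal.mul_mem_right _ _ (Ideal.mem_map_of_mem _ hs))

theorem finrank_quotient_map_C_sup_span {k : Type*} [Field k] [Algebra k S] [Nontrivial S]
    [Module.Finite k (S ⧸ B)] {q : S[X]} (hq : q.Monic) :
    Module.Finite k (S[X] ⧸ B.map C ⊔ Ideal.span {q}) ∧
      finrank k (S[X] ⧸ B.map C ⊔ Ideal.span {q}) = q.natDegree * finrank k (S ⧸ B) := by
  obtain ⟨h1, h2⟩ := (remainderCompatible_const hq (B := B)).finrank_quotient_ideal (k := k)
  rw [map_C_sup_span_eq hq]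
  exact ⟨h1, h2.trans (by simp)⟩

/-- For a monic polynomial `q` the square of the ideal `(B, q)` has the expected colength. -/
theorem finrank_quotient_map_C_sup_span_sq {k : Type*} [Field k] [Algebra k S] [Nontrivial S]
    [Module.Finite k (S ⧸ B ^ 2)] {q : S[X]} (hq : q.Monic) :
    Module.Finite k (S[X] ⧸ (B.map C ⊔ Ideal.span {q}) ^ 2) ∧
      finrank k (S[X] ⧸ (B.map C ⊔ Ideal.span {q}) ^ 2) =
        q.natDegree * (finrank k (S ⧸ B ^ 2) + finrank k (S ⧸ B)) := by
  set A := B.map C ⊔ Ideal.span {q} with hA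
  have fB : Module.Finite k (S ⧸ B) := finite_quotient_of_le (Ideal.pow_le_self two_ne_zero)
  have hqA : q ∈ A := Ideal.mem_sup_right (Ideal.mem_span_singleton_self _)
  have hsq : A ^ 2 = (B ^ 2).map C ⊔ Ideal.span {q} * A := by
    rw [Ideal.map_pow, sq, sq]
    conv_lhs => rw [hA, Ideal.sup_mul, Ideal.mul_sup, Ideal.mul_sup]
    rw [hA, Ideal.mul_sup, mul_comm (B.map C) (Ideal.span _)]
    refine le_antisymm (sup_le (sup_le le_sup_left ?_) le_sup_right)
      (sup_le (le_sup_left.trans le_sup_left) le_sup_right)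
    exact le_sup_left.trans le_sup_right
  have hsup : A ^ 2 ⊔ Ideal.span {q} * ⊤ = (B ^ 2).map C ⊔ Ideal.span {q} := by
    rw [Ideal.mul_top, hsq, sup_assoc,
      sup_eq_right.mpr (Ideal.mul_le_left : Ideal.span {q} * A ≤ Ideal.span {q})]
  have hcolon : ∀ x, x ∈ A ↔ x ∈ (⊤ : Ideal S[X]) ∧ q * x ∈ A ^ 2 := fun x => by
    refine ⟨fun hx => ⟨trivial, ?_⟩, fun hx => ?_⟩
    · rw [sq]
      exact Ideal.mul_mem_mul hqA hx
    · have h2 := hx.2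
      rw [hsq, Submodule.mem_sup] at h2
      obtain ⟨a, ha, b, hb, hab⟩ := h2
      obtain ⟨b', hb', rfl⟩ := Ideal.mem_span_singleton_mul.mp hb
      -- division by the monic polynomial `q` modulo `B ^ 2`
      have h3 : q * (x - b') ∈ (B ^ 2).map C := by
        have : q * (x - b') = a := by linear_combination -hab
        rwa [this]
      have h4 : x - b' ∈ (B ^ 2).map C := by
        rw [← Ideal.mk_ker (I := B ^ 2), ← ker_mapRingHom, RingHom.mem_ker, coe_mapRingHom] at h3 ⊢
        rw [Polynomial.map_mul] at h3
        exact (hq.map _).mul_right_eq_zero_iff.mp h3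
      have h5 : (B ^ 2).map C ≤ A := by
        rw [hA]
        exact (Ideal.map_mono (Ideal.pow_le_self two_ne_zero)).trans le_sup_left
      have := add_mem (h5 h4) hb'
      rwa [sub_add_cancel] at this
  obtain ⟨f1, h1⟩ := finrank_quotient_map_C_sup_span (k := k) hq (B := B)
  obtain ⟨f2, h2⟩ := finrank_quotient_map_C_sup_span (k := k) hq (B := B ^ 2)
  rw [← hA] at f1 h1
  rw [← hsup] at f2 h2
  obtain ⟨f3, h3⟩ := finrank_quotient_add_finrank_quotient (k := k) (A ^ 2) ⊤ A q hcolon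
  have htop : finrank k (S[X] ⧸ (⊤ : Ideal S[X])) = 0 := finrank_zero_of_subsingleton
  refine ⟨f3, ?_⟩
  rw [htop, add_zero] at h3
  rw [h3, h2, h1]
  ring

theorem X_sq_mem (hpJ : p ∈ J) (hp : ∀ s ∈ J, p * s ∈ I) :
    (X : S[X]) ^ 2 ∈ I.map C ⊔ Ideal.span {X + C (p * v)} := by
  have h : (X : S[X]) ^ 2 = C (p * p) * C (v * v) + (X + C (p * v)) * (X - C (p * v)) := by
    simp only [C_mul]
    ring
  rw [h]
  exact add_mem (Ideal.mem_sup_left (Ideal.mul_mem_right _ _ (Ideal.mem_map_of_mem _ (hp p hpJ))))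
    (Ideal.mem_sup_right (Ideal.mul_mem_right _ _ (Ideal.mem_span_singleton_self _)))

theorem isCoprime_general (hd : 2 ≤ d) (hlv : l * v = 1) (hpJ : p ∈ J) (hp : ∀ s ∈ J, p * s ∈ I) :
    IsCoprime (I.map C ⊔ Ideal.span {X + C (p * v)})
      (J.map C ⊔ Ideal.span {X ^ (d - 1) - C l}) := by
  rw [Ideal.isCoprime_iff_sup_eq, Ideal.eq_top_iff_one]
  have h1 : (X : S[X]) ^ (2 * (d - 1)) ∈ I.map C ⊔ Ideal.span {X + C (p * v)} := by
    rw [pow_mul]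
    exact Ideal.pow_mem_of_mem _ (X_sq_mem hpJ hp) _ (by omega)
  have h2 : (X ^ (d - 1) - C l : S[X]) ∈ J.map C ⊔ Ideal.span {X ^ (d - 1) - C l} :=
    Ideal.mem_sup_right (Ideal.mem_span_singleton_self _)
  have h3 : (1 : S[X]) = X ^ (2 * (d - 1)) * C (v * v) -
      (X ^ (d - 1) - C l) * ((X ^ (d - 1) + C l) * C (v * v)) := by
    have h4 : (C l * C v : S[X]) = 1 := by rw [← C_mul, hlv, C_1]
    rw [C_mul]
    linear_combination (- 1 - C l * C v) * h4
  rw [h3]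
  exact sub_mem (Ideal.mem_sup_left (Ideal.mul_mem_right _ _ h1))
    (Ideal.mem_sup_right (Ideal.mul_mem_right _ _ h2))

/-- Away from the special fibre, where the parameter `l` is invertible with inverse `v`, the ray
family is the disjoint union of the scheme defined by `I`, embedded by `X = - p / l`, and of the
product of the scheme defined by `J` with the zeros of `X ^ (d - 1) - l`. -/
theorem rayIdeal_eq_mul (hd : 2 ≤ d) (hlv : l * v = 1) (hIJ : I ≤ J) (hpJ : p ∈ J)
    (hp : ∀ s ∈ J, p * s ∈ I) :
    rayIdeal I J d l p = (I.map C ⊔ Ideal.span {X + C (p * v)}) *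
      (J.map C ⊔ Ideal.span {X ^ (d - 1) - C l}) := by
  obtain ⟨e, rfl⟩ : ∃ e, d = e + 2 := ⟨d - 2, by omega⟩
  have h4 : (C l * C v : S[X]) = 1 := by rw [← C_mul, hlv, C_1]
  have hs : e + 2 - 1 = e + 1 := rfl
  have hδ : rayPoly (e + 2) l p ∈ rayIdeal I J (e + 2) l p :=
    Ideal.mem_sup_right (Ideal.mem_span_singleton_self _)
  refine le_antisymm ?_ ?_
  · rw [Ideal.mul_eq_inf_of_isCoprime (isCoprime_general hd hlv hpJ hp)]
    refine le_inf (sup_le (stepIdeal_le (fun s hs => ?_) fun s hs => ?_) ?_)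
      (sup_le (inf_le_left.trans le_sup_left) ?_)
    · exact Ideal.mem_sup_left (Ideal.mem_map_of_mem _ hs)
    · have h : C s * X = C s * (X + C (p * v)) - C (p * s) * C v := by
        simp only [C_mul]
        ring
      rw [h]
      exact sub_mem (Ideal.mem_sup_right (Ideal.mul_mem_left _ _ (Ideal.mem_span_singleton_self _)))
        (Ideal.mem_sup_left (Ideal.mul_mem_right _ _ (Ideal.mem_map_of_mem _ (hp s hs))))
    · rw [Ideal.span_singleton_le_iff_mem]
      have h : rayPoly (e + 2) l p = X ^ e * X ^ 2 - C l * (X + C (p * v)) := by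
        rw [rayPoly, C_mul]
        linear_combination C p * h4
      rw [h]
      exact sub_mem (Ideal.mul_mem_left _ _ (X_sq_mem hpJ hp))
        (Ideal.mem_sup_right (Ideal.mul_mem_left _ _ (Ideal.mem_span_singleton_self _)))
    · rw [Ideal.span_singleton_le_iff_mem]
      have h : rayPoly (e + 2) l p = X * (X ^ (e + 1) - C l) - C p := by
        rw [rayPoly]
        ring
      rw [h]
      exact sub_mem (Ideal.mem_sup_right (Ideal.mul_mem_left _ _ (Ideal.mem_span_singleton_self _)))
        (Ideal.mem_sup_left (Ideal.mem_map_of_mem _ hpJ))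
  · rw [Ideal.sup_mul, Ideal.mul_sup, hs]
    have hI : I.map C ≤ rayIdeal I J (e + 2) l p := by
      rw [Ideal.map_le_iff_le_comap]
      exact fun s hs => Ideal.mem_sup_left (C_mem_stepIdeal hIJ hs)
    refine sup_le (sup_le (Ideal.mul_le_left.trans hI) (Ideal.mul_le_left.trans hI)) ?_
    rw [Ideal.mul_sup]
    refine sup_le ?_ ?_
    · rw [mul_comm, Ideal.mul_le]
      intro a ha b hb
      obtain ⟨b, rfl⟩ := Ideal.mem_span_singleton'.mp hb
      rw [mul_left_comm]
      refine Ideal.mul_mem_left _ _ ?_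
      have hle : J.map C ≤ (rayIdeal I J (e + 2) l p).colon {X + C (p * v)} := by
        rw [Ideal.map_le_iff_le_comap]
        intro s hs
        rw [Ideal.mem_comap, Submodule.mem_colon_singleton, smul_eq_mul]
        have h : C s * (X + C (p * v)) = C s * X ^ 1 + C v * C (p * s) := by
          simp only [C_mul]
          ring
        rw [h]
        exact Ideal.mem_sup_left (add_mem (C_mul_X_pow_mem_stepIdeal hs one_ne_zero)
          (Ideal.mul_mem_left _ _ (C_mem_stepIdeal hIJ (hp s hs))))
      exact Submodule.mem_colon_singleton.mp (hle ha)
    · rw [Ideal.span_singleton_mul_span_singleton, Ideal.span_singleton_le_iff_mem]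
      have h : (X + C (p * v)) * (X ^ (e + 1) - C l) =
          rayPoly (e + 2) l p + C v * (C p * X ^ (e + 1)) := by
        rw [rayPoly, C_mul]
        linear_combination (- C p) * h4
      rw [h]
      exact add_mem hδ (Ideal.mem_sup_left (Ideal.mul_mem_left _ _
        (C_mul_X_pow_mem_stepIdeal hpJ (by omega))))

/-- The square of the ideal of a general fibre has the expected colength. -/
theorem finrank_quotient_rayIdeal_sq_general {k : Type*} [Field k] [Algebra k S] [Nontrivial S]
    (hd : 2 ≤ d) (hlv : l * v = 1) (hIJ : I ≤ J) (hpJ : p ∈ J) (hp : ∀ s ∈ J, p * s ∈ I)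
    [Module.Finite k (S ⧸ I ^ 2)] {m : ℕ}
    (hI : finrank k (S ⧸ I ^ 2) = (m + 1) * finrank k (S ⧸ I))
    (hJ : finrank k (S ⧸ J ^ 2) = (m + 1) * finrank k (S ⧸ J)) :
    finrank k (S[X] ⧸ rayIdeal I J d l p ^ 2) =
      (m + 2) * (finrank k (S ⧸ I) + (d - 1) * finrank k (S ⧸ J)) := by
  have fJ : Module.Finite k (S ⧸ J ^ 2) := finite_quotient_of_le (Ideal.pow_right_mono hIJ 2)
  have hq : (X ^ (d - 1) - C l).Monic := monic_X_pow_sub_C l (by omega)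
  obtain ⟨f1, h1⟩ := finrank_quotient_map_C_sup_span_sq (k := k) (monic_X_add_C (p * v)) (B := I)
  obtain ⟨f2, h2⟩ := finrank_quotient_map_C_sup_span_sq (k := k) hq (B := J)
  have hcop := (isCoprime_general hd hlv hpJ hp).pow (m := 2) (n := 2)
  rw [rayIdeal_eq_mul hd hlv hIJ hpJ hp, mul_pow, Ideal.mul_eq_inf_of_isCoprime hcop]
  set A₁ := (I.map C ⊔ Ideal.span {X + C (p * v)}) ^ 2
  set A₂ := (J.map C ⊔ Ideal.span {X ^ (d - 1) - C l}) ^ 2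
  have f3 : Module.Finite k (S[X] ⧸ A₁ ⊓ A₂) := finite_quotient_inf A₁ A₂
  have h3 := finrank_quotient_sup_add_inf (k := k) A₁ A₂
  have htop : finrank k (S[X] ⧸ (⊤ : Ideal S[X])) = 0 := finrank_zero_of_subsingleton
  rw [Ideal.isCoprime_iff_sup_eq.mp hcop, htop, zero_add, h1, h2, natDegree_X_add_C,
    natDegree_X_pow_sub_C, hI, hJ] at h3
  rw [h3]
  ring

end General

section GeneralSmoothable

variable {k : Type u} [Field k] {S : Type u} [CommRing S] [Algebra k S]

/-- The Chinese remainder theorem for two ideals, as an isomorphism of algebras. -/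
def quotientInfAlgEquivProd (k : Type*) {R : Type*} [Field k] [CommRing R] [Algebra k R]
    (I J : Ideal R) (h : IsCoprime I J) : (R ⧸ I ⊓ J) ≃ₐ[k] (R ⧸ I) × (R ⧸ J) :=
  AlgEquiv.ofRingEquiv (f := Ideal.quotientInfEquivQuotientProd I J h) fun _ => rfl

variable (k) in
theorem nonempty_quotient_sup_span_X_sub_C (B : Ideal S) (r : S) :
    Nonempty ((S[X] ⧸ B.map C ⊔ Ideal.span {X - C r}) ≃ₐ[k] S ⧸ B) := by
  let ψ : S[X] →ₐ[k] S ⧸ B :=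
    (Ideal.Quotient.mkₐ k B).comp ((Polynomial.aeval r : S[X] →ₐ[S] S).restrictScalars k)
  have hψ : ∀ q, ψ q = Ideal.Quotient.mk B (q.eval r) := fun q => by
    rw [← Polynomial.coe_aeval_eq_eval]
    rfl
  have hsurj : Function.Surjective ψ := fun y => by
    obtain ⟨y, rfl⟩ := Ideal.Quotient.mk_surjective y
    exact ⟨C y, by rw [hψ, eval_C]⟩
  have hker : B.map C ⊔ Ideal.span {X - C r} = RingHom.ker ψ := by
    refine le_antisymm (sup_le ?_ ?_) fun q hq => ?_
    · rw [Ideal.map_le_iff_le_comap]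
      intro s hs
      rw [Ideal.mem_comap, RingHom.mem_ker, hψ, eval_C, Ideal.Quotient.eq_zero_iff_mem]
      exact hs
    · rw [Ideal.span_singleton_le_iff_mem, RingHom.mem_ker, hψ]
      simp
    · rw [RingHom.mem_ker, hψ, Ideal.Quotient.eq_zero_iff_mem] at hq
      rw [← sub_add_cancel q (C (q.eval r))]
      exact add_mem
        (Ideal.mem_sup_right (Ideal.mem_span_singleton.mpr X_sub_C_dvd_sub_C_eval))
        (Ideal.mem_sup_left (Ideal.mem_map_of_mem _ hq))
  exact ⟨(Ideal.quotientEquivAlgOfEq k hker).trans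
    (Ideal.quotientKerAlgEquivOfSurjective hsurj)⟩

theorem isCoprime_sup_span {R : Type*} [CommRing R] (B : Ideal R) {q q' : R}
    (h : IsCoprime q q') : IsCoprime (B ⊔ Ideal.span {q}) (B ⊔ Ideal.span {q'}) := by
  rw [Ideal.isCoprime_iff_sup_eq, Ideal.eq_top_iff_one]
  obtain ⟨a, b, hab⟩ := h
  rw [← hab]
  exact add_mem
    (Ideal.mem_sup_left (Ideal.mem_sup_right (Ideal.mul_mem_left _ _
      (Ideal.mem_span_singleton_self q))))
    (Ideal.mem_sup_right (Ideal.mem_sup_right (Ideal.mul_mem_left _ _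
      (Ideal.mem_span_singleton_self q'))))

theorem sup_span_inf_sup_span {R : Type*} [CommRing R] (B : Ideal R) {q q' : R}
    (h : IsCoprime q q') :
    (B ⊔ Ideal.span {q}) ⊓ (B ⊔ Ideal.span {q'}) = B ⊔ Ideal.span {q * q'} := by
  refine le_antisymm ?_ (le_inf ?_ ?_)
  · rintro x ⟨h1, h2⟩
    obtain ⟨b, hb, c, hc, rfl⟩ := Submodule.mem_sup.mp h1
    obtain ⟨b', hb', c', hc', hx⟩ := Submodule.mem_sup.mp h2
    obtain ⟨c, rfl⟩ := Ideal.mem_span_singleton'.mp hc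
    obtain ⟨c', rfl⟩ := Ideal.mem_span_singleton'.mp hc'
    obtain ⟨a, e, hae⟩ := h
    have : b + c * q = (a * q * b' + e * q' * b) + (a * c' + e * c) * (q * q') := by
      linear_combination (-(b + c * q)) * hae - (a * q) * hx
    rw [this]
    exact add_mem (Ideal.mem_sup_left (add_mem (Ideal.mul_mem_left _ _ hb')
      (Ideal.mul_mem_left _ _ hb)))
      (Ideal.mem_sup_right (Ideal.mul_mem_left _ _ (Ideal.mem_span_singleton_self _)))
  · exact sup_le_sup_left (Ideal.span_singleton_le_span_singleton.mpr (dvd_mul_right _ _)) _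
  · exact sup_le_sup_left (Ideal.span_singleton_le_span_singleton.mpr (dvd_mul_left _ _)) _

theorem isSmoothable_quotient_prod_X_sub_C [IsAlgClosed k] [Nontrivial S] {B : Ideal S}
    [Module.Finite k (S ⧸ B)] (h : IsSmoothable k (S ⧸ B)) (s : Finset k) :
    IsSmoothable k (S[X] ⧸ B.map C ⊔ Ideal.span {∏ ω ∈ s, (X - C (algebraMap k S ω))}) := by
  classical
  induction s using Finset.induction_on with
  | empty =>
    have : Subsingleton
        (S[X] ⧸ B.map C ⊔ Ideal.span {∏ ω ∈ (∅ : Finset k), (X - C (algebraMap k S ω))}) := by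
      rw [Finset.prod_empty, Ideal.span_singleton_one, sup_top_eq]
      exact Ideal.Quotient.subsingleton_iff.mpr rfl
    exact IsSmoothable.of_subsingleton _
  | insert a s ha ih =>
    have hcop : IsCoprime (X - C (algebraMap k S a)) (∏ ω ∈ s, (X - C (algebraMap k S ω))) := by
      refine IsCoprime.prod_right fun ω hω => ?_
      refine isCoprime_X_sub_C_of_isUnit_sub ?_
      rw [← map_sub]
      exact (isUnit_iff_ne_zero.mpr (sub_ne_zero.mpr fun h => ha (by rwa [h]))).map _
    obtain ⟨e⟩ := nonempty_quotient_sup_span_X_sub_C k B (algebraMap k S a)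
    obtain ⟨f1, -⟩ := finrank_quotient_map_C_sup_span (k := k) (B := B)
      (monic_X_sub_C (algebraMap k S a))
    obtain ⟨f2, -⟩ := finrank_quotient_map_C_sup_span (k := k) (B := B)
      (monic_prod_X_sub_C (algebraMap k S) s)
    have h1 := (h.of_algEquiv e.symm).prod ih
    rw [Finset.prod_insert ha, ← sup_span_inf_sup_span _ hcop]
    exact h1.of_algEquiv (quotientInfAlgEquivProd k _ _ (isCoprime_sup_span _ hcop)).symm

/-- The general fibres of the lower ray family are smoothable: they are disjoint unions of
the scheme of `I` and of `d - 1` copies of the scheme of `J`. -/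
theorem isSmoothable_quotient_rayIdeal [IsAlgClosed k] [Nontrivial S] {I J : Ideal S} {d : ℕ}
    {a : k} {p : S} (hd : 2 ≤ d) (hdk : ((d - 1 : ℕ) : k) ≠ 0) (ha : a ≠ 0) (hIJ : I ≤ J)
    (hpJ : p ∈ J) (hp : ∀ s ∈ J, p * s ∈ I) [Module.Finite k (S ⧸ I)]
    (hI : IsSmoothable k (S ⧸ I)) (hJ : IsSmoothable k (S ⧸ J)) :
    IsSmoothable k (S[X] ⧸ rayIdeal I J d (algebraMap k S a) p) := by
  classical
  have fJ : Module.Finite k (S ⧸ J) := finite_quotient_of_le hIJ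
  have hv : algebraMap k S a * algebraMap k S a⁻¹ = 1 := by
    rw [← map_mul, mul_inv_cancel₀ ha, map_one]
  have hcop := isCoprime_general (I := I) (J := J) hd hv hpJ hp
  rw [rayIdeal_eq_mul hd hv hIJ hpJ hp, Ideal.mul_eq_inf_of_isCoprime hcop]
  -- the `d - 1` roots of `X ^ (d - 1) - a` are distinct because `d - 1` is invertible in `k`
  have hsep : (X ^ (d - 1) - C a : k[X]).Separable := separable_X_pow_sub_C a hdk ha
  have hq : (X ^ (d - 1) - C (algebraMap k S a) : S[X]) =
      ∏ ω ∈ (X ^ (d - 1) - C a : k[X]).roots.toFinset, (X - C (algebraMap k S ω)) := by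
    have h1 : (X ^ (d - 1) - C a : k[X]) =
        ∏ ω ∈ (X ^ (d - 1) - C a : k[X]).roots.toFinset, (X - C ω) := by
      rw [Finset.prod, Multiset.toFinset_val, Multiset.dedup_eq_self.mpr (nodup_roots hsep)]
      exact (IsAlgClosed.splits (X ^ (d - 1) - C a : k[X])).eq_prod_roots_of_monic
        (monic_X_pow_sub_C a (by omega))
    have h2 := congrArg (Polynomial.map (algebraMap k S)) h1
    rw [Polynomial.map_prod] at h2
    simpa using h2
  have hX : (X + C (p * algebraMap k S a⁻¹) : S[X]) = X - C (-(p * algebraMap k S a⁻¹)) := by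
    rw [C_neg, sub_neg_eq_add]
  obtain ⟨e⟩ := nonempty_quotient_sup_span_X_sub_C k I (-(p * algebraMap k S a⁻¹))
  obtain ⟨f1, -⟩ := finrank_quotient_map_C_sup_span (k := k) (B := I)
    (monic_X_sub_C (-(p * algebraMap k S a⁻¹)))
  obtain ⟨f2, -⟩ := finrank_quotient_map_C_sup_span (k := k) (B := J)
    (monic_X_pow_sub_C (algebraMap k S a) (n := d - 1) (by omega))
  have h2 := isSmoothable_quotient_prod_X_sub_C hJ (X ^ (d - 1) - C a : k[X]).roots.toFinset
  rw [← hq] at h2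
  have h1 := (hI.of_algEquiv e.symm)
  rw [← hX] at h1 f1
  exact (h1.prod h2).of_algEquiv (quotientInfAlgEquivProd k _ _ hcop).symm

end GeneralSmoothable

/-! ### Finite modules over the affine line -/

section AffineLine

open TensorProduct in
theorem finrank_quotient_smul_top_eq {k M : Type*} [Field k] [AddCommGroup M] [Module k M]
    [Module k[X] M] [IsScalarTower k k[X] M] (a : k) :
    finrank k (M ⧸ (Ideal.span {X - C a} • ⊤ : Submodule k[X] M)) =
      finrank (k[X] ⧸ Ideal.span {X - C a}) ((k[X] ⧸ Ideal.span {X - C a}) ⊗[k[X]] M) := by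
  have hmax : (Ideal.span {X - C a}).IsMaximal :=
    PrincipalIdealRing.isMaximal_of_irreducible (irreducible_X_sub_C a)
  let _ := Ideal.Quotient.field (Ideal.span {X - C a})
  have e := (quotTensorEquivQuotSMul M (Ideal.span {X - C a})).restrictScalars k
  have h1 : finrank k (k[X] ⧸ Ideal.span {X - C a}) = 1 := by
    rw [(quotientSpanXSubCAlgEquiv a).toLinearEquiv.finrank_eq, finrank_self]
  rw [← e.finrank_eq, ← one_mul (finrank (k[X] ⧸ Ideal.span {X - C a}) _), ← h1]
  exact (Module.finrank_mul_finrank k (k[X] ⧸ Ideal.span {X - C a}) _).symm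

/-- A finite torsion module with trivial fibres is trivial. -/
theorem subsingleton_of_forall_smul_top_eq_top {k T : Type*} [Field k] [IsAlgClosed k]
    [AddCommGroup T] [Module k[X] T] {q : k[X]} (hq : q ≠ 0) (hT : ∀ x : T, q • x = 0)
    (h : ∀ a : k, ∀ x : T, ∃ y : T, (X - C a) • y = x) : Subsingleton T := by
  have hprod : ∀ s : Multiset k, ∀ x : T, ∃ y : T, (s.map (X - C ·)).prod • y = x := fun s => by
    induction s using Multiset.induction_on with
    | empty => exact fun x => ⟨x, by simp⟩
    | cons a s ih =>
      intro x
      obtain ⟨y, rfl⟩ := h a x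
      obtain ⟨z, rfl⟩ := ih y
      exact ⟨z, by rw [Multiset.map_cons, Multiset.prod_cons, mul_smul]⟩
  refine subsingleton_of_forall_eq 0 fun x => ?_
  obtain ⟨y, rfl⟩ := hprod q.roots x
  have h1 := hT y
  rw [(IsAlgClosed.splits q).eq_prod_roots, mul_smul] at h1
  have hu : IsUnit (C q.leadingCoeff) := isUnit_C.mpr
    (isUnit_iff_ne_zero.mpr (leadingCoeff_ne_zero.mpr hq))
  exact hu.smul_eq_zero.mp h1

open TensorProduct in
/-- Over the affine line, a finite module whose fibres away from the origin have the same dimension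
is flat if and only if the fibre at the origin has this dimension as well. -/
theorem flat_iff_finrank_fibre {k M : Type u} [Field k] [IsAlgClosed k] [AddCommGroup M]
    [Module k M] [Module k[X] M] [IsScalarTower k k[X] M] [Module.Finite k[X] M] {N : ℕ}
    (h : ∀ a : k, a ≠ 0 →
      finrank k (M ⧸ (Ideal.span {X - C a} • ⊤ : Submodule k[X] M)) = N) :
    Module.Flat k[X] M ↔
      finrank k (M ⧸ (Ideal.span {X - C (0 : k)} • ⊤ : Submodule k[X] M)) = N := by
  set T := Submodule.torsion k[X] M with hTdef
  obtain ⟨f, hf⟩ := Module.projective_lifting_property T.mkQ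
    (LinearMap.id : M ⧸ T →ₗ[k[X]] M ⧸ T) T.mkQ_surjective
  have hex : LinearMap.range T.subtype = LinearMap.ker T.mkQ := by
    rw [Submodule.range_subtype, Submodule.ker_mkQ]
  let e : (T × (M ⧸ T)) ≃ₗ[k[X]] M := lequivProdOfRightSplitExact T.injective_subtype hex hf
  set r := finrank k[X] (M ⧸ T)
  -- the fibre dimension is the rank plus the fibre dimension of the torsion
  have hfib : ∀ a : k, finrank k (M ⧸ (Ideal.span {X - C a} • ⊤ : Submodule k[X] M)) = r +
      finrank (k[X] ⧸ Ideal.span {X - C a}) ((k[X] ⧸ Ideal.span {X - C a}) ⊗[k[X]] T) := by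
    intro a
    have hmax : (Ideal.span {X - C a}).IsMaximal :=
      PrincipalIdealRing.isMaximal_of_irreducible (irreducible_X_sub_C a)
    let _ := Ideal.Quotient.field (Ideal.span {X - C a})
    rw [finrank_quotient_smul_top_eq]
    let e₁ := LinearEquiv.baseChange k[X] (k[X] ⧸ Ideal.span {X - C a}) _ _ e.symm
    let e₂ := TensorProduct.prodRight k[X] (k[X] ⧸ Ideal.span {X - C a})
      (k[X] ⧸ Ideal.span {X - C a}) T (M ⧸ T)
    have i₁ : Module.Free (k[X] ⧸ Ideal.span {X - C a}) ((k[X] ⧸ Ideal.span {X - C a}) ⊗[k[X]] T) :=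
      Module.Free.of_divisionRing _ _
    have h₁ : finrank (k[X] ⧸ Ideal.span {X - C a})
        ((k[X] ⧸ Ideal.span {X - C a}) ⊗[k[X]] (M ⧸ T)) = r := Module.finrank_baseChange
    rw [(e₁.trans e₂).finrank_eq, Module.finrank_prod, h₁, add_comm]
  have hzero : ∀ a : k,
      finrank (k[X] ⧸ Ideal.span {X - C a}) ((k[X] ⧸ Ideal.span {X - C a}) ⊗[k[X]] T) = 0 ↔
        ∀ x : T, ∃ y : T, (X - C a) • y = x := by
    intro a
    have hmax : (Ideal.span {X - C a}).IsMaximal :=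
      PrincipalIdealRing.isMaximal_of_irreducible (irreducible_X_sub_C a)
    let _ := Ideal.Quotient.field (Ideal.span {X - C a})
    rw [Module.finrank_zero_iff,
      (quotTensorEquivQuotSMul T (Ideal.span {X - C a})).toEquiv.subsingleton_congr,
      Submodule.Quotient.subsingleton_iff, Submodule.ideal_span_singleton_smul,
      Submodule.eq_top_iff']
    refine forall_congr' fun x => ?_
    rw [Submodule.mem_smul_pointwise_iff_exists]
    simp
  obtain ⟨q, hqT, hq⟩ : ∃ q : k[X], (∀ x : T, q • x = 0) ∧ q ≠ 0 := by
    obtain ⟨q, hq⟩ := Submodule.annihilator_top_inter_nonZeroDivisors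
      (Submodule.torsion_isTorsion (R := k[X]) (M := M))
    exact ⟨q, fun x => Submodule.mem_annihilator.mp hq.1 x trivial, nonZeroDivisors.ne_zero hq.2⟩
  -- a general fibre of the torsion is trivial
  have hr : r = N := by
    obtain ⟨a, ha⟩ := Polynomial.exists_eval_ne_zero_of_natDegree_lt_card (X * q)
      (mul_ne_zero X_ne_zero hq) (by
        exact Cardinal.natCast_lt_aleph0.trans_le (Cardinal.aleph0_le_mk k))
    rw [eval_mul, eval_X] at ha
    rw [← h a (left_ne_zero_of_mul ha), hfib a, (hzero a).mpr, add_zero]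
    intro x
    obtain ⟨w, hw⟩ : X - C a ∣ q - C (q.eval a) := X_sub_C_dvd_sub_C_eval
    refine ⟨(C (-(q.eval a)⁻¹) * w) • x, ?_⟩
    have h1 : (X - C a) * (C (-(q.eval a)⁻¹) * w) = C (-(q.eval a)⁻¹) * q + 1 := by
      rw [mul_left_comm, ← hw, mul_sub, ← C_mul, neg_mul, inv_mul_cancel₀ (right_ne_zero_of_mul ha),
        C_neg (a := (1 : k)), C_1, sub_neg_eq_add]
    rw [smul_smul, h1, add_smul, mul_smul, hqT, smul_zero, zero_add, one_smul]
  rw [IsDedekindDomain.flat_iff_torsion_eq_bot, ← hTdef, hfib, hr, Nat.add_eq_left, hzero]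
  constructor
  · intro hT x
    exact ⟨0, Subsingleton.elim (h := (Submodule.subsingleton_iff_eq_bot).mpr hT) _ _⟩
  · intro h0
    rw [← Submodule.subsingleton_iff_eq_bot]
    refine subsingleton_of_forall_smul_top_eq_top hq hqT fun a => ?_
    rcases eq_or_ne a 0 with rfl | ha
    · exact h0
    · have := h a ha
      rw [hfib, hr, Nat.add_eq_left, hzero] at this
      exact this

end AffineLine

/-! ### Tangent spaces at Gorenstein schemes -/

section Gorenstein

variable {k R : Type*} [Field k] [CommRing R] [Algebra k R]

theorem finrank_cotangent (I : Ideal R) [Module.Finite k (R ⧸ I ^ 2)] :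
    finrank k I.Cotangent + finrank k (R ⧸ I) = finrank k (R ⧸ I ^ 2) := by
  let f : I.Cotangent →ₗ[k] R ⧸ I ^ 2 := I.cotangentToQuotientSquare.restrictScalars k
  have hf : Function.Injective f := I.cotangentToQuotientSquare_injective
  let g : (R ⧸ I ^ 2) →ₗ[k] R ⧸ I :=
    (Ideal.Quotient.factorₐ k (Ideal.pow_le_self two_ne_zero)).toLinearMap
  have hg : Function.Surjective g :=
    Ideal.Quotient.factor_surjective (Ideal.pow_le_self two_ne_zero)
  have hfg : LinearMap.range f = LinearMap.ker g := by
    ext x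
    obtain ⟨x, rfl⟩ := Ideal.Quotient.mk_surjective x
    have h1 : Ideal.Quotient.mk (I ^ 2) x ∈ LinearMap.range f ↔
        Ideal.Quotient.mk (I ^ 2) x ∈ LinearMap.range I.cotangentToQuotientSquare := Iff.rfl
    have h2 : Ideal.Quotient.mk (I ^ 2) x ∈ LinearMap.ker g ↔ x ∈ I :=
      Ideal.Quotient.eq_zero_iff_mem
    rw [h1, h2, I.range_cotangentToQuotientSquare, Submodule.restrictScalars_mem,
      Ideal.mk_mem_cotangentIdeal]
  rw [(LinearEquiv.ofInjective f hf).finrank_eq, hfg, ← LinearMap.finrank_range_add_finrank_ker g,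
    LinearMap.range_eq_top.mpr hg, finrank_top, add_comm]

/-- A nondegenerate functional generates the dual of a finite algebra. -/
theorem exists_dual_eq_mul {A : Type*} [CommRing A] [Algebra k A] [Module.Finite k A]
    (φ : A →ₗ[k] k) (hφ : ∀ x : A, (∀ y, φ (y * x) = 0) → x = 0) (γ : Dual k A) :
    ∃ x, ∀ y, φ (y * x) = γ y := by
  let μ : A →ₗ[k] Dual k A := (LinearMap.mul k A).flip.compr₂ φ
  have hμ : ∀ x y, μ x y = φ (y * x) := fun x y => rfl
  have hμinj : Function.Injective μ := by
    rw [injective_iff_map_eq_zero]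
    exact fun x hx => hφ x fun y => by rw [← hμ, hx, LinearMap.zero_apply]
  obtain ⟨x, rfl⟩ := (LinearMap.injective_iff_surjective_of_finrank_eq_finrank
    Subspace.dual_finrank_eq.symm).mp hμinj γ
  exact ⟨x, fun y => rfl⟩

/-- The functional `y ↦ g (y c)` on `R ⧸ I` given by a functional `g` on the conormal module and
an element `c` of this module. -/
def conormalFunctional (I : Ideal R) (g : Dual k I.Cotangent) (c : I.Cotangent) :
    Dual k (R ⧸ I) where
  toFun y := g (y • c)
  map_add' y z := by rw [add_smul, map_add]
  map_smul' a y := by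
    have h : (a • y) • c = a • y • c := by
      rw [← algebraMap_smul R a y, ← algebraMap_smul R a (y • c), smul_assoc]
    rw [h, map_smul, RingHom.id_apply]

/-- Every functional on the conormal module is the composition of a homomorphism to `R ⧸ I` with
the given nondegenerate functional `φ`. -/
theorem exists_hom_of_dual_cotangent (I : Ideal R) [Module.Finite k (R ⧸ I)]
    (φ : (R ⧸ I) →ₗ[k] k) (hφ : ∀ x : R ⧸ I, (∀ y, φ (y * x) = 0) → x = 0)
    (g : Dual k I.Cotangent) :
    ∃ ψ : I →ₗ[R] R ⧸ I, ∀ x, φ (ψ x) = g (I.toCotangent x) := by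
  choose e he using fun c => exists_dual_eq_mul φ hφ (conormalFunctional I g c)
  have hγ : ∀ c y, conormalFunctional I g c y = g (y • c) := fun c y => rfl
  have hcancel : ∀ a b : R ⧸ I, (∀ y, φ (y * a) = φ (y * b)) → a = b := fun a b h =>
    sub_eq_zero.mp (hφ _ fun y => by rw [mul_sub, map_sub, h, sub_self])
  have hadd : ∀ c c', e (c + c') = e c + e c' := fun c c' => hcancel _ _ fun y => by
    rw [mul_add, map_add, he, he, he, hγ, hγ, hγ, smul_add, map_add]
  have hsmul : ∀ (r : R) c, e (r • c) = r • e c := fun r c => hcancel _ _ fun y => by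
    have h1 : y * r • e c = (r • y) * e c := by rw [mul_smul_comm, smul_mul_assoc]
    have h2 : y • r • c = (r • y) • c := by rw [smul_assoc, smul_comm]
    rw [h1, he, he, hγ, hγ, h2]
  refine ⟨⟨⟨fun x => e (I.toCotangent x), fun x y => ?_⟩, fun r x => ?_⟩, fun x => ?_⟩
  · rw [map_add, hadd]
  · simp only [map_smul, hsmul, RingHom.id_apply]
  · have h1 := he (I.toCotangent x) 1
    rw [one_mul, hγ, one_smul] at h1
    exact h1

/-- If `R ⧸ I` carries a nondegenerate functional, i.e. is a Gorenstein algebra, then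
`Hom(I, R ⧸ I)` is dual to the conormal module `I ⧸ I ^ 2`. -/
theorem finrank_hom_add_finrank_quotient (I : Ideal R) [Module.Finite k (R ⧸ I ^ 2)]
    (φ : (R ⧸ I) →ₗ[k] k) (hφ : ∀ x : R ⧸ I, (∀ y, φ (y * x) = 0) → x = 0) :
    finrank k (I →ₗ[R] R ⧸ I) + finrank k (R ⧸ I) = finrank k (R ⧸ I ^ 2) := by
  have fI : Module.Finite k (R ⧸ I) := finite_quotient_of_le (Ideal.pow_le_self two_ne_zero)
  have hlift : ∀ (ψ : I →ₗ[R] R ⧸ I) (x y : I), ψ (x * y) = 0 := fun ψ x y => by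
    have : x * y = (x : R) • y := rfl
    rw [this, map_smul, Algebra.smul_def, Ideal.Quotient.algebraMap_eq,
      Ideal.Quotient.eq_zero_iff_mem.mpr x.2, zero_mul]
  let Θ : (I →ₗ[R] R ⧸ I) →ₗ[k] Dual k I.Cotangent :=
    { toFun := fun ψ => φ ∘ₗ (Ideal.Cotangent.lift ψ (hlift ψ)).restrictScalars k
      map_add' := fun ψ χ => by
        ext c
        obtain ⟨x, rfl⟩ := I.toCotangent_surjective c
        exact map_add φ (ψ x) (χ x)
      map_smul' := fun a ψ => by
        ext c
        obtain ⟨x, rfl⟩ := I.toCotangent_surjective c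
        exact map_smul φ a (ψ x) }
  have hΘ : ∀ ψ x, Θ ψ (I.toCotangent x) = φ (ψ x) := fun ψ x => rfl
  have hinj : Function.Injective Θ := by
    rw [injective_iff_map_eq_zero]
    intro ψ hψ
    ext x
    refine hφ _ fun y => ?_
    obtain ⟨y, rfl⟩ := Ideal.Quotient.mk_surjective y
    have : Ideal.Quotient.mk I y * ψ x = ψ (y • x) := (map_smul ψ y x).symm
    rw [this, ← hΘ, hψ, LinearMap.zero_apply]
  have hsurj : Function.Surjective Θ := by
    intro g
    obtain ⟨ψ, hψ⟩ := exists_hom_of_dual_cotangent I φ hφ g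
    refine ⟨ψ, ?_⟩
    ext c
    obtain ⟨x, rfl⟩ := I.toCotangent_surjective c
    rw [hΘ, hψ]
  rw [← finrank_cotangent (k := k) I, (LinearEquiv.ofBijective Θ ⟨hinj, hsurj⟩).finrank_eq,
    Subspace.dual_finrank_eq]

end Gorenstein

/-! ### Ideals of polynomials and of power series -/

section PowerSeries

variable {k : Type u} [Field k] {σ : Type} [Finite σ]

open MvPolynomial (idealOfVars)

/-- The inclusion of the polynomial ring in the power series ring. -/
abbrev toSeries (k : Type u) [Field k] (σ : Type) : MvPolynomial σ k →+* MvPowerSeries σ k :=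
  MvPolynomial.coeToMvPowerSeries.ringHom

/-- A power series without terms of degree less than `N` is a combination of the monomials of
degree `N`: each of its terms is divided by one of the monomials of degree `N` that divide it. -/
theorem mem_map_pow_idealOfVars {N : ℕ} {s : MvPowerSeries σ k}
    (hs : ∀ a, a.degree < N → MvPowerSeries.coeff a s = 0) :
    s ∈ (idealOfVars σ k ^ N).map (toSeries k σ) := by
  classical
  have hex : ∀ a : σ →₀ ℕ, N ≤ a.degree → ∃ b ≤ a, b.degree = N := fun a ha => by
    obtain ⟨b, hb, hbN⟩ := Finsupp.exists_le_degree_eq a N ha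
    exact ⟨b, hb, hbN⟩
  choose! b hb hbN using hex
  have hfin : {c : σ →₀ ℕ | c.degree = N}.Finite :=
    (Finsupp.finite_of_degree_le N).subset fun c hc => le_of_eq hc
  let w : (σ →₀ ℕ) → MvPowerSeries σ k := fun c e =>
    if N ≤ (c + e).degree ∧ b (c + e) = c then MvPowerSeries.coeff (c + e) s else 0
  have hw : ∀ c e, MvPowerSeries.coeff e (w c) =
      if N ≤ (c + e).degree ∧ b (c + e) = c then MvPowerSeries.coeff (c + e) s else 0 :=
    fun c e => rfl
  have hsum : s = ∑ c ∈ hfin.toFinset, MvPowerSeries.monomial c 1 * w c := by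
    ext a
    simp only [map_sum, MvPowerSeries.coeff_monomial_mul, hw, one_mul]
    rcases lt_or_ge a.degree N with h | h
    · rw [hs a h, Finset.sum_eq_zero]
      intro c hc
      split_ifs with h1 h2
      · rw [add_tsub_cancel_of_le h1, hs a h]
      · rfl
      · rfl
    · rw [Finset.sum_eq_single (b a)]
      · rw [if_pos (hb a h), add_tsub_cancel_of_le (hb a h), if_pos ⟨h, rfl⟩]
      · intro c hc hca
        split_ifs with h1 h2
        · rw [add_tsub_cancel_of_le h1] at h2
          exact absurd h2.2.symm hca
        · rfl
        · rfl
      · intro h'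
        exact absurd (by simpa using hbN a h) h'
  rw [hsum]
  refine sum_mem fun c hc => Ideal.mul_mem_right _ _ ?_
  have h1 : (MvPowerSeries.monomial c (1 : k)) = toSeries k σ (MvPolynomial.monomial c 1) :=
    (MvPolynomial.coe_monomial c 1).symm
  rw [h1]
  refine Ideal.mem_map_of_mem _ ?_
  rw [MvPolynomial.monomial_mem_pow_idealOfVars_iff _ _ one_ne_zero]
  exact le_of_eq (by simpa using hc : c.degree = N).symm

/-- Every power series is a polynomial up to terms of high degree. -/
theorem exists_sub_mem_map_pow (N : ℕ) (s : MvPowerSeries σ k) :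
    ∃ p, s - toSeries k σ p ∈ (idealOfVars σ k ^ N).map (toSeries k σ) := by
  refine ⟨MvPowerSeries.truncTotal N s, mem_map_pow_idealOfVars fun a ha => ?_⟩
  rw [map_sub, sub_eq_zero]
  exact ((MvPolynomial.coeff_coe _ _).trans (MvPowerSeries.coeff_truncTotal _ ha)).symm

theorem exists_add_of_map_le {N : ℕ} {I : Ideal (MvPowerSeries σ k)}
    (hI : (idealOfVars σ k ^ N).map (toSeries k σ) ≤ I) (s : MvPowerSeries σ k) :
    ∃ p, s - toSeries k σ p ∈ I := by
  obtain ⟨p, hp⟩ := exists_sub_mem_map_pow N s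
  exact ⟨p, hI hp⟩

/-- An ideal of power series that contains a power of the maximal ideal is generated by the
polynomials in it. -/
theorem map_comap_toSeries {N : ℕ} {I : Ideal (MvPowerSeries σ k)}
    (hI : (idealOfVars σ k ^ N).map (toSeries k σ) ≤ I) :
    (I.comap (toSeries k σ)).map (toSeries k σ) = I := by
  refine le_antisymm Ideal.map_comap_le fun s hs => ?_
  obtain ⟨p, hp⟩ := exists_sub_mem_map_pow N s
  have hpI : p ∈ I.comap (toSeries k σ) := by
    have := sub_mem hs (hI hp)
    rwa [sub_sub_cancel] at this
  rw [← sub_add_cancel s (toSeries k σ p)]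
  exact add_mem (Ideal.map_mono (Ideal.map_le_iff_le_comap.mp hI) hp)
    (Ideal.mem_map_of_mem _ hpI)

theorem comap_map_toSeries {N : ℕ} {I : Ideal (MvPolynomial σ k)} (hI : idealOfVars σ k ^ N ≤ I) :
    (I.map (toSeries k σ)).comap (toSeries k σ) = I := by
  refine le_antisymm (fun p hp => ?_) Ideal.le_comap_map
  let τ := (MvPowerSeries.truncTotalAlgHom σ k N).toRingHom
  have hτ : ∀ q, τ (toSeries k σ q) = Ideal.Quotient.mk _ q :=
    (MvPowerSeries.truncTotalAlgHom σ k N).commutes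
  have h1 : I.map (toSeries k σ) ≤ (I.map (Ideal.Quotient.mk (idealOfVars σ k ^ N))).comap τ := by
    rw [Ideal.map_le_iff_le_comap]
    intro q hq
    rw [Ideal.mem_comap, Ideal.mem_comap, hτ]
    exact Ideal.mem_map_of_mem _ hq
  have h2 := h1 hp
  rw [Ideal.mem_comap, hτ, Ideal.mem_quotient_iff_mem hI] at h2
  exact h2

theorem le_iff_comap_toSeries_le {N : ℕ} {I J : Ideal (MvPowerSeries σ k)}
    (hI : (idealOfVars σ k ^ N).map (toSeries k σ) ≤ I) :
    I ≤ J ↔ I.comap (toSeries k σ) ≤ J.comap (toSeries k σ) := by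
  refine ⟨fun h => Ideal.comap_mono h, fun h => ?_⟩
  rw [← map_comap_toSeries hI]
  exact Ideal.map_le_iff_le_comap.mpr h

/-- Ideals that contain a power of the maximal ideal correspond to each other in the two rings, and
so do their products. -/
theorem comap_mul_toSeries {N : ℕ} {I J : Ideal (MvPowerSeries σ k)}
    (hI : (idealOfVars σ k ^ N).map (toSeries k σ) ≤ I)
    (hJ : (idealOfVars σ k ^ N).map (toSeries k σ) ≤ J) :
    (I * J).comap (toSeries k σ) = I.comap (toSeries k σ) * J.comap (toSeries k σ) := by
  conv_lhs => rw [← map_comap_toSeries hI, ← map_comap_toSeries hJ, ← Ideal.map_mul]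
  refine comap_map_toSeries (N := N + N) ?_
  rw [pow_add]
  exact Ideal.mul_mono (Ideal.map_le_iff_le_comap.mp hI) (Ideal.map_le_iff_le_comap.mp hJ)

theorem finite_quotient_pow_idealOfVars (N : ℕ) :
    Module.Finite k (MvPolynomial σ k ⧸ idealOfVars σ k ^ N) := by
  classical
  have hfin : {c : σ →₀ ℕ | c.degree < N}.Finite := Finsupp.finite_of_degree_lt N
  let g : (hfin.toFinset → k) →ₗ[k] MvPolynomial σ k ⧸ idealOfVars σ k ^ N :=
    Fintype.linearCombination k fun c => Ideal.Quotient.mk _ (MvPolynomial.monomial c.1 1)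
  refine Module.Finite.of_surjective g fun y => ?_
  obtain ⟨p, rfl⟩ := Ideal.Quotient.mk_surjective y
  refine ⟨fun c => p.coeff c.1, ?_⟩
  have h1 : g (fun c => p.coeff c.1) = Ideal.Quotient.mk _
      (∑ c : hfin.toFinset, MvPolynomial.monomial c.1 (p.coeff c.1)) := by
    rw [map_sum]
    refine Finset.sum_congr rfl fun c _ => ?_
    rw [← mul_one (p.coeff c.1), ← smul_eq_mul, ← MvPolynomial.smul_monomial]
    rfl
  rw [h1, Ideal.Quotient.eq, MvPolynomial.mem_pow_idealOfVars_iff']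
  intro a ha
  rw [MvPolynomial.coeff_sub, MvPolynomial.coeff_sum, sub_eq_zero,
    Finset.sum_eq_single ⟨a, by simpa using ha⟩]
  · simp
  · rintro ⟨c, hc⟩ - hca
    rw [MvPolynomial.coeff_monomial, if_neg]
    rintro rfl
    exact hca rfl
  · intro h
    exact absurd (Finset.mem_univ _) h

end PowerSeries

/-! ### Apolar algebras as quotients of the polynomial ring -/

section ApolarPolynomial

variable {k : Type u} [Field k] {σ : Type} [DecidableEq σ]

open MvPolynomial (idealOfVars)

theorem mem_ann {f : MvPolynomial σ k} {s : MvPowerSeries σ k} : s ∈ ann f ↔ contract s f = 0 :=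
  Iff.rfl

theorem coeff_contract (s : MvPowerSeries σ k) (f : MvPolynomial σ k) (c : σ →₀ ℕ) :
    (contract s f).coeff c = ∑ a ∈ f.support,
      if c ≤ a then f.coeff a * MvPowerSeries.coeff (a - c) s else 0 := by
  conv_lhs => rw [← f.support_sum_monomial_coeff]
  rw [map_sum, MvPolynomial.coeff_sum]
  refine Finset.sum_congr rfl fun a _ => ?_
  have h1 : MvPolynomial.monomial a (f.coeff a) =
      f.coeff a • (MvPolynomial.monomial a 1 : MvPolynomial σ k) := by
    rw [MvPolynomial.smul_monomial, smul_eq_mul, mul_one]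
  rw [h1, map_smul, MvPolynomial.coeff_smul, contract_monomial, MvPolynomial.coeff_sum]
  simp only [MvPolynomial.coeff_monomial, smul_eq_mul]
  split_ifs with hca
  · rw [Finset.sum_eq_single (a - c, c)]
    · simp
    · rintro ⟨p, q⟩ hp hne
      rw [if_neg]
      rintro rfl
      rw [Finset.HasAntidiagonal.mem_antidiagonal] at hp
      exact hne (by rw [← hp]; simp)
    · intro h
      exact absurd (Finset.HasAntidiagonal.mem_antidiagonal.mpr (tsub_add_cancel_of_le hca)) h
  · rw [Finset.sum_eq_zero, mul_zero]
    rintro ⟨p, q⟩ hp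
    rw [if_neg]
    rintro rfl
    rw [Finset.HasAntidiagonal.mem_antidiagonal] at hp
    exact hca (by rw [← hp]; exact le_add_self)

theorem contract_eq_zero_of_degree {f : MvPolynomial σ k} {s : MvPowerSeries σ k}
    (hs : ∀ a, a.degree ≤ f.totalDegree → MvPowerSeries.coeff a s = 0) : contract s f = 0 := by
  ext c
  rw [coeff_contract, MvPolynomial.coeff_zero]
  refine Finset.sum_eq_zero fun a ha => ?_
  split_ifs with h
  · rw [hs, mul_zero]
    refine (Finsupp.degree_mono tsub_le_self).trans ?_
    exact MvPolynomial.le_totalDegree ha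
  · rfl

theorem map_pow_le_ann (f : MvPolynomial σ k) :
    (idealOfVars σ k ^ (f.totalDegree + 1)).map (toSeries k σ) ≤ ann f := by
  rw [Ideal.map_le_iff_le_comap]
  intro p hp
  rw [MvPolynomial.mem_pow_idealOfVars_iff'] at hp
  refine contract_eq_zero_of_degree fun a ha => ?_
  exact (MvPolynomial.coeff_coe _ _).trans (hp a (by omega))

theorem map_pow_le_ann_pow (f : MvPolynomial σ k) (m : ℕ) :
    (idealOfVars σ k ^ ((f.totalDegree + 1) * m)).map (toSeries k σ) ≤ ann f ^ m := by
  rw [pow_mul, Ideal.map_pow]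
  exact Ideal.pow_right_mono (map_pow_le_ann f) m

/-- The ideal of the spectrum of the apolar algebra in affine space. -/
abbrev annPoly (f : MvPolynomial σ k) : Ideal (MvPolynomial σ k) := (ann f).comap (toSeries k σ)

theorem mem_annPoly {f p : MvPolynomial σ k} :
    p ∈ annPoly f ↔ contract (p : MvPowerSeries σ k) f = 0 :=
  Iff.rfl

theorem ker_apolarPresentation (f : MvPolynomial σ k) :
    RingHom.ker (apolarPresentation f) = annPoly f := by
  ext p
  exact Ideal.Quotient.eq_zero_iff_mem

theorem annPoly_ne_top {f : MvPolynomial σ k} (hf : f ≠ 0) : annPoly f ≠ ⊤ := by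
  rw [Ne, Ideal.eq_top_iff_one, mem_annPoly, MvPolynomial.coe_one]
  intro h
  refine hf ?_
  ext c
  have h1 := congrArg (MvPolynomial.coeff c) h
  rw [coeff_contract] at h1
  by_cases hc : c ∈ f.support
  · rw [Finset.sum_eq_single_of_mem c hc] at h1
    · simpa using h1
    · intro a _ hac
      split_ifs with h2
      · rw [MvPowerSeries.coeff_one, if_neg, mul_zero]
        exact fun h3 => hac (le_antisymm (tsub_eq_zero_iff_le.mp h3) h2)
      · rfl
  · simpa using hc

theorem pow_le_annPoly (f : MvPolynomial σ k) :
    idealOfVars σ k ^ (f.totalDegree + 1) ≤ annPoly f :=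
  Ideal.map_le_iff_le_comap.mp (map_pow_le_ann f)

/-- The functional that takes `p` to the constant term of `p ⌟ f`; it is nondegenerate, which is
how the apolar algebra of `f` is Gorenstein. -/
def apolarFunctional (f : MvPolynomial σ k) : (MvPolynomial σ k ⧸ annPoly f) →ₗ[k] k :=
  ((annPoly f).restrictScalars k).liftQ
    { toFun := fun p => (contract (p : MvPowerSeries σ k) f).coeff 0
      map_add' := fun p q => by
        rw [MvPolynomial.coe_add, contract_add, LinearMap.add_apply, MvPolynomial.coeff_add]
      map_smul' := fun c p => by
        simp only [coeff_contract, zero_le, if_true, tsub_zero, MvPolynomial.coeff_coe,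
          MvPolynomial.coeff_smul, smul_eq_mul, RingHom.id_apply, Finset.mul_sum]
        exact Finset.sum_congr rfl fun a _ => by ring }
    (fun p hp => by
      have h : contract (p : MvPowerSeries σ k) f = 0 := hp
      simp [h]) ∘ₗ
  (Submodule.Quotient.restrictScalarsEquiv k (annPoly f)).symm.toLinearMap

theorem apolarFunctional_mk (f p : MvPolynomial σ k) :
    apolarFunctional f (Ideal.Quotient.mk _ p) =
      (contract (p : MvPowerSeries σ k) f).coeff 0 :=
  rfl

theorem apolarFunctional_nondegenerate (f : MvPolynomial σ k) (x : MvPolynomial σ k ⧸ annPoly f)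
    (hx : ∀ y, apolarFunctional f (y * x) = 0) : x = 0 := by
  obtain ⟨p, rfl⟩ := Ideal.Quotient.mk_surjective x
  rw [Ideal.Quotient.eq_zero_iff_mem, mem_annPoly]
  ext b
  have h1 := hx (Ideal.Quotient.mk _ (MvPolynomial.monomial b 1))
  rw [← map_mul, apolarFunctional_mk, MvPolynomial.coe_mul, contract_mul, LinearMap.comp_apply,
    coeff_contract] at h1
  simp only [zero_le, if_true, tsub_zero, MvPolynomial.coeff_coe, MvPolynomial.coeff_monomial,
    mul_ite, mul_one, mul_zero] at h1
  by_cases hb : b ∈ (contract (p : MvPowerSeries σ k) f).support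
  · rw [Finset.sum_ite_eq, if_pos hb] at h1
    exact h1
  · simpa using hb

variable [Finite σ]

theorem apolarPresentation_surjective (f : MvPolynomial σ k) :
    Function.Surjective (apolarPresentation f) := by
  intro y
  obtain ⟨s, rfl⟩ := Ideal.Quotient.mk_surjective y
  obtain ⟨p, hp⟩ := exists_sub_mem_map_pow (f.totalDegree + 1) s
  exact ⟨p, (Ideal.Quotient.eq.mpr (map_pow_le_ann f hp)).symm⟩

/-- The apolar algebra as a quotient of the polynomial ring. -/
def quotientAnnPolyEquiv (f : MvPolynomial σ k) :
    (MvPolynomial σ k ⧸ annPoly f) ≃ₐ[k] Apolar f :=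
  (Ideal.quotientEquivAlgOfEq k (ker_apolarPresentation f).symm).trans
    (Ideal.quotientKerAlgEquivOfSurjective (apolarPresentation_surjective f))

theorem finite_quotient_annPoly_sq (f : MvPolynomial σ k) :
    Module.Finite k (MvPolynomial σ k ⧸ annPoly f ^ 2) := by
  have := finite_quotient_pow_idealOfVars (k := k) (σ := σ) ((f.totalDegree + 1) * 2)
  refine finite_quotient_of_le (I := idealOfVars σ k ^ ((f.totalDegree + 1) * 2)) ?_
  rw [pow_mul]
  exact Ideal.pow_right_mono (pow_le_annPoly f) 2

end ApolarPolynomial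

/-- For apolar algebras, unobstructedness is a condition on the colength of the square of the
ideal. -/
theorem isUnobstructed_apolar_iff {k : Type u} [Field k] {σ : Type} [DecidableEq σ] [Fintype σ]
    (f : MvPolynomial σ k) : IsUnobstructed (apolarPresentation f) ↔
      IsSmoothable k (MvPolynomial σ k ⧸ annPoly f) ∧
        finrank k (MvPolynomial σ k ⧸ annPoly f ^ 2) =
          (Fintype.card σ + 1) * finrank k (MvPolynomial σ k ⧸ annPoly f) := by
  have f2 := finite_quotient_annPoly_sq f
  have h : ∀ I, I = annPoly f → finrank k (HilbTangentSpace I) +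
      finrank k (MvPolynomial σ k ⧸ annPoly f) = finrank k (MvPolynomial σ k ⧸ annPoly f ^ 2) := by
    rintro _ rfl
    exact finrank_hom_add_finrank_quotient (annPoly f) (apolarFunctional f)
      (apolarFunctional_nondegenerate f)
  have e := quotientAnnPolyEquiv f
  rw [IsUnobstructed, ← e.toLinearEquiv.finrank_eq]
  refine and_congr ⟨fun hs => hs.of_algEquiv e.symm, fun hs => hs.of_algEquiv e⟩ ?_
  rw [← h _ (ker_apolarPresentation f), add_mul, one_mul, Nat.add_right_cancel_iff]

/-! ### Apolar ideals of ray sums -/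

section RaySumIdeal

variable {k : Type u} [Field k] {n : ℕ}

theorem coeff_mapDomain_inclT (s : MvPowerSeries (Fin n) k) (a : Fin n →₀ ℕ) :
    MvPowerSeries.coeff (a.mapDomain some) (inclT s) = MvPowerSeries.coeff a s := by
  have h := MvPowerSeries.coeff_embDomain_rename (Function.Embedding.some (α := Fin n)) s a
  rwa [Finsupp.embDomain_eq_mapDomain] at h

theorem X_pow_mul_rename_monomial (m : ℕ) (a : Fin n →₀ ℕ) (c : k) :
    MvPolynomial.X none ^ m * MvPolynomial.rename some (MvPolynomial.monomial a c) =
      MvPolynomial.monomial (Finsupp.single none m + a.mapDomain some) c := by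
  rw [MvPolynomial.X_pow_eq_monomial, MvPolynomial.rename_monomial, MvPolynomial.monomial_mul,
    one_mul]

/-- Power series in the old variables act on the coefficients of the powers of the new variable. -/
theorem contract_inclT (s : MvPowerSeries (Fin n) k) (m : ℕ) (h : MvPolynomial (Fin n) k) :
    contract (inclT s) (MvPolynomial.X none ^ m * MvPolynomial.rename some h) =
      MvPolynomial.X none ^ m * MvPolynomial.rename some (contract s h) := by
  let F : MvPolynomial (Fin n) k →ₗ[k] MvPolynomial (Option (Fin n)) k :=
    (LinearMap.mulLeft k (MvPolynomial.X none ^ m)).comp (MvPolynomial.rename some).toLinearMap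
  have hF : ∀ h, F h = MvPolynomial.X none ^ m * MvPolynomial.rename some h := fun h => rfl
  suffices hlin : (contract (inclT s)).comp F = F.comp (contract s) from congr($hlin h)
  refine (MvPolynomial.basisMonomials (Fin n) k).ext fun a => ?_
  rw [MvPolynomial.coe_basisMonomials]
  change contract (inclT s) (F (MvPolynomial.monomial a 1)) =
    F (contract s (MvPolynomial.monomial a 1))
  rw [hF, X_pow_mul_rename_monomial, contract_monomial, contract_monomial, map_sum]
  refine (Finset.sum_of_injOn
    (fun q => (q.1.mapDomain some, Finsupp.single none m + q.2.mapDomain some)) ?_ ?_ ?_ ?_).symm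
  · rintro ⟨q₁, q₂⟩ - ⟨q₁', q₂'⟩ - hq
    rw [Prod.mk.injEq, add_right_inj] at hq
    have hinj := Finsupp.mapDomain_injective (M := ℕ) (Option.some_injective (Fin n))
    exact Prod.ext (hinj hq.1) (hinj hq.2)
  · rintro ⟨q₁, q₂⟩ hq
    simp only [Finset.mem_coe, Finset.HasAntidiagonal.mem_antidiagonal] at hq ⊢
    rw [← hq, Finsupp.mapDomain_add]
    abel
  · rintro ⟨p₁, p₂⟩ hp hne
    have h0 : MvPowerSeries.coeff p₁ (inclT s) = 0 := by
      refine MvPowerSeries.coeff_rename_eq_zero _ s ?_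
      rintro ⟨q₁, rfl⟩
      rw [Finset.HasAntidiagonal.mem_antidiagonal] at hp
      have hsome : ∀ (b : Fin n →₀ ℕ) i, b.mapDomain some (some i) = b i := fun b i =>
        Finsupp.mapDomain_apply (Option.some_injective _) b i
      have hnone : ∀ b : Fin n →₀ ℕ, b.mapDomain some none = 0 := fun b =>
        Finsupp.mapDomain_of_notMem_range b none (by simp)
      have hle : ∀ i, q₁ i + p₂ (some i) = a i := fun i => by
        have := DFunLike.congr_fun hp (some i)
        simpa [hsome] using this
      refine hne ⟨(q₁, a - q₁), ?_, ?_⟩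
      · rw [Finset.mem_coe, Finset.HasAntidiagonal.mem_antidiagonal]
        refine add_tsub_cancel_of_le fun i => ?_
        change q₁ i ≤ a i
        have := hle i
        omega
      · refine Prod.ext rfl ?_
        ext (_ | i)
        · have := DFunLike.congr_fun hp none
          simpa [hnone] using this.symm
        · have := hle i
          simp only [Finsupp.add_apply, hsome, Finsupp.tsub_apply]
          rw [Finsupp.single_eq_of_ne (by simp)]
          omega
    rw [h0, MvPolynomial.monomial_zero]
  · rintro ⟨q₁, q₂⟩ -
    rw [coeff_mapDomain_inclT]
    exact X_pow_mul_rename_monomial m q₂ _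

theorem contract_X_none (m : ℕ) (h : MvPolynomial (Fin n) k) :
    contract (MvPowerSeries.X none) (MvPolynomial.X none ^ (m + 1) * MvPolynomial.rename some h) =
      MvPolynomial.X none ^ m * MvPolynomial.rename some h := by
  let F : ℕ → MvPolynomial (Fin n) k →ₗ[k] MvPolynomial (Option (Fin n)) k := fun m =>
    (LinearMap.mulLeft k (MvPolynomial.X none ^ m)).comp (MvPolynomial.rename some).toLinearMap
  have hF : ∀ m h, F m h = MvPolynomial.X none ^ m * MvPolynomial.rename some h := fun m h => rfl
  suffices hlin : (contract (MvPowerSeries.X none)).comp (F (m + 1)) = F m from congr($hlin h)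
  refine (MvPolynomial.basisMonomials (Fin n) k).ext fun a => ?_
  rw [MvPolynomial.coe_basisMonomials, LinearMap.comp_apply, hF, hF,
    X_pow_mul_rename_monomial, X_pow_mul_rename_monomial, contract_monomial,
    Finset.sum_eq_single (Finsupp.single none 1, Finsupp.single none m + a.mapDomain some)]
  · simp [MvPowerSeries.coeff_X]
  · rintro ⟨p₁, p₂⟩ hp hne
    rw [MvPowerSeries.coeff_X, if_neg, MvPolynomial.monomial_zero]
    rintro rfl
    rw [Finset.HasAntidiagonal.mem_antidiagonal, add_comm m, Finsupp.single_add, add_assoc,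
      add_right_inj] at hp
    exact hne (Prod.ext rfl hp)
  · intro h
    exact absurd (Finset.HasAntidiagonal.mem_antidiagonal.mpr (by
      rw [add_comm m, Finsupp.single_add, add_assoc])) h

theorem contract_X_none_rename (h : MvPolynomial (Fin n) k) :
    contract (MvPowerSeries.X none) (MvPolynomial.rename some h) = 0 := by
  suffices hlin : (contract (MvPowerSeries.X none)).comp
      (MvPolynomial.rename some : MvPolynomial (Fin n) k →ₐ[k] _).toLinearMap = 0 from
    congr($hlin h)
  refine (MvPolynomial.basisMonomials (Fin n) k).ext fun a => ?_
  rw [MvPolynomial.coe_basisMonomials, LinearMap.comp_apply, LinearMap.zero_apply]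
  have h1 := X_pow_mul_rename_monomial 0 a (1 : k)
  rw [pow_zero, one_mul] at h1
  rw [AlgHom.toLinearMap_apply, h1, contract_monomial]
  refine Finset.sum_eq_zero ?_
  rintro ⟨p₁, p₂⟩ hp
  rw [MvPowerSeries.coeff_X, if_neg, MvPolynomial.monomial_zero]
  rintro rfl
  rw [Finset.HasAntidiagonal.mem_antidiagonal] at hp
  have h2 := DFunLike.congr_fun hp none
  rw [Finsupp.add_apply, Finsupp.add_apply,
    Finsupp.mapDomain_of_notMem_range a none (by simp)] at h2
  simp at h2

theorem contract_one {σ : Type} [DecidableEq σ] (h : MvPolynomial σ k) :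
    contract (1 : MvPowerSeries σ k) h = h := by
  suffices hlin : contract (1 : MvPowerSeries σ k) = LinearMap.id from congr($hlin h)
  refine (MvPolynomial.basisMonomials _ k).ext fun a => ?_
  rw [MvPolynomial.coe_basisMonomials, contract_monomial, Finset.sum_eq_single (0, a)]
  · simp
  · rintro ⟨p₁, p₂⟩ hp hne
    rw [MvPowerSeries.coeff_one, if_neg, MvPolynomial.monomial_zero]
    rintro rfl
    rw [Finset.HasAntidiagonal.mem_antidiagonal, zero_add] at hp
    exact hne (Prod.ext rfl hp)
  · simp

theorem contract_X_none_pow (i m : ℕ) (h : MvPolynomial (Fin n) k) :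
    contract (MvPowerSeries.X none ^ i) (MvPolynomial.X none ^ m * MvPolynomial.rename some h) =
      if i ≤ m then MvPolynomial.X none ^ (m - i) * MvPolynomial.rename some h else 0 := by
  induction i generalizing m with
  | zero =>
    rw [pow_zero, contract_one, if_pos (Nat.zero_le m), tsub_zero]
  | succ i ih =>
    rw [pow_succ, contract_mul, LinearMap.comp_apply]
    rcases m with _ | m
    · rw [pow_zero, one_mul, contract_X_none_rename, map_zero, if_neg (by omega)]
    · rw [contract_X_none, ih]
      simp

/-- The polynomial ring in the old variables and the new one, as a polynomial ring in the new
variable. -/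
abbrev rayEquiv (k : Type u) [Field k] (n : ℕ) :
    MvPolynomial (Option (Fin n)) k ≃ₐ[k] (MvPolynomial (Fin n) k)[X] :=
  MvPolynomial.optionEquivLeft k (Fin n)

theorem rayEquiv_symm_C (h : MvPolynomial (Fin n) k) :
    (rayEquiv k n).symm (C h) = MvPolynomial.rename some h := by
  induction h using MvPolynomial.induction_on with
  | C a => rw [MvPolynomial.optionEquivLeft_symm_C_C, MvPolynomial.rename_C]
  | add p q hp hq => rw [C_add, map_add, map_add, hp, hq]
  | mul_X p i hp =>
    rw [C_mul, map_mul, map_mul, hp, MvPolynomial.optionEquivLeft_symm_C_X, MvPolynomial.rename_X]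

theorem rayEquiv_symm_X : (rayEquiv k n).symm X = MvPolynomial.X none :=
  MvPolynomial.optionEquivLeft_symm_X ..

theorem rayEquiv_rename (h : MvPolynomial (Fin n) k) :
    rayEquiv k n (MvPolynomial.rename some h) = C h := by
  rw [← rayEquiv_symm_C, AlgEquiv.apply_symm_apply]

theorem rayEquiv_X_none : rayEquiv k n (MvPolynomial.X none) = X :=
  MvPolynomial.optionEquivLeft_X_none ..

/-- The action of a polynomial in the old and the new variables on `x ^ m h`, sorted by powers of
`x`. -/
theorem contract_rayEquiv_symm (q : (MvPolynomial (Fin n) k)[X]) (m : ℕ)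
    (h : MvPolynomial (Fin n) k) :
    contract ((rayEquiv k n).symm q : MvPowerSeries (Option (Fin n)) k)
        (MvPolynomial.X none ^ m * MvPolynomial.rename some h) =
      ∑ j ∈ Finset.range (m + 1), MvPolynomial.X none ^ j *
        MvPolynomial.rename some (contract (q.coeff (m - j) : MvPowerSeries (Fin n) k) h) := by
  induction q using Polynomial.induction_on' with
  | add p q hp hq =>
    rw [map_add, MvPolynomial.coe_add, contract_add, LinearMap.add_apply, hp, hq,
      ← Finset.sum_add_distrib]
    refine Finset.sum_congr rfl fun j _ => ?_
    rw [coeff_add, MvPolynomial.coe_add, contract_add, LinearMap.add_apply, map_add, mul_add]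
  | monomial i s =>
    have h0 : ∀ h : MvPolynomial (Fin n) k, contract (0 : MvPowerSeries (Fin n) k) h = 0 :=
      fun h => (ann h).zero_mem
    have h1 : (MvPolynomial.rename some s : MvPowerSeries (Option (Fin n)) k) =
        inclT (s : MvPowerSeries (Fin n) k) := (MvPowerSeries.rename_coe some s).symm
    have h2 : (rayEquiv k n).symm (C s * X ^ i) =
        MvPolynomial.rename some s * MvPolynomial.X none ^ i := by
      rw [map_mul, map_pow, rayEquiv_symm_C, rayEquiv_symm_X]
    rw [← C_mul_X_pow_eq_monomial, h2, MvPolynomial.coe_mul, MvPolynomial.coe_pow,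
      MvPolynomial.coe_X, contract_mul, LinearMap.comp_apply, contract_X_none_pow, h1]
    simp only [coeff_C_mul_X_pow]
    split_ifs with him
    · rw [contract_inclT, Finset.sum_eq_single_of_mem (m - i)
        (Finset.mem_range.mpr (by omega))]
      · rw [if_pos (by omega)]
      · intro j hj hji
        rw [Finset.mem_range] at hj
        rw [if_neg (by omega), MvPolynomial.coe_zero, h0, map_zero, mul_zero]
    · rw [map_zero, Finset.sum_eq_zero]
      intro j hj
      rw [if_neg (by omega), MvPolynomial.coe_zero, h0, map_zero, mul_zero]

end RaySumIdeal

section RaySumIdeal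

variable {k : Type u} [Field k] {n : ℕ}

theorem contract_comm {σ : Type} [DecidableEq σ] (s u : MvPowerSeries σ k) (f : MvPolynomial σ k) :
    contract s (contract u f) = contract u (contract s f) := by
  rw [← LinearMap.comp_apply, ← LinearMap.comp_apply, ← contract_mul, ← contract_mul, mul_comm]

theorem contract_mul_apply {σ : Type} [DecidableEq σ] (s u : MvPowerSeries σ k)
    (f : MvPolynomial σ k) : contract (s * u) f = contract s (contract u f) := by
  rw [contract_mul, LinearMap.comp_apply]

theorem ann_le_ann_contract {σ : Type} [DecidableEq σ] (f : MvPolynomial σ k)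
    (D : MvPowerSeries σ k) : ann f ≤ ann (contract D f) := fun s hs => by
  rw [mem_ann] at hs ⊢
  rw [contract_comm, hs, map_zero]

theorem contract_eq_of_sub_mem_ann {σ : Type} [DecidableEq σ] {f : MvPolynomial σ k}
    {D E : MvPowerSeries σ k} (h : D - E ∈ ann f) : contract D f = contract E f := by
  rw [mem_ann] at h
  rw [← sub_add_cancel D E, contract_add, LinearMap.add_apply, h, zero_add]

section Setting

variable {f : MvPolynomial (Fin n) k} {D : MvPowerSeries (Fin n) k}
  {p : MvPolynomial (Fin n) k}

theorem mem_annPoly_contract (hD : contract (D ^ 2) f = 0) (hp : D - toSeries k _ p ∈ ann f) :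
    p ∈ annPoly (contract D f) := by
  rw [mem_annPoly, contract_comm]
  have h := contract_eq_of_sub_mem_ann hp
  rw [MvPolynomial.coeToMvPowerSeries.ringHom_apply] at h
  rw [← h, ← contract_mul_apply, ← sq, hD]

theorem mul_mem_annPoly (hp : D - toSeries k _ p ∈ ann f) {s : MvPolynomial (Fin n) k}
    (hs : s ∈ annPoly (contract D f)) : p * s ∈ annPoly f := by
  have h := contract_eq_of_sub_mem_ann hp
  rw [MvPolynomial.coeToMvPowerSeries.ringHom_apply] at h
  rw [mem_annPoly] at hs ⊢
  rw [MvPolynomial.coe_mul, contract_mul_apply, contract_comm, ← h, hs]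

theorem constantCoeff_eq_zero (hf : f ≠ 0) (hD : contract (D ^ 2) f = 0) :
    MvPowerSeries.constantCoeff D = 0 := by
  by_contra h
  have hu : IsUnit (D ^ 2) :=
    (MvPowerSeries.isUnit_iff_constantCoeff.mpr (isUnit_iff_ne_zero.mpr h)).pow 2
  obtain ⟨v, hv⟩ := hu.exists_left_inv
  refine annPoly_ne_top hf ?_
  rw [Ideal.eq_top_iff_one, mem_annPoly, MvPolynomial.coe_one, ← hv, contract_mul_apply, hD,
    map_zero]

/-- The ray sum is `f + x ^ d (∂ ⌟ f)` if `∂ ^ 2 ⌟ f = 0`. -/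
theorem raySum_eq (hf : f ≠ 0) (hD : contract (D ^ 2) f = 0) (d : ℕ) :
    raySum d f D = MvPolynomial.X none ^ 0 * MvPolynomial.rename some f +
      MvPolynomial.X none ^ d * MvPolynomial.rename some (contract D f) := by
  have h2 : ∀ i, contract (D ^ (i + 2)) f = 0 := fun i => by
    rw [pow_add, contract_mul_apply, hD, map_zero]
  rcases hdeg : f.totalDegree with _ | e
  · have h3 : contract D f = 0 := by
      refine contract_eq_zero_of_degree fun a ha => ?_
      rw [hdeg, Nat.le_zero, Finsupp.degree_eq_zero_iff] at ha
      rw [ha]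
      exact constantCoeff_eq_zero hf hD
    rw [raySum, hdeg, zero_add, Finset.sum_range_one, pow_zero, contract_one, h3, map_zero,
      mul_zero, mul_zero, add_zero]
  · rw [raySum, hdeg, Finset.sum_range_succ', Finset.sum_range_succ', Finset.sum_eq_zero]
    · rw [zero_add, zero_add, pow_one, mul_one, mul_zero, pow_zero, pow_zero, contract_one,
        add_comm]
    · intro i _
      rw [add_assoc, h2, map_zero, mul_zero]

theorem sum_X_pow_mul_rename_eq_zero {m : ℕ} {h : ℕ → MvPolynomial (Fin n) k} :
    ∑ j ∈ Finset.range m, MvPolynomial.X none ^ j * MvPolynomial.rename some (h j) = 0 ↔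
      ∀ j < m, h j = 0 := by
  constructor
  · intro h0 j hj
    have h1 := congrArg (fun q => (rayEquiv k n q).coeff j) h0
    simp only [map_sum, map_mul, map_pow, rayEquiv_X_none, rayEquiv_rename, map_zero, coeff_zero,
      finsetSum_coeff, coeff_X_pow_mul', coeff_C] at h1
    rw [Finset.sum_eq_single_of_mem j (Finset.mem_range.mpr hj)] at h1
    · simpa using h1
    · intro i _ hij
      split_ifs with h2 h3
      · omega
      · rfl
      · rfl
  · intro h0
    refine Finset.sum_eq_zero fun j hj => ?_
    rw [h0 j (Finset.mem_range.mp hj), map_zero, mul_zero]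

/-- The annihilator of the ray sum in terms of coefficients with respect to the new variable:
applied to `f + x ^ d (∂ ⌟ f)`, the polynomial `q` gives `x ^ (d - i) (q_i ⌟ ∂ ⌟ f)` for each
`i < d`, while its terms of degree `0` and `d` combine to `(q_0 + p q_d) ⌟ f`. -/
theorem rayEquiv_symm_mem_annPoly_raySum (hf : f ≠ 0) (hD : contract (D ^ 2) f = 0) {d : ℕ}
    (hp : D - toSeries k _ p ∈ ann f) (q : (MvPolynomial (Fin n) k)[X]) :
    (rayEquiv k n).symm q ∈ annPoly (raySum d f D) ↔
      (∀ i < d, q.coeff i ∈ annPoly (contract D f)) ∧ q.coeff 0 + p * q.coeff d ∈ annPoly f := by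
  have hDp := contract_eq_of_sub_mem_ann hp
  rw [MvPolynomial.coeToMvPowerSeries.ringHom_apply] at hDp
  rw [mem_annPoly, raySum_eq hf hD, map_add, contract_rayEquiv_symm, contract_rayEquiv_symm,
    zero_add, Finset.sum_range_one, Finset.sum_range_succ', add_left_comm, pow_zero, one_mul,
    one_mul, ← map_add, tsub_zero, tsub_zero, hDp, ← contract_mul_apply, ← LinearMap.add_apply,
    ← contract_add]
  let h : ℕ → MvPolynomial (Fin n) k
    | 0 => contract ((q.coeff 0 : MvPowerSeries (Fin n) k) +
        (q.coeff d : MvPowerSeries (Fin n) k) * (p : MvPowerSeries (Fin n) k)) f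
    | j + 1 => contract (q.coeff (d - (j + 1)) : MvPowerSeries (Fin n) k)
        (contract (p : MvPowerSeries (Fin n) k) f)
  have hsum := sum_X_pow_mul_rename_eq_zero (m := d + 1) (h := h)
  rw [Finset.sum_range_succ', pow_zero, one_mul] at hsum
  refine hsum.trans ⟨fun h0 => ⟨fun i hi => ?_, ?_⟩, fun h0 j hj => ?_⟩
  · have h1 := h0 (d - (i + 1) + 1) (by omega)
    have h2 : d - (d - (i + 1) + 1) = i := by omega
    change contract (q.coeff (d - (d - (i + 1) + 1)) : MvPowerSeries (Fin n) k) _ = 0 at h1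
    rwa [h2] at h1
  · rw [mem_annPoly, MvPolynomial.coe_add, MvPolynomial.coe_mul,
      mul_comm (p : MvPowerSeries (Fin n) k)]
    exact h0 0 (by omega)
  · rcases j with _ | j
    · have h1 := h0.2
      rwa [mem_annPoly, MvPolynomial.coe_add, MvPolynomial.coe_mul,
        mul_comm (p : MvPowerSeries (Fin n) k)] at h1
    · exact h0.1 (d - (j + 1)) (by omega)

/-- The annihilator of the ray sum is the ideal of the special fibre of the lower ray family. -/
theorem comap_annPoly_raySum (hf : f ≠ 0) (hD : contract (D ^ 2) f = 0) {d : ℕ} (hd : 2 ≤ d)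
    (hp : D - toSeries k _ p ∈ ann f) :
    (annPoly (raySum d f D)).comap (rayEquiv k n).symm =
      rayIdeal (annPoly f) (annPoly (contract D f)) d 0 p := by
  have hIJ : annPoly f ≤ annPoly (contract D f) := Ideal.comap_mono (ann_le_ann_contract f D)
  have hpJ := mem_annPoly_contract hD hp
  have hmem : ∀ q, q ∈ (annPoly (raySum d f D)).comap (rayEquiv k n).symm ↔ _ :=
    rayEquiv_symm_mem_annPoly_raySum hf hD hp
  have hδ : rayPoly d 0 p ∈ rayIdeal (annPoly f) (annPoly (contract D f)) d 0 p :=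
    Ideal.mem_sup_right (Ideal.mem_span_singleton_self _)
  refine le_antisymm (fun q hq => ?_) (sup_le (fun q hq => ?_) ?_)
  · rw [hmem] at hq
    -- the terms of degree `0` and `d` belong to the ideal together
    have h1 : C (q.coeff 0) + C (q.coeff d) * X ^ d ∈
        rayIdeal (annPoly f) (annPoly (contract D f)) d 0 p := by
      have h2 : C (q.coeff 0) + C (q.coeff d) * X ^ d =
          C (q.coeff 0 + p * q.coeff d) + C (q.coeff d) * rayPoly d 0 p := by
        rw [rayPoly, C_add, C_mul, C_0]
        ring
      rw [h2]
      exact add_mem (Ideal.mem_sup_left (C_mem_stepIdeal hIJ hq.2)) (Ideal.mul_mem_left _ _ hδ)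
    have h3 : q - (C (q.coeff 0) + C (q.coeff d) * X ^ d) ∈
        rayIdeal (annPoly f) (annPoly (contract D f)) d 0 p := by
      refine mem_of_forall_coeff fun i => ?_
      rw [coeff_sub, coeff_add, coeff_C, coeff_C_mul_X_pow]
      rcases Nat.eq_zero_or_pos i with rfl | hi
      · rw [if_pos rfl, if_neg (by omega)]
        simp
      rw [if_neg hi.ne', zero_add]
      split_ifs with hid
      · simp [hid]
      rw [sub_zero]
      rcases lt_or_gt_of_ne hid with hlt | hgt
      · exact Ideal.mem_sup_left (C_mul_X_pow_mem_stepIdeal (hq.1 i hlt) hi.ne')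
      · have h4 : C (q.coeff i) * X ^ i =
            (C (q.coeff i) * X ^ (i - d)) * rayPoly d 0 p +
              C (p * q.coeff i) * X ^ (i - d) := by
          obtain ⟨j, rfl⟩ := Nat.exists_eq_add_of_lt hgt
          rw [add_assoc, add_tsub_cancel_left, rayPoly, C_0, C_mul]
          ring
        rw [h4]
        exact add_mem (Ideal.mul_mem_left _ _ hδ) (Ideal.mem_sup_left
          (C_mul_X_pow_mem_stepIdeal (Ideal.mul_mem_right _ _ hpJ) (by omega)))
    have h4 := add_mem h3 h1
    rwa [sub_add_cancel] at h4
  · rw [mem_stepIdeal] at hq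
    rw [hmem]
    exact ⟨fun i _ => hq.1 i, add_mem hq.2 (mul_mem_annPoly hp (hq.1 d))⟩
  · rw [Ideal.span_singleton_le_iff_mem, hmem]
    have hc : ∀ i, (rayPoly d 0 p).coeff i = (if i = d then 1 else 0) - if i = 0 then p else 0 :=
      fun i => by simp [rayPoly, coeff_X_pow, coeff_C]
    constructor
    · intro i hi
      rw [hc, if_neg hi.ne, zero_sub]
      split_ifs
      · exact neg_mem hpJ
      · rw [neg_zero]
        exact zero_mem _
    · rw [hc, hc, if_neg (by omega), if_pos rfl, if_pos rfl, if_neg (by omega)]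
      simp

/-- The polynomials in the ideal of the ray decomposition. -/
theorem comap_raySumJ (f : MvPolynomial (Fin n) k) (D : MvPowerSeries (Fin n) k) :
    ((raySumJ f D).comap (toSeries k _)).comap (rayEquiv k n).symm =
      stepIdeal (annPoly f) (annPoly (contract D f)) := by
  have hpow : ∀ g : MvPolynomial (Fin n) k, MvPolynomial.rename some g =
      MvPolynomial.X none ^ 0 * MvPolynomial.rename some g := fun g => by rw [pow_zero, one_mul]
  have hI : raySumJ f D ≤ ann (MvPolynomial.X none ^ 0 * MvPolynomial.rename some f) := by
    refine sup_le ?_ (Ideal.mul_le_left.trans ?_)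
    · rw [Ideal.map_le_iff_le_comap]
      intro s hs
      rw [Ideal.mem_comap, mem_ann, contract_inclT, mem_ann.mp hs, map_zero, mul_zero]
    · rw [Ideal.span_singleton_le_iff_mem, mem_ann, ← hpow, contract_X_none_rename]
  have hJ : ∀ m, (ann (contract D f)).map inclT ≤
      ann (MvPolynomial.X none ^ m * MvPolynomial.rename some (contract D f)) := fun m => by
    rw [Ideal.map_le_iff_le_comap]
    intro s hs
    rw [Ideal.mem_comap, mem_ann, contract_inclT, mem_ann.mp hs, map_zero, mul_zero]
  have hJ' : ∀ m, raySumJ f D ≤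
      ann (MvPolynomial.X none ^ m * MvPolynomial.rename some (contract D f)) := fun m =>
    sup_le ((Ideal.map_mono (ann_le_ann_contract f D)).trans (hJ m))
      (Ideal.mul_le_right.trans (hJ m))
  refine le_antisymm (fun q hq => ?_) (stepIdeal_le (fun s hs => ?_) fun s hs => ?_)
  · rw [mem_stepIdeal]
    have h0 := mem_ann.mp (hI hq)
    have h1 := fun m => mem_ann.mp (hJ' m hq)
    rw [MvPolynomial.coeToMvPowerSeries.ringHom_apply, contract_rayEquiv_symm,
      sum_X_pow_mul_rename_eq_zero] at h0
    refine ⟨fun i => ?_, h0 0 (by omega)⟩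
    have h2 := h1 i
    rw [MvPolynomial.coeToMvPowerSeries.ringHom_apply, contract_rayEquiv_symm,
      sum_X_pow_mul_rename_eq_zero] at h2
    exact h2 0 (by omega)
  · rw [Ideal.mem_comap, Ideal.mem_comap, rayEquiv_symm_C]
    have h1 : toSeries k _ (MvPolynomial.rename some s) = inclT (toSeries k _ s) :=
      (MvPowerSeries.rename_coe some s).symm
    rw [h1]
    exact Ideal.mem_sup_left (Ideal.mem_map_of_mem _ hs)
  · rw [Ideal.mem_comap, Ideal.mem_comap, map_mul, rayEquiv_symm_C, rayEquiv_symm_X]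
    have h1 : toSeries k _ (MvPolynomial.rename some s * MvPolynomial.X none) =
        MvPowerSeries.X none * inclT (toSeries k _ s) := by
      rw [map_mul, mul_comm]
      exact congrArg₂ _ (MvPolynomial.coe_X _) (MvPowerSeries.rename_coe some s).symm
    rw [h1]
    exact Ideal.mem_sup_right (Ideal.mul_mem_mul (Ideal.mem_span_singleton_self _)
      (Ideal.mem_map_of_mem _ hs))

end Setting

end RaySumIdeal

/-! ### The lower ray family -/

section LowerRayFamily

variable {k : Type u} [Field k] {n : ℕ}

/-- The restriction to the fibre over the point `a` of the affine line. -/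
def fibreMap (n : ℕ) (a : k) :
    MvPolynomial (Option (Fin n)) k[X] →ₐ[k] (MvPolynomial (Fin n) k)[X] :=
  (rayEquiv k n).toAlgHom.comp (MvPolynomial.mapAlgHom (aeval a))

theorem fibreMap_apply (a : k) (w : MvPolynomial (Option (Fin n)) k[X]) :
    fibreMap n a w = rayEquiv k n (MvPolynomial.map (aeval a : k[X] →ₐ[k] k).toRingHom w) :=
  rfl

theorem fibreMap_map_C (a : k) (w : MvPolynomial (Option (Fin n)) k) :
    fibreMap n a (MvPolynomial.map C w) = rayEquiv k n w := by
  have h : (aeval a : k[X] →ₐ[k] k).toRingHom.comp C = RingHom.id k := by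
    ext c
    simp
  rw [fibreMap_apply, MvPolynomial.map_map, h, MvPolynomial.map_id]

theorem fibreMap_surjective (a : k) : Function.Surjective (fibreMap n a) := fun q =>
  ⟨MvPolynomial.map C ((rayEquiv k n).symm q), by
    rw [fibreMap_map_C, AlgEquiv.apply_symm_apply]⟩

theorem ker_fibreMap (a : k) : RingHom.ker (fibreMap n a) =
    (RingHom.ker (aeval a : k[X] →ₐ[k] k)).map
      (algebraMap k[X] (MvPolynomial (Option (Fin n)) k[X])) := by
  have h := MvPolynomial.ker_map (σ := Option (Fin n)) (aeval a : k[X] →ₐ[k] k).toRingHom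
  refine Eq.trans ?_ h
  ext w
  rw [RingHom.mem_ker, RingHom.mem_ker, fibreMap_apply, EmbeddingLike.map_eq_zero_iff]

theorem ker_aeval_eq_span (a : k) :
    RingHom.ker (aeval a : k[X] →ₐ[k] k) = Ideal.span {X - C a} := by
  ext q
  rw [RingHom.mem_ker, Ideal.mem_span_singleton, dvd_iff_isRoot, IsRoot.def, coe_aeval_eq_eval]

/-- The fibre of a closed subscheme of a family over the affine line, if `E` is the restriction of
the family to the fibre over `a`. -/
theorem nonempty_fibre_equiv {T Q : Type*} [CommRing T] [CommRing Q] [Algebra k T] [Algebra k[X] T]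
    [IsScalarTower k k[X] T] [Algebra k Q] {E : T →ₐ[k] Q} (hE : Function.Surjective E) {a : k}
    (hker : RingHom.ker E = (RingHom.ker (aeval a : k[X] →ₐ[k] k)).map (algebraMap k[X] T))
    (K : Ideal T) :
    Nonempty (((T ⧸ K) ⧸ (RingHom.ker (aeval a : k[X] →ₐ[k] k)).map (algebraMap k[X] (T ⧸ K)))
      ≃ₐ[k] Q ⧸ K.map E) := by
  let ψ : (T ⧸ K) →ₐ[k] Q ⧸ K.map E := Ideal.quotientMapₐ (K.map E) E Ideal.le_comap_map
  have hψ : ∀ w, ψ (Ideal.Quotient.mk K w) = Ideal.Quotient.mk _ (E w) := fun w => rfl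
  have hsurj : Function.Surjective ψ := fun y => by
    obtain ⟨y, rfl⟩ := Ideal.Quotient.mk_surjective y
    obtain ⟨w, rfl⟩ := hE y
    exact ⟨Ideal.Quotient.mk K w, rfl⟩
  have hker' : (RingHom.ker (aeval a : k[X] →ₐ[k] k)).map (algebraMap k[X] (T ⧸ K)) =
      RingHom.ker ψ := by
    have h1 : algebraMap k[X] (T ⧸ K) = (Ideal.Quotient.mk K).comp (algebraMap k[X] T) := rfl
    rw [h1, ← Ideal.map_map, ← hker]
    ext y
    obtain ⟨w, rfl⟩ := Ideal.Quotient.mk_surjective y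
    have h2 : Ideal.comap E (K.map E) = K ⊔ RingHom.ker E :=
      Ideal.comap_map_of_surjective' E.toRingHom hE K
    have h3 := Ideal.comap_map_of_surjective' (Ideal.Quotient.mk K) Ideal.Quotient.mk_surjective
      (RingHom.ker E)
    rw [Ideal.mk_ker] at h3
    rw [RingHom.mem_ker, hψ, Ideal.Quotient.eq_zero_iff_mem, ← Ideal.mem_comap,
      ← Ideal.mem_comap, h2, h3, sup_comm]
  exact ⟨(Ideal.quotientEquivAlgOfEq k hker').trans
    (Ideal.quotientKerAlgEquivOfSurjective hsurj)⟩

theorem finrank_fibre {T Q : Type*} [CommRing T] [CommRing Q] [Algebra k T] [Algebra k[X] T]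
    [IsScalarTower k k[X] T] [Algebra k Q] {E : T →ₐ[k] Q} (hE : Function.Surjective E) {a : k}
    (hker : RingHom.ker E = (RingHom.ker (aeval a : k[X] →ₐ[k] k)).map (algebraMap k[X] T))
    (K : Ideal T) :
    finrank k ((T ⧸ K) ⧸ (Ideal.span {X - C a} • ⊤ : Submodule k[X] (T ⧸ K))) =
      finrank k (Q ⧸ K.map E) := by
  obtain ⟨e⟩ := nonempty_fibre_equiv hE hker K
  rw [← e.toLinearEquiv.finrank_eq, ker_aeval_eq_span, Ideal.smul_top_eq_map]
  exact ((Submodule.Quotient.restrictScalarsEquiv k[X] _).restrictScalars k).finrank_eq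

variable {f : MvPolynomial (Fin n) k} {D : MvPowerSeries (Fin n) k}
  {p : MvPolynomial (Fin n) k} {d : ℕ}

/-- The fibres of the lower ray family. -/
theorem map_fibreMap_raySumLowerIdeal (hp : D - toSeries k _ p ∈ ann f) (a : k) :
    (raySumLowerIdeal d f D).map (fibreMap n a) =
      rayIdeal (annPoly f) (annPoly (contract D f)) d (algebraMap k _ a) p := by
  have hstep := comap_raySumJ f D
  set L := (raySumJ f D).comap (toSeries k (Option (Fin n))) with hL
  have hL' : L.map (rayEquiv k n) = stepIdeal (annPoly f) (annPoly (contract D f)) := by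
    rw [← hstep]
    exact Ideal.map_comap_of_equiv (rayEquiv k n).toRingEquiv
  have hmem : ∀ q : MvPolynomial (Option (Fin n)) k,
      (q : MvPowerSeries (Option (Fin n)) k) - inclT D ∈ raySumJ f D →
        rayEquiv k n q - C p ∈ stepIdeal (annPoly f) (annPoly (contract D f)) := fun q hq => by
    rw [← hL', ← rayEquiv_rename, ← map_sub]
    refine Ideal.mem_map_of_mem _ ?_
    rw [hL, Ideal.mem_comap, map_sub]
    have h1 : toSeries k _ (MvPolynomial.rename some p) = inclT (toSeries k _ p) :=
      (MvPowerSeries.rename_coe some p).symm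
    have h2 : inclT (D - toSeries k _ p) ∈ raySumJ f D :=
      Ideal.mem_sup_left (Ideal.mem_map_of_mem _ hp)
    rw [h1]
    have h3 := add_mem hq h2
    rwa [map_sub, sub_add_sub_cancel] at h3
  have hfib : ∀ q, fibreMap n a (MvPolynomial.X none ^ d -
      MvPolynomial.C X * MvPolynomial.X none - MvPolynomial.map C q) =
        rayPoly d (algebraMap k _ a) p - (rayEquiv k n q - C p) := fun q => by
    have h1 : fibreMap n a (MvPolynomial.X none) = X := by
      rw [fibreMap_apply, MvPolynomial.map_X, rayEquiv_X_none]
    have h2 : fibreMap n a (MvPolynomial.C X) = C (algebraMap k _ a) := by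
      rw [fibreMap_apply, MvPolynomial.map_C, MvPolynomial.optionEquivLeft_C,
        AlgHom.toRingHom_eq_coe, RingHom.coe_coe, aeval_X, MvPolynomial.algebraMap_eq]
    rw [map_sub, map_sub, map_mul, map_pow, h1, h2, fibreMap_map_C, rayPoly]
    ring
  have hLmap : (L.map (MvPolynomial.map C)).map (fibreMap n a) =
      stepIdeal (annPoly f) (annPoly (contract D f)) := by
    have hcomp : (fibreMap n a).toRingHom.comp (MvPolynomial.map C) =
        (rayEquiv k n).toRingEquiv.toRingHom := RingHom.ext fun w => fibreMap_map_C a w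
    rw [← hL']
    refine (Ideal.map_map (MvPolynomial.map C) (fibreMap n a).toRingHom).trans ?_
    rw [hcomp]
    rfl
  obtain ⟨q₀, hq₀⟩ : ∃ q₀ : MvPolynomial (Option (Fin n)) k,
      (q₀ : MvPowerSeries (Option (Fin n)) k) - inclT D ∈ raySumJ f D := by
    refine ⟨MvPolynomial.rename some p, ?_⟩
    have h1 : (MvPolynomial.rename some p : MvPowerSeries (Option (Fin n)) k) =
        inclT (toSeries k _ p) := (MvPowerSeries.rename_coe some p).symm
    rw [h1, ← map_sub, ← neg_sub, map_neg]
    exact neg_mem (Ideal.mem_sup_left (Ideal.mem_map_of_mem _ hp))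
  rw [raySumLowerIdeal, lowerRayIdeal, Ideal.map_sup]
  change Ideal.map (fibreMap n a) (Ideal.map (MvPolynomial.map C) L) ⊔ _ = _
  rw [hLmap, rayIdeal, Ideal.map_span]
  refine le_antisymm (sup_le le_sup_left (Ideal.span_le.mpr ?_)) (sup_le le_sup_left ?_)
  · rintro _ ⟨_, ⟨q, hq, rfl⟩, rfl⟩
    rw [hfib]
    exact sub_mem (Ideal.mem_sup_right (Ideal.mem_span_singleton_self _))
      (Ideal.mem_sup_left (hmem q hq))
  · rw [Ideal.span_singleton_le_iff_mem, ← sub_add_cancel (rayPoly d _ p)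
      (rayEquiv k n q₀ - C p), ← hfib]
    exact add_mem (Ideal.mem_sup_right (Ideal.subset_span ⟨_, ⟨q₀, hq₀, rfl⟩, rfl⟩))
      (Ideal.mem_sup_left (hmem q₀ hq₀))

end LowerRayFamily

/-! ### The lower ray family and its special fibre -/

theorem flat_iff_forall_smul_eq_zero {B M : Type*} [CommRing B] [IsDedekindDomain B]
    [AddCommGroup M] [Module B M] :
    Module.Flat B M ↔ ∀ (a : nonZeroDivisors B) (x : M), a • x = 0 → x = 0 := by
  rw [IsDedekindDomain.flat_iff_torsion_eq_bot, eq_bot_iff]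
  exact ⟨fun h a x hx => h (Submodule.mem_torsion_iff x |>.mpr ⟨a, hx⟩),
    fun h x hx => by
      obtain ⟨a, ha⟩ := Submodule.mem_torsion_iff x |>.mp hx
      exact h a x ha⟩

/-- In a flat family the conormal module is flat if and only if the first infinitesimal
neighbourhood is. -/
theorem flat_cotangent_iff {B T : Type*} [CommRing B] [IsDedekindDomain B] [CommRing T]
    [Algebra B T] (K : Ideal T) (hK : Module.Flat B (T ⧸ K)) :
    Module.Flat B K.Cotangent ↔ Module.Flat B (T ⧸ K ^ 2) := by
  rw [flat_iff_forall_smul_eq_zero] at hK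
  rw [flat_iff_forall_smul_eq_zero, flat_iff_forall_smul_eq_zero]
  let g : K.Cotangent →ₗ[B] T ⧸ K ^ 2 := K.cotangentToQuotientSquare.restrictScalars B
  have hg : Function.Injective g := K.cotangentToQuotientSquare_injective
  constructor
  · intro h a x hx
    obtain ⟨w, rfl⟩ := Ideal.Quotient.mk_surjective x
    have hw : w ∈ K := by
      refine Ideal.Quotient.eq_zero_iff_mem.mp (hK a _ ?_)
      have h1 := congrArg (Ideal.Quotient.factorₐ B (Ideal.pow_le_self two_ne_zero : K ^ 2 ≤ K)) hx
      rw [map_zero] at h1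
      exact h1
    have h2 : g (K.toCotangent ⟨w, hw⟩) = Ideal.Quotient.mk (K ^ 2) w := rfl
    rw [← h2] at hx ⊢
    have h3 : g (a • K.toCotangent ⟨w, hw⟩) = 0 := (map_smul g (a : B) _).trans hx
    rw [h a _ ((map_eq_zero_iff g hg).mp h3), map_zero]
  · intro h a x hx
    refine (map_eq_zero_iff g hg).mp (h a _ ?_)
    have h3 : g (a • x) = a • g x := map_smul g (a : B) x
    rw [← h3, hx, map_zero]

/-- The special fibre of a free family of closed subschemes of `Q` over the affine line is
smoothable if the other fibres are. Here `E a` is the restriction to the fibre over `a`. -/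
theorem isSmoothable_special_fibre {k : Type u} [Field k] [IsAlgClosed k] {T Q : Type u}
    [CommRing T] [CommRing Q] [Algebra k T] [Algebra k[X] T] [IsScalarTower k k[X] T] [Algebra k Q]
    {E : k → T →ₐ[k] Q} (hE : ∀ a, Function.Surjective (E a))
    (hker : ∀ a, RingHom.ker (E a) =
      (RingHom.ker (aeval a : k[X] →ₐ[k] k)).map (algebraMap k[X] T))
    (K : Ideal T) [Module.Finite k[X] (T ⧸ K)] [Module.Free k[X] (T ⧸ K)]
    (h : ∀ a, a ≠ 0 → IsSmoothable k (Q ⧸ K.map (E a))) :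
    IsSmoothable k (Q ⧸ K.map (E 0)) := by
  obtain ⟨e₀⟩ := nonempty_fibre_equiv (hE 0) (hker 0) K
  refine (IsSmoothable.of_family fun a ha => ?_).of_algEquiv e₀
  obtain ⟨e⟩ := nonempty_fibre_equiv (hE a) (hker a) K
  exact (h a ha).of_algEquiv e.symm

theorem finite_quotient_of_isIntegral_X {B : Type*} [CommRing B] {σ : Type*} [Finite σ]
    (K : Ideal (MvPolynomial σ B))
    (h : ∀ i, IsIntegral B (Ideal.Quotient.mk K (MvPolynomial.X i))) :
    Module.Finite B (MvPolynomial σ B ⧸ K) := by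
  have hint : Algebra.IsIntegral B (MvPolynomial σ B ⧸ K) := ⟨fun y => by
    obtain ⟨w, rfl⟩ := Ideal.Quotient.mk_surjective y
    induction w using MvPolynomial.induction_on with
    | C b => exact isIntegral_algebraMap (x := b)
    | add p q hp hq => rw [map_add]; exact hp.add hq
    | mul_X p i hp => rw [map_mul]; exact hp.mul (h i)⟩
  exact Algebra.IsIntegral.finite

section LowerRayFamily

variable {k : Type u} [Field k] {n : ℕ} {f : MvPolynomial (Fin n) k}
  {D : MvPowerSeries (Fin n) k} {p : MvPolynomial (Fin n) k} {d : ℕ}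

theorem map_C_rename_mem_raySumLowerIdeal {s : MvPolynomial (Fin n) k} (hs : s ∈ annPoly f) :
    MvPolynomial.map C (MvPolynomial.rename some s) ∈ raySumLowerIdeal d f D := by
  refine Ideal.mem_sup_left (Ideal.mem_map_of_mem _ ?_)
  have h1 : toSeries k _ (MvPolynomial.rename some s) = inclT (toSeries k _ s) :=
    (MvPowerSeries.rename_coe some s).symm
  rw [Ideal.mem_comap, h1]
  exact Ideal.mem_sup_left (Ideal.mem_map_of_mem _ hs)

theorem rayGenerator_mem_raySumLowerIdeal (hp : D - toSeries k _ p ∈ ann f) :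
    MvPolynomial.X none ^ d - MvPolynomial.C X * MvPolynomial.X none -
      MvPolynomial.map C (MvPolynomial.rename some p) ∈ raySumLowerIdeal d f D := by
  refine Ideal.mem_sup_right (Ideal.subset_span ⟨_, ?_, rfl⟩)
  have h1 : (MvPolynomial.rename some p : MvPowerSeries (Option (Fin n)) k) =
      inclT (toSeries k _ p) := (MvPowerSeries.rename_coe some p).symm
  rw [h1, ← map_sub, ← neg_sub, map_neg]
  exact neg_mem (Ideal.mem_sup_left (Ideal.mem_map_of_mem _ hp))

/-- The lower ray family and its first infinitesimal neighbourhood are finite over the affine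
line: the old variables are nilpotent on them, and so is `α ^ d - t α`. -/
theorem finite_quotient_raySumLowerIdeal_sq (hd : 2 ≤ d) (hD : contract (D ^ 2) f = 0)
    (hp : D - toSeries k _ p ∈ ann f) :
    Module.Finite k[X] (MvPolynomial (Option (Fin n)) k[X] ⧸ raySumLowerIdeal d f D ^ 2) := by
  refine finite_quotient_of_isIntegral_X _ fun i => ?_
  rcases i with _ | i
  · set δ : MvPolynomial (Option (Fin n)) k[X] :=
      MvPolynomial.X none ^ d - MvPolynomial.C X * MvPolynomial.X none with hδ
    have hp2 : p * p ∈ annPoly f := mul_mem_annPoly hp (mem_annPoly_contract hD hp)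
    have h1 : δ ^ 2 ∈ raySumLowerIdeal d f D := by
      have h2 : δ ^ 2 = (MvPolynomial.X none ^ d - MvPolynomial.C X * MvPolynomial.X none -
          MvPolynomial.map C (MvPolynomial.rename some p)) *
            (δ + MvPolynomial.map C (MvPolynomial.rename some p)) +
          MvPolynomial.map C (MvPolynomial.rename some (p * p)) := by
        rw [map_mul, map_mul, ← hδ]
        ring
      rw [h2]
      exact add_mem (Ideal.mul_mem_right _ _ (rayGenerator_mem_raySumLowerIdeal hp))
        (map_C_rename_mem_raySumLowerIdeal hp2)
    refine ⟨rayPoly d X 0 ^ (2 * 2), (monic_rayPoly hd X 0).pow _, ?_⟩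
    rw [← aeval_def, map_pow]
    have h3 : aeval (Ideal.Quotient.mk (raySumLowerIdeal d f D ^ 2) (MvPolynomial.X none))
        (rayPoly d (X : k[X]) 0) = Ideal.Quotient.mk (raySumLowerIdeal d f D ^ 2) δ := by
      rw [rayPoly, C_0, sub_zero, map_sub, map_mul, map_pow, aeval_X, aeval_C, hδ, map_sub,
        map_mul, map_pow]
      rfl
    rw [h3, pow_mul, ← map_pow, ← map_pow, Ideal.Quotient.eq_zero_iff_mem]
    exact Ideal.pow_mem_pow h1 2
  · refine IsIntegral.of_pow (n := (f.totalDegree + 1) * 2) (by positivity) ?_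
    have h1 : (MvPolynomial.X i : MvPolynomial (Fin n) k) ^ (f.totalDegree + 1) ∈ annPoly f :=
      have hX : (MvPolynomial.X i : MvPolynomial (Fin n) k) ∈ MvPolynomial.idealOfVars (Fin n) k :=
        Ideal.subset_span ⟨i, rfl⟩
      pow_le_annPoly f (Ideal.pow_mem_pow hX _)
    have h2 := map_C_rename_mem_raySumLowerIdeal (d := d) (D := D) h1
    rw [map_pow, map_pow, MvPolynomial.rename_X, MvPolynomial.map_X] at h2
    have h3 : Ideal.Quotient.mk (raySumLowerIdeal d f D ^ 2) (MvPolynomial.X (some i)) ^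
        ((f.totalDegree + 1) * 2) = 0 := by
      rw [← map_pow, Ideal.Quotient.eq_zero_iff_mem, pow_mul]
      exact Ideal.pow_mem_pow h2 2
    rw [h3]
    exact isIntegral_zero

/-- The equivalence of unobstructedness of the ray sum, flatness along the lower ray family, and
the condition on the ideals, for a fixed exponent. -/
theorem tfae_of_admissible [IsAlgClosed k] (hf0 : f ≠ 0) (hD : contract (D ^ 2) f = 0)
    (hf : IsUnobstructed (apolarPresentation f))
    (hDf : IsUnobstructed (apolarPresentation (contract D f))) (hd : 2 ≤ d)
    (hdk : ((d - 1 : ℕ) : k) ≠ 0) (hp : D - toSeries k _ p ∈ ann f) :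
    (IsUnobstructed (apolarPresentation (raySum d f D)) ↔
      annPoly f ⊓ annPoly (contract D f) ^ 2 ⊓ (annPoly f ^ 2).colon {p} =
        annPoly f * annPoly (contract D f)) ∧
    (Module.Flat k[X] (raySumLowerIdeal d f D).Cotangent ↔
      annPoly f ⊓ annPoly (contract D f) ^ 2 ⊓ (annPoly f ^ 2).colon {p} =
        annPoly f * annPoly (contract D f)) ∧
    (Module.Flat k[X] (MvPolynomial (Option (Fin n)) k[X] ⧸ raySumLowerIdeal d f D ^ 2) ↔
      annPoly f ⊓ annPoly (contract D f) ^ 2 ⊓ (annPoly f ^ 2).colon {p} =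
        annPoly f * annPoly (contract D f)) := by
  obtain ⟨hfs, hfd⟩ := (isUnobstructed_apolar_iff f).mp hf
  obtain ⟨hDs, hDd⟩ := (isUnobstructed_apolar_iff (contract D f)).mp hDf
  rw [Fintype.card_fin] at hfd hDd
  have hIJ : annPoly f ≤ annPoly (contract D f) := Ideal.comap_mono (ann_le_ann_contract f D)
  have hpJ := mem_annPoly_contract hD hp
  have hpJI : ∀ s ∈ annPoly (contract D f), p * s ∈ annPoly f := fun s hs => mul_mem_annPoly hp hs
  have f2 := finite_quotient_annPoly_sq f
  have f1 : Module.Finite k (MvPolynomial (Fin n) k ⧸ annPoly f) :=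
    finite_quotient_of_le (Ideal.pow_le_self two_ne_zero)
  set N := finrank k (MvPolynomial (Fin n) k ⧸ annPoly f) +
    (d - 1) * finrank k (MvPolynomial (Fin n) k ⧸ annPoly (contract D f)) with hN
  set 𝔍 := raySumLowerIdeal d f D
  have hfib : ∀ a : k, 𝔍.map (fibreMap n a) =
      rayIdeal (annPoly f) (annPoly (contract D f)) d (algebraMap k _ a) p :=
    map_fibreMap_raySumLowerIdeal hp
  have hfib0 : 𝔍.map (fibreMap n 0) = rayIdeal (annPoly f) (annPoly (contract D f)) d 0 p := by
    rw [hfib, map_zero]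
  have fin2 := finite_quotient_raySumLowerIdeal_sq hd hD hp
  have fin1 : Module.Finite k[X] (MvPolynomial (Option (Fin n)) k[X] ⧸ 𝔍) :=
    Module.Finite.of_surjective
      (Ideal.Quotient.factorₐ k[X] (Ideal.pow_le_self two_ne_zero : 𝔍 ^ 2 ≤ 𝔍)).toLinearMap
      (Ideal.Quotient.factor_surjective (Ideal.pow_le_self two_ne_zero))
  have hdim : ∀ a : k, finrank k ((MvPolynomial (Option (Fin n)) k[X] ⧸ 𝔍) ⧸
      (Ideal.span {X - C a} • ⊤ : Submodule k[X] (MvPolynomial (Option (Fin n)) k[X] ⧸ 𝔍))) =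
        N := fun a => by
    rw [finrank_fibre (fibreMap_surjective a) (ker_fibreMap a), hfib,
      (finrank_quotient_rayIdeal hd _ hIJ hpJI).2]
  -- all fibres of the family have the same length, so that the family is flat
  have hflat : Module.Flat k[X] (MvPolynomial (Option (Fin n)) k[X] ⧸ 𝔍) :=
    (flat_iff_finrank_fibre fun a _ => hdim a).mpr (hdim 0)
  have hsq : ∀ a : k, finrank k ((MvPolynomial (Option (Fin n)) k[X] ⧸ 𝔍 ^ 2) ⧸
      (Ideal.span {X - C a} • ⊤ : Submodule k[X] (MvPolynomial (Option (Fin n)) k[X] ⧸ 𝔍 ^ 2))) =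
        finrank k ((MvPolynomial (Fin n) k)[X] ⧸
          rayIdeal (annPoly f) (annPoly (contract D f)) d (algebraMap k _ a) p ^ 2) := fun a => by
    rw [finrank_fibre (fibreMap_surjective a) (ker_fibreMap a), Ideal.map_pow, hfib]
  have h4 := (finrank_quotient_rayIdeal_sq_iff (k := k) (m := n) hd hIJ hpJ hpJI hfd hDd).2
  have hflat2 : Module.Flat k[X] (MvPolynomial (Option (Fin n)) k[X] ⧸ 𝔍 ^ 2) ↔
      annPoly f ⊓ annPoly (contract D f) ^ 2 ⊓ (annPoly f ^ 2).colon {p} =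
        annPoly f * annPoly (contract D f) := by
    rw [flat_iff_finrank_fibre (N := (n + 2) * N) fun a ha => ?_, hsq, map_zero, h4]
    have hv : algebraMap k (MvPolynomial (Fin n) k) a * algebraMap k _ a⁻¹ = 1 := by
      rw [← map_mul, mul_inv_cancel₀ ha, map_one]
    rw [hsq, finrank_quotient_rayIdeal_sq_general hd hv hIJ hpJ hpJI hfd hDd]
  refine ⟨?_, (flat_cotangent_iff 𝔍 hflat).trans hflat2, hflat2⟩
  have hmapg : (annPoly (raySum d f D)).map (rayEquiv k n : _ →ₐ[k] _) =
      rayIdeal (annPoly f) (annPoly (contract D f)) d 0 p := by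
    rw [← comap_annPoly_raySum hf0 hD hd hp]
    exact Ideal.map_comap_of_equiv (rayEquiv k n).toRingEquiv
  have e₁ : (MvPolynomial (Option (Fin n)) k ⧸ annPoly (raySum d f D)) ≃ₐ[k]
      (MvPolynomial (Fin n) k)[X] ⧸ rayIdeal (annPoly f) (annPoly (contract D f)) d 0 p :=
    Ideal.quotientEquivAlg _ _ (rayEquiv k n) hmapg.symm
  have e₂ : (MvPolynomial (Option (Fin n)) k ⧸ annPoly (raySum d f D) ^ 2) ≃ₐ[k]
      (MvPolynomial (Fin n) k)[X] ⧸ rayIdeal (annPoly f) (annPoly (contract D f)) d 0 p ^ 2 :=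
    Ideal.quotientEquivAlg _ _ (rayEquiv k n) (by
      rw [Ideal.map_pow]
      exact congrArg (· ^ 2) hmapg.symm)
  have hsm : IsSmoothable k (MvPolynomial (Option (Fin n)) k ⧸ annPoly (raySum d f D)) := by
    have hfree : Module.Free k[X] (MvPolynomial (Option (Fin n)) k[X] ⧸ 𝔍) :=
      Module.free_of_finite_type_torsion_free'
    have h0 := isSmoothable_special_fibre fibreMap_surjective ker_fibreMap 𝔍 fun a ha => by
      rw [hfib]
      exact isSmoothable_quotient_rayIdeal hd hdk ha hIJ hpJ hpJI hfs hDs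
    rw [hfib0] at h0
    exact h0.of_algEquiv e₁.symm
  rw [isUnobstructed_apolar_iff, and_iff_right hsm, Fintype.card_option, Fintype.card_fin,
    e₁.toLinearEquiv.finrank_eq, e₂.toLinearEquiv.finrank_eq,
    (finrank_quotient_rayIdeal hd 0 hIJ hpJI).2, ← h4]

end LowerRayFamily

/-! ### The condition on the ideals -/

section Condition

variable {k : Type u} [Field k] {n : ℕ} {f : MvPolynomial (Fin n) k}
  {D : MvPowerSeries (Fin n) k} {p : MvPolynomial (Fin n) k}

theorem mul_ann_le (f : MvPolynomial (Fin n) k) (D : MvPowerSeries (Fin n) k) :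
    ann f * ann (contract D f) ≤
      ann f ⊓ ann (contract D f) ^ 2 ⊓ (ann f ^ 2).colon {D} := by
  rw [inf_assoc]
  refine le_inf Ideal.mul_le_left (mul_le_sq_inf_colon (ann_le_ann_contract f D) fun s hs => ?_)
  rw [mem_ann, contract_mul_apply, contract_comm]
  exact hs

/-- The condition on the ideals may be tested on polynomials. That `p` is congruent to `∂` modulo
`Ann(f) ^ 2`, and not only modulo `Ann(f)`, makes the colon ideals correspond to each other. -/
theorem ann_inf_eq_iff (hp : D - toSeries k _ p ∈ ann f ^ 2) :
    ann f ⊓ ann (contract D f) ^ 2 ⊓ (ann f ^ 2).colon {D} = ann f * ann (contract D f) ↔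
      annPoly f ⊓ annPoly (contract D f) ^ 2 ⊓ (annPoly f ^ 2).colon {p} =
        annPoly f * annPoly (contract D f) := by
  have hI := map_pow_le_ann f
  have hJ := hI.trans (ann_le_ann_contract f D)
  have hI2 : (ann f ^ 2).comap (toSeries k _) = annPoly f ^ 2 := by
    rw [sq, comap_mul_toSeries hI hI, sq]
  have hJ2 : (ann (contract D f) ^ 2).comap (toSeries k _) = annPoly (contract D f) ^ 2 := by
    rw [sq, comap_mul_toSeries hJ hJ, sq]
  have hcolon : ((ann f ^ 2).colon {D}).comap (toSeries k _) = (annPoly f ^ 2).colon {p} := by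
    ext x
    rw [Ideal.mem_comap, Submodule.mem_colon_singleton, Submodule.mem_colon_singleton, smul_eq_mul,
      smul_eq_mul, ← hI2, Ideal.mem_comap, map_mul]
    have h1 : toSeries k _ x * D = toSeries k _ x * toSeries k _ p +
        toSeries k _ x * (D - toSeries k _ p) := by ring
    rw [h1]
    exact Ideal.add_mem_iff_left _ (Ideal.mul_mem_left _ _ hp)
  have hIJ : (ann f * ann (contract D f)).comap (toSeries k _) =
      annPoly f * annPoly (contract D f) := comap_mul_toSeries hI hJ
  have hle := mul_ann_le f D
  have hpow : (MvPolynomial.idealOfVars (Fin n) k ^ ((f.totalDegree + 1) * 2)).map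
      (toSeries k _) ≤ ann f * ann (contract D f) := by
    refine (map_pow_le_ann_pow f 2).trans ?_
    rw [sq]
    exact Ideal.mul_mono_right (ann_le_ann_contract f D)
  have hcomap : (ann f ⊓ ann (contract D f) ^ 2 ⊓ (ann f ^ 2).colon {D}).comap (toSeries k _) =
      annPoly f ⊓ annPoly (contract D f) ^ 2 ⊓ (annPoly f ^ 2).colon {p} := by
    rw [Ideal.comap_inf, Ideal.comap_inf, hJ2, hcolon]
  rw [← hcomap, ← hIJ]
  refine ⟨fun h => by rw [h], fun h => le_antisymm ?_ hle⟩
  rw [le_iff_comap_toSeries_le (hpow.trans hle), h]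

end Condition

/-! ### Admissible exponents -/

theorem Admissible.natCast_sub_one_ne_zero {k : Type u} [Field k] {d : ℕ} (h : Admissible k d) :
    ((d - 1 : ℕ) : k) ≠ 0 := by
  obtain ⟨h2, h⟩ := h
  rw [Ne, ringChar.spec]
  intro hdvd
  have hle := Nat.le_of_dvd (by omega) hdvd
  rcases h with h | h
  · rw [h, zero_dvd_iff] at hdvd
    omega
  · omega

theorem admissible_two (k : Type u) [Field k] : Admissible k 2 := by
  refine ⟨le_rfl, ?_⟩
  rcases CharP.char_is_prime_or_zero k (ringChar k) with h | h
  · exact Or.inr h.two_le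
  · exact Or.inl h

end RayFamily

end

theorem mainTheorem6 {k : Type u} [Field k] [IsAlgClosed k]
    (hchar2 : ringChar k ≠ 2) (hchar3 : ringChar k ≠ 3)
    {n : ℕ} (f : MvPolynomial (Fin n) k) (hf0 : f ≠ 0) (D : MvPowerSeries (Fin n) k)
    (hD : RayFamily.contract (D ^ 2) f = 0)
    (hf : RayFamily.IsUnobstructed (RayFamily.apolarPresentation f))
    (hDf : RayFamily.IsUnobstructed (RayFamily.apolarPresentation (RayFamily.contract D f))) :
    List.TFAE [
      -- the ray sum is unobstructed, for some and for every admissible `d`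
      ∃ d, RayFamily.Admissible k d ∧
        RayFamily.IsUnobstructed (RayFamily.apolarPresentation (RayFamily.raySum d f D)),
      ∀ d, RayFamily.Admissible k d →
        RayFamily.IsUnobstructed (RayFamily.apolarPresentation (RayFamily.raySum d f D)),
      -- flatness of the conormal module over `k[t]`
      ∃ d, RayFamily.Admissible k d ∧
        Module.Flat (Polynomial k) (RayFamily.raySumLowerIdeal d f D).Cotangent,
      ∀ d, RayFamily.Admissible k d →
        Module.Flat (Polynomial k) (RayFamily.raySumLowerIdeal d f D).Cotangent,
      -- flatness of the quotient by the square of the ideal over `k[t]`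
      ∃ d, RayFamily.Admissible k d ∧
        Module.Flat (Polynomial k)
          (MvPolynomial (Option (Fin n)) (Polynomial k) ⧸
            (RayFamily.raySumLowerIdeal d f D) ^ 2),
      ∀ d, RayFamily.Admissible k d →
        Module.Flat (Polynomial k)
          (MvPolynomial (Option (Fin n)) (Polynomial k) ⧸
            (RayFamily.raySumLowerIdeal d f D) ^ 2),
      -- the inclusion of ideals of `S`, and the corresponding equality
      RayFamily.ann f ⊓ RayFamily.ann (RayFamily.contract D f) ^ 2 ⊓
          (RayFamily.ann f ^ 2).colon {D} ≤
        RayFamily.ann f * RayFamily.ann (RayFamily.contract D f),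
      RayFamily.ann f ⊓ RayFamily.ann (RayFamily.contract D f) ^ 2 ⊓
          (RayFamily.ann f ^ 2).colon {D} =
        RayFamily.ann f * RayFamily.ann (RayFamily.contract D f)] := by
  -- replace `∂` by a polynomial that is congruent to it modulo `Ann(f) ^ 2`
  obtain ⟨p, hp⟩ := RayFamily.exists_add_of_map_le (RayFamily.map_pow_le_ann_pow f 2) D
  have hcond := RayFamily.ann_inf_eq_iff hp
  have hle := RayFamily.mul_ann_le f D
  have key := fun d (hd : RayFamily.Admissible k d) =>
    RayFamily.tfae_of_admissible hf0 hD hf hDf hd.1 hd.natCast_sub_one_ne_zero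
      (Ideal.pow_le_self two_ne_zero hp)
  -- the condition on the ideals does not depend on `d`
  have hexists : ∀ {P : ℕ → Prop} {Q : Prop}, (∀ d, RayFamily.Admissible k d → (P d ↔ Q)) →
      ((∃ d, RayFamily.Admissible k d ∧ P d) ↔ Q) := fun h =>
    ⟨fun ⟨d, hd, hP⟩ => (h d hd).mp hP,
      fun hQ => ⟨2, RayFamily.admissible_two k, (h 2 (RayFamily.admissible_two k)).mpr hQ⟩⟩
  have hforall : ∀ {P : ℕ → Prop} {Q : Prop}, (∀ d, RayFamily.Admissible k d → (P d ↔ Q)) →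
      ((∀ d, RayFamily.Admissible k d → P d) ↔ Q) := fun h =>
    ⟨fun hP => (h 2 (RayFamily.admissible_two k)).mp (hP 2 (RayFamily.admissible_two k)),
      fun hQ d hd => (h d hd).mpr hQ⟩
  rw [hexists fun d hd => (key d hd).1, hforall fun d hd => (key d hd).1,
    hexists fun d hd => (key d hd).2.1, hforall fun d hd => (key d hd).2.1,
    hexists fun d hd => (key d hd).2.2, hforall fun d hd => (key d hd).2.2, ← hcond]
  tfae_have 7 ↔ 8 := ⟨fun h => le_antisymm h hle, fun h => h.le⟩
  tfae_have 1 ↔ 8 := Iff.rfl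
  tfae_have 2 ↔ 8 := Iff.rfl
  tfae_have 3 ↔ 8 := Iff.rfl
  tfae_have 4 ↔ 8 := Iff.rfl
  tfae_have 5 ↔ 8 := Iff.rfl
  tfae_have 6 ↔ 8 := Iff.rfl
  tfae_finish
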